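/- **Model.** Let $n,K,T\ge 1$, $s\ge 0$ be integers. For $t=1,\dots,T$ let $\Theta_t\in\{0,1\}^{n\times K}$ be a (nonrandom) clustering matrix (exactly one 1 per row), $G_{t,k}=\{i:\Theta_t(i,k)=1\}$, $n_t(k)=|G_{t,k}|$, $n_{t,\max}=\max_k n_t(k)$, and let $B_t\in[0,1]^{K\times K}$ be symmetric, $P_t=\Theta_tB_t\Theta_t^{T}$. The observed symmetric matrices $A_t$ have independent Bernoulli entries, $\Pr(A_t(i,j)=1)=P_t(i,j)$, for $1\le i<j\le n$, $1\le t\le T$, and all their diagonal entries are equal to a constant $d$ (for instance $d=10$). Let $\alpha_n>0$, $H_t=\alpha_n^{-1}B_t$, and assume, for all $t$: * $C_\alpha^{-1}\alpha_n\le\max_{k,k'}|B_t(k,k')|\le C_\alpha\alpha_n$ and $\alpha_n\ge C_\alpha^{-1}c_0\log n/n$; * for $k\le k'$ there is a function $f(\cdot;k,k')$ on $[0,1]$ with $H_t(k,k')=f(t/T;k,k')$ for all $t$, which is $l$ times differentiable with $|f^{(l)}(x)-f^{(l)}(x')|\le L|x-x'|^{\beta-l}$, where $l$ is the largest integer strictly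 smaller than $\beta$; * at most $s$ nodes change community between two consecutive times; * all eigenvalues of $H_t$ lie in $[C_\lambda^{-1},C_\lambda]$; * the communities are balanced: $C_1 n/K\le n_t(k)\le C_2 n/K$ for all $k$. Here $\tau,c_0,W_{\max},\beta,C_1,C_2>0$, $L\ge0$ and $C_\alpha,C_\lambda\ge1$. **Estimator.** For an integer $r\ge 0$ let $F_{r,1}=\{-r,\dots,r\}$, $F_{r,2}=\{0,\dots,r\}$, $F_{r,3}=\{-r,\dots,0\}$, $D_{r,1}=\{1+r,\dots,T-r\}$, $D_{r,2}=\{1,\dots,r\}$, $D_{r,3}=\{T-r+1,\dots,T\}$. Let $W^{(j)}_r$ be functions on $F_{r,j}$ with $|W^{(j)}_r|\le W_{\max}$ and $|F_{r,j}|^{-1}\sum_{i\in F_{r,j}}i^kW^{(j)}_r(i)$ equal to $1$ for $k=0$ and to $0$ for $k=1,\dots,l$. For $r\le T/2$ and $t\in D_{r,j}$ put $\widehat P_{t,r}=|F_{r,j}|^{-1}\sum_{i\in F_{r,j}}W^{(j)}_r(i)A_{t+i}$, and let $P_{t,r}$ be the same average of the $P_{t+i}$. Given $C_0>0$, the width $r=r_t$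 is either the adaptive one, $$\hat r_t=\max\Big\{0\le r\le T/2:\ \|\widehat P_{t,r}-\widehat P_{t,\rho}\|\le 4C_0\sqrt{n\alpha_n/(\rho\vee1)}\ \text{ for all } 0\le\rho<r\Big\}$$ (for all $t$), or a nonrandom minimizer over $0\le r\le T/2$ of $\|P_{t,r}-P_t\|+C_0\sqrt{n\alpha_n/(r\vee1)}$ (for all $t$); $\|\cdot\|$ is the spectral norm. **Clustering.** Let $\epsilon\ge0$. Let $U_t\in\mathbb R^{n\times K}$ consist of $K$ orthonormal eigenvectors of $\widehat P_{t,r_t}$ for its $K$ largest eigenvalues, and let $\widehat\Theta_t$ be the clustering matrix in any $(1+\epsilon)$-approximate solution of the $K$-means problem, i.e. for some $\widehat X\in\mathbb R^{K\times K}$, $\|\widehat\Theta_t\widehat X-U_t\|_F^2\le(1+\epsilon)\min_{\Theta,X}\|\Theta X-U_t\|_F^2$, the minimum being over all clustering matrices $\Theta$ and all $X\in\mathbb R^{K\times K}$. With $\|\cdot\|_0$ the number of nonzero entries and $J$ ranging over $K\times K$ permutation matrices, put $$R_t=\frac1n\min_J\|\widehat\Theta_tJ-\Theta_t\|_0,\qquad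 \tilde R_t=\min_J\max_k\frac1{n_t(k)}\|(\widehat\Theta_tJ-\Theta_t)_{G_{t,k},*}\|_0,\qquad \tilde R_{\max}=\max_{1\le t\le T}\tilde R_t.$$ **Claim.** Let $Z=\Big(\dfrac{n\alpha_n}{T^{2\beta}}\Big)^{1/(2\beta+1)}+\sqrt{\dfrac{s\alpha_n}{K}}$ and assume that either $Z\ge\alpha_n/n$, or $\epsilon\le n$ and $n_t(k)\ge C_\lambda^2$ for all $t,k$. For every $C_0$ larger than some constant depending only on $\tau,c_0,C_\alpha,W_{\max}$ there is a constant $\tilde C_R>0$, depending only on $C_0$, $\tau,c_0,W_{\max},\beta,L,C_\alpha,C_\lambda,C_1,C_2$, such that, with $$\Psi=\tilde C_R\,(2+\epsilon)\,\frac{K^3}{n\alpha_n}\,\min\{1,\,Z\},$$ for every $t=1,\dots,T$, with probability at least $1-4n^{-\tau}$, one has $\tilde R_t\le\Psi$ and, if $\Psi\le1$, also $R_t\le\Psi\,n_{t,\max}/n$. Moreover, for every $\tau_1$ with $T\le n^{\tau_1}$, with probability at least $1-4n^{-(\tau-\tau_1)}$ one has $\tilde R_{\max}\le\Psi$. -/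

import Mathlib

open MeasureTheory ProbabilityTheory

noncomputable section

namespace DSBM

/-! Matrix norms -/

/-- Spectral norm: the operator norm of `M` on Euclidean space. -/
def specNorm {n : ℕ} (M : Matrix (Fin n) (Fin n) ℝ) : ℝ :=
  ‖Matrix.toEuclideanCLM (n := Fin n) (𝕜 := ℝ) M‖

/-- Squared Frobenius norm. -/
def frobSq {m k : ℕ} (M : Matrix (Fin m) (Fin k) ℝ) : ℝ :=
  ∑ i, ∑ j, M i j ^ 2

/-- Largest entry in absolute value. -/
def maxEntry {m k : ℕ} (M : Matrix (Fin m) (Fin k) ℝ) : ℝ :=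
  ⨆ p : Fin m × Fin k, |M p.1 p.2|

/-- Number of nonzero entries in the rows belonging to `S`. -/
def nnzOn {m k : ℕ} (S : Finset (Fin m)) (M : Matrix (Fin m) (Fin k) ℝ) : ℕ :=
  ((S ×ˢ (Finset.univ : Finset (Fin k))).filter fun p => M p.1 p.2 ≠ 0).card

/-! Communities -/

/-- The clustering matrix of a label function. The matrices with entries in `{0, 1}` and exactly
one `1` in each row are exactly the matrices of this form. -/
def clusterMatrix {n K : ℕ} (g : Fin n → Fin K) : Matrix (Fin n) (Fin K) ℝ :=
  Matrix.of fun i k => if g i = k then 1 else 0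

/-- The set of nodes of community `k`. -/
def community {n K : ℕ} (g : Fin n → Fin K) (k : Fin K) : Finset (Fin n) :=
  Finset.univ.filter fun i => g i = k

/-- The size of the largest community. -/
def maxSize {n K : ℕ} (g : Fin n → Fin K) : ℕ :=
  Finset.univ.sup fun k => (community g k).card

/-- The matrix of edge probabilities `Θ B Θᵀ`. -/
def edgeProb {n K : ℕ} (g : Fin n → Fin K) (B : Matrix (Fin K) (Fin K) ℝ) :
    Matrix (Fin n) (Fin n) ℝ :=
  clusterMatrix g * B * (clusterMatrix g).transpose

/-! The random dynamic network; time runs through `1, …, T` -/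

/-- Indices of the free edge variables: a time in `1, …, T` and a pair `i < j`. -/
abbrev EdgeIndex (n T : ℕ) : Type :=
  {p : ℤ × Fin n × Fin n // (1 ≤ p.1 ∧ p.1 ≤ (T : ℤ)) ∧ p.2.1 < p.2.2}

/-- `A t`, `1 ≤ t ≤ T`, are the symmetric adjacency matrices of a dynamic network: the entries above
the diagonal are independent Bernoulli variables with success probabilities `P t i j`,
and all the diagonal entries are set to the constant `d`. -/
structure IsDynamicNetwork {Ω : Type*} [MeasurableSpace Ω] (μ : Measure Ω) {n : ℕ} (T : ℕ)
    (d : ℝ) (P : ℤ → Matrix (Fin n) (Fin n) ℝ) (A : ℤ → Ω → Matrix (Fin n) (Fin n) ℝ) : Prop where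
  measurable : ∀ t ∈ Set.Icc (1 : ℤ) T, ∀ i j, Measurable fun ω => A t ω i j
  symm : ∀ t ∈ Set.Icc (1 : ℤ) T, ∀ ω i j, A t ω i j = A t ω j i
  diag : ∀ t ∈ Set.Icc (1 : ℤ) T, ∀ ω i, A t ω i i = d
  binary : ∀ t ∈ Set.Icc (1 : ℤ) T, ∀ ω i j, i ≠ j → A t ω i j = 0 ∨ A t ω i j = 1
  prob : ∀ t ∈ Set.Icc (1 : ℤ) T, ∀ i j, i < j →
    μ {ω | A t ω i j = 1} = ENNReal.ofReal (P t i j)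
  indep : iIndepFun (fun (e : EdgeIndex n T) ω => A e.1.1 ω e.1.2.1 e.1.2.2) μ

/-! Smoothness and stability in time -/

/-- The largest integer strictly smaller than `β` (for `β > 0`). -/
def holderOrder (β : ℝ) : ℕ := ⌈β⌉₊ - 1

/-- The Hölder class `Σ(β, L)` on `[0, 1]`. -/
def HolderClass (β L : ℝ) : Set (ℝ → ℝ) :=
  {f | ContDiffOn ℝ (holderOrder β : ℕ∞) f (Set.Icc 0 1) ∧
    ∀ x ∈ Set.Icc (0 : ℝ) 1, ∀ y ∈ Set.Icc (0 : ℝ) 1,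
      |iteratedDerivWithin (holderOrder β) f (Set.Icc 0 1) x -
        iteratedDerivWithin (holderOrder β) f (Set.Icc 0 1) y| ≤
          L * |x - y| ^ (β - (holderOrder β : ℝ))}

/-- The rescaled connection probabilities `H t` are values of Hölder functions at `t / T`. -/
def SmoothInTime {K : ℕ} (β L : ℝ) (T : ℕ) (H : ℤ → Matrix (Fin K) (Fin K) ℝ) : Prop :=
  ∀ k k' : Fin K, k ≤ k' → ∃ f ∈ HolderClass β L,
    ∀ t ∈ Set.Icc (1 : ℤ) T, H t k k' = f ((t : ℝ) / (T : ℝ))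

/-- At most `s` nodes change their community between two consecutive time instants. -/
def AtMostSwitches {n K : ℕ} (s T : ℕ) (g : ℤ → Fin n → Fin K) : Prop :=
  ∀ t : ℤ, 1 ≤ t → t + 1 ≤ (T : ℤ) →
    (Finset.univ.filter fun i => g t i ≠ g (t + 1) i).card ≤ s

/-! Kernel estimators -/

/-- The windows `{-r, …, r}`, `{0, …, r}`, `{-r, …, 0}` (interior, left and right boundary). -/
def window (r : ℕ) : Fin 3 → Finset ℤ :=
  ![Finset.Icc (-(r : ℤ)) r, Finset.Icc 0 (r : ℤ), Finset.Icc (-(r : ℤ)) 0]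

/-- The sets of times `{1 + r, …, T - r}`, `{1, …, r}`, `{T - r + 1, …, T}`. -/
def timeDomain (T r : ℕ) : Fin 3 → Finset ℤ :=
  ![Finset.Icc (1 + (r : ℤ)) ((T : ℤ) - r), Finset.Icc 1 (r : ℤ),
    Finset.Icc ((T : ℤ) - r + 1) (T : ℤ)]

/-- Discrete kernels `W j r i` of order `l`, bounded by `Wmax`. -/
def IsDiscreteKernel (l : ℕ) (Wmax : ℝ) (W : Fin 3 → ℕ → ℤ → ℝ) : Prop :=
  ∀ j r, (∀ i ∈ window r j, |W j r i| ≤ Wmax) ∧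
    ∀ k ≤ l, ((window r j).card : ℝ)⁻¹ * ∑ i ∈ window r j, (i : ℝ) ^ k * W j r i =
      if k = 0 then 1 else 0

/-- The kernel average of the matrices `X` at time `t` with window width `r`. -/
def smooth {n : ℕ} (W : Fin 3 → ℕ → ℤ → ℝ) (T r : ℕ) (X : ℤ → Matrix (Fin n) (Fin n) ℝ)
    (t : ℤ) : Matrix (Fin n) (Fin n) ℝ :=
  ∑ j : Fin 3, if t ∈ timeDomain T r j then
    ((window r j).card : ℝ)⁻¹ • ∑ i ∈ window r j, W j r i • X (t + i) else 0

/-- `C₀ √(n α / (r ∨ 1))`, the bound on the stochastic error at window width `r`. -/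
def noiseLevel (C₀ : ℝ) (n : ℕ) (α : ℝ) (r : ℕ) : ℝ :=
  C₀ * Real.sqrt ((n : ℝ) * α / (max r 1 : ℕ))

/-- The window width chosen by Lepskii's method from the matrices `A` at time `t`: the largest
`r ≤ T / 2` such that the estimator is within `4 C₀ √(n α / (ρ ∨ 1))` of that of width `ρ`,
for all `ρ < r`. -/
def IsLepskiWidth {n : ℕ} (C₀ α : ℝ) (W : Fin 3 → ℕ → ℤ → ℝ) (T : ℕ)
    (A : ℤ → Matrix (Fin n) (Fin n) ℝ) (t : ℤ) (r : ℕ) : Prop :=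
  IsGreatest {r : ℕ | 2 * r ≤ T ∧ ∀ ρ < r,
    specNorm (smooth W T r A t - smooth W T ρ A t) ≤ 4 * noiseLevel C₀ n α ρ} r

/-- The oracle window width at time `t`: a minimizer of the sum of the bias and of the bound on the
stochastic error. -/
def IsOracleWidth {n : ℕ} (C₀ α : ℝ) (W : Fin 3 → ℕ → ℤ → ℝ) (T : ℕ)
    (P : ℤ → Matrix (Fin n) (Fin n) ℝ) (t : ℤ) (r : ℕ) : Prop :=
  2 * r ≤ T ∧ ∀ ρ : ℕ, 2 * ρ ≤ T →
    specNorm (smooth W T r P t - P t) + noiseLevel C₀ n α r ≤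
      specNorm (smooth W T ρ P t - P t) + noiseLevel C₀ n α ρ

/-! Spectral clustering -/

/-- The columns of `U` are the first `K` eigenvectors of the symmetric matrix `M`: they are
orthonormal eigenvectors, with nonincreasing eigenvalues, and no eigenvector orthogonal to all of
them belongs to a larger eigenvalue. -/
def IsLeadingEigenvectors {n K : ℕ} (M : Matrix (Fin n) (Fin n) ℝ)
    (U : Matrix (Fin n) (Fin K) ℝ) : Prop :=
  U.transpose * U = 1 ∧ ∃ lam : Fin K → ℝ, Antitone lam ∧ M * U = U * Matrix.diagonal lam ∧
    ∀ (v : Fin n → ℝ) (x : ℝ), v ≠ 0 → M.mulVec v = x • v → U.transpose.mulVec v = 0 →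
      ∀ k, x ≤ lam k

/-- `g` is the clustering of a `(1 + ε)`-approximate solution of the `K`-means problem for the rows
of `U`. -/
def IsApproxKMeans {n K : ℕ} (ε : ℝ) (U : Matrix (Fin n) (Fin K) ℝ) (g : Fin n → Fin K) : Prop :=
  ∃ X : Matrix (Fin K) (Fin K) ℝ, ∀ (g' : Fin n → Fin K) (X' : Matrix (Fin K) (Fin K) ℝ),
    frobSq (clusterMatrix g * X - U) ≤ (1 + ε) * frobSq (clusterMatrix g' * X' - U)

/-- `g` is a possible output of `(1 + ε)`-approximate spectral clustering of `M`. -/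
def IsSpectralClustering {n K : ℕ} (ε : ℝ) (M : Matrix (Fin n) (Fin n) ℝ)
    (g : Fin n → Fin K) : Prop :=
  ∃ U : Matrix (Fin n) (Fin K) ℝ, IsLeadingEigenvectors M U ∧ IsApproxKMeans ε U g

/-! Clustering errors -/

/-- `Θ̂ J - Θ`, with `J` the permutation matrix of `σ`. -/
def errorMatrix {n K : ℕ} (ghat g : Fin n → Fin K) (σ : Equiv.Perm (Fin K)) :
    Matrix (Fin n) (Fin K) ℝ :=
  clusterMatrix ghat * σ.permMatrix ℝ - clusterMatrix g

/-- The overall relative clustering error `R`. -/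
def overallError {n K : ℕ} (ghat g : Fin n → Fin K) : ℝ :=
  (n : ℝ)⁻¹ * ⨅ σ : Equiv.Perm (Fin K), (nnzOn Finset.univ (errorMatrix ghat g σ) : ℝ)

/-- The highest relative clustering error over the communities, `R̃`. -/
def communityError {n K : ℕ} (ghat g : Fin n → Fin K) : ℝ :=
  ⨅ σ : Equiv.Perm (Fin K), ⨆ k : Fin K,
    ((community g k).card : ℝ)⁻¹ * (nnzOn (community g k) (errorMatrix ghat g σ) : ℝ)

/-- The highest value of `R̃` over the times `1, …, T`. -/
def maxCommunityError {n K : ℕ} (T : ℕ) (ghat g : ℤ → Fin n → Fin K) : ℝ :=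
  ⨆ t : Set.Icc (1 : ℤ) T, communityError (ghat t) (g t)

/-! The error bound -/

/-- `(n α / T ^ (2β)) ^ (1 / (2β + 1)) + √(s α / K)`. -/
def temporalRate (n K T s : ℕ) (α β : ℝ) : ℝ :=
  ((n : ℝ) * α / (T : ℝ) ^ (2 * β)) ^ (1 / (2 * β + 1)) + Real.sqrt ((s : ℝ) * α / (K : ℝ))

/-- `C (2 + ε) K³ / (n α) min{1, (n α / T ^ (2β)) ^ (1 / (2β + 1)) + √(s α / K)}`. -/
def errorBound (C ε : ℝ) (n K T s : ℕ) (α β : ℝ) : ℝ :=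
  C * (2 + ε) * ((K : ℝ) ^ 3 / ((n : ℝ) * α)) * min 1 (temporalRate n K T s α β)

end DSBM

end

/-! The weights of a kernel average to 1, so the smoothed adjacency matrix has diagonal exactly `d`
and is compared with `d • 1 + offDiag (P t)`. The difference splits into noise and bias, both off
the diagonal (`smooth_adjacency_sub_eq`). The multiple of the identity only shifts the eigenvalues.
The diagonal removed from `P t` is constant on communities, so vectors constant on communities still
form an invariant subspace.

Noise. `exists_specNorm_noise_concentration` bounds the noise at width `r` by a constant times `√(n
α / (r ∨ 1))`, without a logarithm, by the Kahn–Szemerédi method. The bilinear form is tested on a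
net of the unit ball. Pairs with small `|x i * y j|` are handled by Bernstein's inequality. Pairs
with large `|x i * y j|` are handled deterministically from bounded degrees and bounded edge
discrepancy (`sum_heavy_pairs_le`). The failure exponent grows linearly with the constant `C₀`.

Bias. `specNorm_bias_le` separates the switches of communities from the drift of `B`. Switches are
estimated in Frobenius norm, where the spectral bound on the rows of `B` gains a factor `1 / K`. The
drift is estimated by a Taylor expansion whose polynomial part is killed by the kernel moments.

Width. With `Z` the temporal rate, a width of order `c / Z` makes the bias at most half the noise
level. The adaptive and the oracle widths both match this choice up to a factor
(`specNorm_lepski_le`, `specNorm_oracle_le`). Since `T` may be huge compared with `n`, the reference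
width is truncated at a level `R` polynomial in `n`, so that the adaptive choice needs control of
polynomially many widths only.

Clustering. A `sin Θ` bound (`sum_sq_sub_blockMean_le`) shows that the leading eigenvectors are
nearly constant on communities. Their community means are well separated
(`inv_card_add_le_sum_sq_sub`), hence approximate `K`-means misplaces few nodes
(`exists_perm_of_isApproxKMeans`).

Degenerate cases. If the truncation at `R` is active, the error is so small that no node is
misclustered. If some community has fewer than `Cl ^ 2` nodes, `K` is of order `n` and the asserted
bound exceeds the trivial bound 2. The alternative hypothesis on `Z`, `ε` and the community sizes is
what makes these two arguments available when needed. -/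

namespace DSBM

/-! Spectral norm -/

lemma specNorm_nonneg {n : ℕ} (M : Matrix (Fin n) (Fin n) ℝ) : 0 ≤ specNorm M := norm_nonneg _

lemma specNorm_zero {n : ℕ} : specNorm (0 : Matrix (Fin n) (Fin n) ℝ) = 0 := by
  simp [specNorm]

lemma specNorm_add_le {n : ℕ} (M N : Matrix (Fin n) (Fin n) ℝ) :
    specNorm (M + N) ≤ specNorm M + specNorm N := by
  simp only [specNorm, map_add]
  exact norm_add_le _ _

lemma specNorm_sub_le {n : ℕ} (M N : Matrix (Fin n) (Fin n) ℝ) :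
    specNorm (M - N) ≤ specNorm M + specNorm N := by
  simp only [specNorm, map_sub]
  exact norm_sub_le _ _

lemma specNorm_smul {n : ℕ} (c : ℝ) (M : Matrix (Fin n) (Fin n) ℝ) :
    specNorm (c • M) = |c| * specNorm M := by
  simp only [specNorm, map_smul, norm_smul, Real.norm_eq_abs]

lemma norm_toLp_eq_sqrt {n : ℕ} (x : Fin n → ℝ) :
    ‖(WithLp.toLp 2 x : EuclideanSpace ℝ (Fin n))‖ = √(∑ i, x i ^ 2) := by
  simp [EuclideanSpace.norm_eq]

lemma abs_dotProduct_mulVec_le {n : ℕ} (M : Matrix (Fin n) (Fin n) ℝ) (x y : Fin n → ℝ) :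
    |x ⬝ᵥ M.mulVec y| ≤ specNorm M * (√(∑ i, x i ^ 2) * √(∑ i, y i ^ 2)) := by
  have h := Matrix.inner_toEuclideanCLM M (WithLp.toLp 2 x) (WithLp.toLp 2 y)
  simp only at h
  rw [← h, ← norm_toLp_eq_sqrt, ← norm_toLp_eq_sqrt]
  refine (abs_real_inner_le_norm _ _).trans ?_
  have h2 := (Matrix.toEuclideanCLM (n := Fin n) (𝕜 := ℝ) M).le_opNorm (WithLp.toLp 2 y)
  calc _ ≤ ‖(WithLp.toLp 2 x : EuclideanSpace ℝ (Fin n))‖ * (specNorm M * ‖WithLp.toLp 2 y‖) := by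
        gcongr; exact h2
    _ = _ := by ring

lemma sqrt_sum_mulVec_sq_le {n : ℕ} (M : Matrix (Fin n) (Fin n) ℝ) (x : Fin n → ℝ) :
    √(∑ i, (M.mulVec x) i ^ 2) ≤ specNorm M * √(∑ i, x i ^ 2) := by
  have h2 := (Matrix.toEuclideanCLM (n := Fin n) (𝕜 := ℝ) M).le_opNorm (WithLp.toLp 2 x)
  rwa [Matrix.toEuclideanCLM_toLp, norm_toLp_eq_sqrt, norm_toLp_eq_sqrt] at h2

lemma specNorm_le_of_forall {n : ℕ} (M : Matrix (Fin n) (Fin n) ℝ) {C : ℝ} (hC : 0 ≤ C)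
    (h : ∀ x : Fin n → ℝ, ∑ i, (M.mulVec x) i ^ 2 ≤ C ^ 2 * ∑ i, x i ^ 2) : specNorm M ≤ C := by
  refine ContinuousLinearMap.opNorm_le_bound _ hC fun x => ?_
  have h1 : x = WithLp.toLp 2 (WithLp.ofLp x) := rfl
  rw [h1, Matrix.toEuclideanCLM_toLp, norm_toLp_eq_sqrt, norm_toLp_eq_sqrt]
  refine (Real.sqrt_le_sqrt (h _)).trans ?_
  rw [Real.sqrt_mul (sq_nonneg C), Real.sqrt_sq hC]

lemma frobSq_nonneg {m k : ℕ} (M : Matrix (Fin m) (Fin k) ℝ) : 0 ≤ frobSq M :=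
  Finset.sum_nonneg fun _ _ => Finset.sum_nonneg fun _ _ => sq_nonneg _

lemma specNorm_le_sqrt_frobSq {n : ℕ} (M : Matrix (Fin n) (Fin n) ℝ) :
    specNorm M ≤ √(frobSq M) := by
  refine specNorm_le_of_forall M (Real.sqrt_nonneg _) fun x => ?_
  rw [Real.sq_sqrt (frobSq_nonneg M), frobSq, Finset.sum_mul]
  refine Finset.sum_le_sum fun i _ => ?_
  exact Finset.sum_mul_sq_le_sq_mul_sq Finset.univ (M i) x

lemma abs_apply_le_specNorm {n : ℕ} (M : Matrix (Fin n) (Fin n) ℝ) (i j : Fin n) :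
    |M i j| ≤ specNorm M := by
  have h := abs_dotProduct_mulVec_le M (Pi.single i 1) (Pi.single j 1)
  have h1 : ∀ i : Fin n, ∑ k, (Pi.single i (1 : ℝ) : Fin n → ℝ) k ^ 2 = 1 := by
    intro i
    simp [Pi.single_apply]
  rw [h1, h1] at h
  simpa using h

lemma specNorm_diagonal_le {n : ℕ} (v : Fin n → ℝ) {C : ℝ} (hC : 0 ≤ C) (h : ∀ i, |v i| ≤ C) :
    specNorm (Matrix.diagonal v) ≤ C := by
  refine specNorm_le_of_forall _ hC fun x => ?_
  rw [Finset.mul_sum]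
  refine Finset.sum_le_sum fun i _ => ?_
  rw [Matrix.mulVec_diagonal, mul_pow]
  gcongr ?_ * _
  exact sq_le_sq.2 ((h i).trans (le_abs_self C))

/-- The matrix `M` with its diagonal entries replaced by `0`. -/
def offDiag {n : ℕ} (M : Matrix (Fin n) (Fin n) ℝ) : Matrix (Fin n) (Fin n) ℝ :=
  M - Matrix.diagonal fun i => M i i

lemma offDiag_apply {n : ℕ} (M : Matrix (Fin n) (Fin n) ℝ) (i j : Fin n) :
    offDiag M i j = if i = j then 0 else M i j := by
  by_cases h : i = j
  · subst h; simp [offDiag]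
  · simp [offDiag, h]

lemma specNorm_offDiag_le {n : ℕ} (M : Matrix (Fin n) (Fin n) ℝ) :
    specNorm (offDiag M) ≤ 2 * specNorm M := by
  have h1 := specNorm_sub_le M (Matrix.diagonal fun i => M i i)
  have h2 := specNorm_diagonal_le (fun i => M i i) (specNorm_nonneg M)
    fun i => abs_apply_le_specNorm M i i
  unfold offDiag
  linarith

/-! A net of the unit ball -/

/-- A maximal 1-separated set in the ball of radius 2 is a 1-net of that ball, and such sets have at
most `5 ^ n` points; halving the points gives a net of the unit ball of mesh 1/2. The cardinalities
are bounded, so a set of maximal cardinality is found with `Nat.findGreatest`. -/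
lemma exists_net (n : ℕ) : ∃ N : Finset (Fin n → ℝ), N.card ≤ 5 ^ n ∧
    (∀ x ∈ N, ∑ i, x i ^ 2 ≤ 1) ∧
    ∀ x : Fin n → ℝ, ∑ i, x i ^ 2 ≤ 1 → ∃ y ∈ N, ∑ i, (x i - y i) ^ 2 ≤ 1 / 4 := by
  classical
  let E := EuclideanSpace ℝ (Fin n)
  let p : ℕ → Prop := fun k => ∃ s : Finset E, s.card = k ∧ (∀ c ∈ s, ‖c‖ ≤ 2) ∧
    ∀ c ∈ s, ∀ d ∈ s, c ≠ d → 1 ≤ ‖c - d‖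
  have hp : ∀ k, p k → k ≤ 5 ^ n := by
    rintro k ⟨s, rfl, h1, h2⟩
    simpa [E] using Besicovitch.card_le_of_separated s h1 h2
  have h0 : p 0 := ⟨∅, by simp⟩
  obtain ⟨s, hs, h1, h2⟩ : p (Nat.findGreatest p (5 ^ n)) :=
    Nat.findGreatest_spec (Nat.zero_le _) h0
  refine ⟨s.image fun c i => c i / 2, ?_, ?_, ?_⟩
  · exact Finset.card_image_le.trans (by rw [hs]; exact Nat.findGreatest_le _)
  · intro x hx
    obtain ⟨c, hc, rfl⟩ := Finset.mem_image.1 hx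
    have := h1 c hc
    have h3 : ‖c‖ ^ 2 = ∑ i, c i ^ 2 := EuclideanSpace.real_norm_sq_eq c
    simp only [div_pow]
    rw [← Finset.sum_div, ← h3]
    nlinarith [norm_nonneg c]
  · intro x hx
    let c : E := WithLp.toLp 2 (fun i => 2 * x i)
    have hc2 : ‖c‖ ≤ 2 := by
      have h3 : ‖c‖ ^ 2 = ∑ i, c i ^ 2 := EuclideanSpace.real_norm_sq_eq c
      simp only [c, mul_pow, ← Finset.mul_sum] at h3
      exact abs_le_of_sq_le_sq' (by rw [h3]; linarith) (by norm_num) |>.2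
    by_contra! hcon
    have hfar : ∀ e ∈ s, 1 < ‖c - e‖ := by
      intro e he
      have h4 := hcon _ (Finset.mem_image_of_mem _ he)
      have h3 : ‖c - e‖ ^ 2 = ∑ i, (c - e) i ^ 2 := EuclideanSpace.real_norm_sq_eq _
      have h5 : ∑ i, (c - e) i ^ 2 = 4 * ∑ i, (x i - e i / 2) ^ 2 := by
        rw [Finset.mul_sum]
        refine Finset.sum_congr rfl fun i _ => ?_
        have h7 : (c - e) i = 2 * x i - e i := rfl
        rw [h7]
        ring
      by_contra! h6
      nlinarith [norm_nonneg (c - e)]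
    have hcs : c ∉ s := fun h => by
      have := hfar c h
      simp at this
      linarith
    have hp1 : p (Nat.findGreatest p (5 ^ n) + 1) := by
      refine ⟨insert c s, by rw [Finset.card_insert_of_notMem hcs, hs], ?_, ?_⟩
      · intro e he
        rcases Finset.mem_insert.1 he with rfl | he
        · exact hc2
        · exact h1 e he
      · intro e he f hf hef
        rcases Finset.mem_insert.1 he with rfl | he <;> rcases Finset.mem_insert.1 hf with rfl | hf
        · exact absurd rfl hef
        · exact (hfar f hf).le
        · rw [norm_sub_rev]; exact (hfar e he).le
        · exact h2 e he f hf hef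
    have := Nat.le_findGreatest (hp _ hp1) hp1
    omega

/-- The net is used twice. Approximating the direction of `M y` gives `|M y| ≤ 2 C` for `y` in the
net; approximating the direction of a general `x` then gives `‖M‖ ≤ 2 C + ‖M‖ / 2`. -/
lemma specNorm_le_of_net {n : ℕ} (N : Finset (Fin n → ℝ))
    (hN : ∀ x : Fin n → ℝ, ∑ i, x i ^ 2 ≤ 1 → ∃ y ∈ N, ∑ i, (x i - y i) ^ 2 ≤ 1 / 4)
    (M : Matrix (Fin n) (Fin n) ℝ) (C : ℝ)
    (h : ∀ x ∈ N, ∀ y ∈ N, |x ⬝ᵥ M.mulVec y| ≤ C) : specNorm M ≤ 4 * C := by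
  have hC : 0 ≤ C := by
    obtain ⟨y, hy, -⟩ := hN 0 (by simp)
    exact (abs_nonneg _).trans (h y hy y hy)
  have sqrt_le : ∀ x : Fin n → ℝ, ∑ i, x i ^ 2 ≤ 1 / 4 → √(∑ i, x i ^ 2) ≤ 1 / 2 := by
    intro x hx
    refine (Real.sqrt_le_sqrt hx).trans ?_
    rw [show (1 / 4 : ℝ) = (1 / 2) ^ 2 by norm_num, Real.sqrt_sq (by norm_num)]
  -- images of the points of the net
  have h1 : ∀ y ∈ N, √(∑ i, (M.mulVec y) i ^ 2) ≤ 2 * C := by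
    intro y hy
    set z := M.mulVec y with hz
    set a := √(∑ i, z i ^ 2) with ha
    by_cases ha0 : a = 0
    · rw [ha0]; positivity
    have hapos : 0 < a := lt_of_le_of_ne (Real.sqrt_nonneg _) (Ne.symm ha0)
    have hasq : a ^ 2 = ∑ i, z i ^ 2 :=
      Real.sq_sqrt (Finset.sum_nonneg fun _ _ => sq_nonneg _)
    obtain ⟨w, hw, hwd⟩ := hN (fun i => z i / a) (by
      simp only [div_pow]
      rw [← Finset.sum_div, ← hasq, div_self (by positivity)])
    have e1 : ∑ i, (z i / a) * z i = a := by
      calc ∑ i, (z i / a) * z i = (∑ i, z i ^ 2) / a := by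
            rw [Finset.sum_div]; exact Finset.sum_congr rfl fun i _ => by ring
        _ = a := by rw [← hasq]; field_simp
    have e2 : ∑ i, (z i / a) * z i = w ⬝ᵥ z + ∑ i, (z i / a - w i) * z i := by
      rw [dotProduct, ← Finset.sum_add_distrib]
      exact Finset.sum_congr rfl fun i _ => by ring
    have e3 : ∑ i, (z i / a - w i) * z i ≤ 1 / 2 * a := by
      refine (Real.sum_mul_le_sqrt_mul_sqrt _ _ _).trans ?_
      gcongr
      exact sqrt_le _ hwd
    have e4 := (abs_le.1 (h w hw y hy)).2
    linarith
  by_contra! hcon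
  have h2 : specNorm M ≤ 2 * C + specNorm M / 2 := by
    refine specNorm_le_of_forall M (by linarith [specNorm_nonneg M]) fun x => ?_
    set a := √(∑ i, x i ^ 2) with ha
    have hasq : a ^ 2 = ∑ i, x i ^ 2 :=
      Real.sq_sqrt (Finset.sum_nonneg fun _ _ => sq_nonneg _)
    have key : √(∑ i, (M.mulVec x) i ^ 2) ≤ (2 * C + specNorm M / 2) * a := by
      by_cases ha0 : a = 0
      · have := sqrt_sum_mulVec_sq_le M x
        rw [← ha, ha0] at this
        rw [ha0]; linarith
      have hapos : 0 < a := lt_of_le_of_ne (Real.sqrt_nonneg _) (Ne.symm ha0)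
      obtain ⟨w, hw, hwd⟩ := hN (fun i => x i / a) (by
        simp only [div_pow]
        rw [← Finset.sum_div, ← hasq, div_self (by positivity)])
      have e1 : M.mulVec x = a • (M.mulVec w + M.mulVec (fun i => x i / a - w i)) := by
        rw [← Matrix.mulVec_add, ← Matrix.mulVec_smul]
        congr 1
        ext i
        simp
        field_simp
      have e2 := h1 w hw
      have e3 := (sqrt_sum_mulVec_sq_le M (fun i => x i / a - w i)).trans
        (mul_le_mul_of_nonneg_left (sqrt_le _ hwd) (specNorm_nonneg M))
      rw [← norm_toLp_eq_sqrt] at e2 e3 ⊢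
      rw [e1, WithLp.toLp_smul, norm_smul, Real.norm_of_nonneg hapos.le, WithLp.toLp_add, mul_comm]
      gcongr
      refine (norm_add_le _ _).trans ?_
      linarith
    calc ∑ i, (M.mulVec x) i ^ 2 = √(∑ i, (M.mulVec x) i ^ 2) ^ 2 :=
          (Real.sq_sqrt (Finset.sum_nonneg fun _ _ => sq_nonneg _)).symm
      _ ≤ ((2 * C + specNorm M / 2) * a) ^ 2 := by gcongr
      _ = _ := by rw [mul_pow, hasq]
  linarith

/-! Exponential tail bounds -/

lemma integral_exp_mul_of_binary {Ω : Type*} [MeasurableSpace Ω] {μ : Measure Ω}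
    [IsProbabilityMeasure μ] {X : Ω → ℝ} (hX : Measurable X) (hbin : ∀ ω, X ω = 0 ∨ X ω = 1)
    {p : ℝ} (hp : 0 ≤ p) (hprob : μ {ω | X ω = 1} = ENNReal.ofReal p) (c : ℝ) :
    Integrable (fun ω => Real.exp (c * X ω)) μ ∧
      ∫ ω, Real.exp (c * X ω) ∂μ = 1 + p * (Real.exp c - 1) := by
  have hms : MeasurableSet {ω | X ω = 1} := hX (measurableSet_singleton 1)
  have e : (fun ω => Real.exp (c * X ω)) =
      fun ω => 1 + {ω | X ω = 1}.indicator (fun _ => Real.exp c - 1) ω := by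
    ext ω
    rcases hbin ω with h | h <;> simp [Set.indicator, h]
  have hi : Integrable ({ω | X ω = 1}.indicator (fun _ => Real.exp c - 1)) μ :=
    (integrable_const _).indicator hms
  rw [e]
  refine ⟨(integrable_const _).add hi, ?_⟩
  rw [integral_add (integrable_const _) hi, integral_indicator_const _ hms, measureReal_def, hprob,
    ENNReal.toReal_ofReal hp]
  simp

/-- Exponential Markov inequality at parameter 1, with `1 + x ≤ exp x` for each factor. The
threshold keeps `exp (c e) - 1` unestimated, so that both the Bernstein and the Chernoff bounds
below follow from different estimates of it. -/
lemma measure_binary_sum_ge_le {Ω ι : Type*} [MeasurableSpace Ω] {μ : Measure Ω}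
    [IsProbabilityMeasure μ] [Fintype ι] {X : ι → Ω → ℝ} (hX : ∀ e, Measurable (X e))
    (hind : iIndepFun X μ) (hbin : ∀ e ω, X e ω = 0 ∨ X e ω = 1) {p : ι → ℝ} (hp : ∀ e, 0 ≤ p e)
    (hprob : ∀ e, μ {ω | X e ω = 1} = ENNReal.ofReal (p e)) (c : ι → ℝ) (h : ℝ) :
    μ {ω | ∑ e, p e * (Real.exp (c e) - 1) + h ≤ ∑ e, c e * X e ω} ≤
      ENNReal.ofReal (Real.exp (-h)) := by
  have hind' : iIndepFun (fun e ω => c e * X e ω) μ :=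
    hind.comp (fun e x => c e * x) fun e => measurable_const_mul _
  have hm' : ∀ e, Measurable fun ω => c e * X e ω := fun e => (hX e).const_mul _
  have hint : Integrable (fun ω => Real.exp (1 * (∑ e, fun ω => c e * X e ω) ω)) μ :=
    hind'.integrable_exp_mul_sum hm' (s := Finset.univ) fun e _ => by
      simpa using (integral_exp_mul_of_binary (hX e) (hbin e) (hp e) (hprob e) (c e)).1
  have key := measure_ge_le_exp_mul_mgf (X := ∑ e, fun ω => c e * X e ω)
    (∑ e, p e * (Real.exp (c e) - 1) + h) zero_le_one hint
  rw [hind'.mgf_sum hm'] at key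
  have hprod : ∏ e, mgf (fun ω => c e * X e ω) μ 1 ≤
      Real.exp (∑ e, p e * (Real.exp (c e) - 1)) := by
    rw [Real.exp_sum]
    refine Finset.prod_le_prod (fun e _ => mgf_nonneg) fun e _ => ?_
    have := (integral_exp_mul_of_binary (hX e) (hbin e) (hp e) (hprob e) (c e)).2
    simp only [mgf, one_mul, this]
    linarith [Real.add_one_le_exp (p e * (Real.exp (c e) - 1))]
  have hfin : μ.real {ω | ∑ e, p e * (Real.exp (c e) - 1) + h ≤ ∑ e, c e * X e ω} ≤
      Real.exp (-h) := by
    have e1 : {ω | ∑ e, p e * (Real.exp (c e) - 1) + h ≤ ∑ e, c e * X e ω} =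
        {ω | ∑ e, p e * (Real.exp (c e) - 1) + h ≤ (∑ e, fun ω => c e * X e ω) ω} := by
      simp
    rw [e1]
    refine key.trans ((mul_le_mul_of_nonneg_left hprod (Real.exp_pos _).le).trans ?_)
    rw [← Real.exp_add]
    apply le_of_eq
    congr 1
    ring
  rw [measureReal_def] at hfin
  exact (ENNReal.le_ofReal_iff_toReal_le (measure_ne_top _ _) (Real.exp_pos _).le).2 hfin

/-- The pairs `i < j`. -/
def upperPairs (n : ℕ) : Finset (Fin n × Fin n) :=
  Finset.univ.filter fun p => p.1 < p.2

lemma sum_sum_ne_eq_sum_upperPairs {n : ℕ} (f : Fin n → Fin n → ℝ) :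
    ∑ i, ∑ j, (if i = j then 0 else f i j) =
      ∑ p ∈ upperPairs n, (f p.1 p.2 + f p.2 p.1) := by
  have h1 : ∀ i j : Fin n, (if i = j then 0 else f i j) =
      (if i < j then f i j else 0) + (if j < i then f i j else 0) := by
    intro i j
    rcases lt_trichotomy i j with h | h | h
    · simp [h, h.ne, h.not_gt]
    · simp [h]
    · simp [h, h.ne', h.not_gt]
  simp only [h1, Finset.sum_add_distrib]
  have e1 : ∑ i, ∑ j, (if j < i then f i j else 0) = ∑ i, ∑ j, (if i < j then f j i else 0) :=
    Finset.sum_comm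
  rw [e1, upperPairs, Finset.sum_filter, Finset.sum_filter, Fintype.sum_prod_type,
    Fintype.sum_prod_type]

/-! ### Bernstein and Chernoff bounds for the network -/

section Network

variable {Ω : Type*} [MeasurableSpace Ω] {μ : Measure Ω} {n T : ℕ} {d : ℝ}
  {P : ℤ → Matrix (Fin n) (Fin n) ℝ} {A : ℤ → Ω → Matrix (Fin n) (Fin n) ℝ}

lemma IsDynamicNetwork.measure_weighted_sum_ge_le [IsProbabilityMeasure μ]
    (hA : IsDynamicNetwork μ T d P A) {S : Finset ℤ}
    (hS : ∀ u ∈ S, u ∈ Set.Icc (1 : ℤ) T) (hP : ∀ u ∈ S, ∀ i j, 0 ≤ P u i j)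
    (c : ℤ → Fin n → Fin n → ℝ) (h : ℝ) :
    μ {ω | ∑ u ∈ S, ∑ p ∈ upperPairs n, P u p.1 p.2 * (Real.exp (c u p.1 p.2) - 1) + h ≤
        ∑ u ∈ S, ∑ p ∈ upperPairs n, c u p.1 p.2 * A u ω p.1 p.2} ≤
      ENNReal.ofReal (Real.exp (-h)) := by
  let ι := {e : ℤ × Fin n × Fin n // e ∈ S ×ˢ upperPairs n}
  have hmem : ∀ e : ι, e.1.1 ∈ S ∧ e.1.2.1 < e.1.2.2 := fun e => by
    have := Finset.mem_product.1 e.2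
    exact ⟨this.1, (Finset.mem_filter.1 this.2).2⟩
  let φ : ι → EdgeIndex n T := fun e => ⟨e.1, hS _ (hmem e).1, (hmem e).2⟩
  have hφ : Function.Injective φ := fun e e' he => by
    apply Subtype.ext
    exact congrArg (fun x : EdgeIndex n T => x.1) he
  have key := measure_binary_sum_ge_le (μ := μ)
    (X := fun (e : ι) ω => A e.1.1 ω e.1.2.1 e.1.2.2)
    (fun e => hA.measurable _ (hS _ (hmem e).1) _ _) (hA.indep.precomp hφ)
    (fun e ω => hA.binary _ (hS _ (hmem e).1) ω _ _ (hmem e).2.ne)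
    (p := fun e => P e.1.1 e.1.2.1 e.1.2.2) (fun e => hP _ (hmem e).1 _ _)
    (fun e => hA.prob _ (hS _ (hmem e).1) _ _ (hmem e).2)
    (fun e => c e.1.1 e.1.2.1 e.1.2.2) h
  have hsum : ∀ f : ℤ × Fin n × Fin n → ℝ,
      ∑ e : ι, f e.1 = ∑ u ∈ S, ∑ p ∈ upperPairs n, f (u, p) := fun f => by
    rw [← Finset.sum_product]
    exact Finset.sum_coe_sort (S ×ˢ upperPairs n) f
  rw [hsum fun e => P e.1 e.2.1 e.2.2 * (Real.exp (c e.1 e.2.1 e.2.2) - 1)] at key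
  refine le_trans (measure_mono fun ω hω => ?_) key
  rw [Set.mem_ofPred_eq] at hω ⊢
  refine le_of_le_of_eq hω ?_
  exact (hsum fun e => c e.1 e.2.1 e.2.2 * A e.1 ω e.2.1 e.2.2).symm


lemma IsDynamicNetwork.sum_weighted_eq (hA : IsDynamicNetwork μ T d P A) {S : Finset ℤ}
    (hS : ∀ u ∈ S, u ∈ Set.Icc (1 : ℤ) T) (w : ℤ → ℝ) (v : Fin n → Fin n → ℝ) (ω : Ω) :
    ∑ i, ∑ j, v i j * offDiag (∑ u ∈ S, w u • A u ω) i j =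
      ∑ u ∈ S, ∑ p ∈ upperPairs n, w u * (v p.1 p.2 + v p.2 p.1) * A u ω p.1 p.2 := by
  have h1 : ∀ i j, v i j * offDiag (∑ u ∈ S, w u • A u ω) i j =
      if i = j then 0 else v i j * (∑ u ∈ S, w u * A u ω i j) := fun i j => by
    rw [offDiag_apply]
    split_ifs <;> simp [Matrix.sum_apply]
  simp only [h1]
  rw [sum_sum_ne_eq_sum_upperPairs, Finset.sum_comm]
  refine Finset.sum_congr rfl fun p _ => ?_
  rw [Finset.mul_sum, Finset.mul_sum, ← Finset.sum_add_distrib]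
  refine Finset.sum_congr rfl fun u hu => ?_
  rw [hA.symm u (hS u hu) ω p.2 p.1]
  ring

lemma sum_weighted_prob_eq {S : Finset ℤ} (hP : ∀ u ∈ S, ∀ i j, P u i j = P u j i)
    (w : ℤ → ℝ) (v : Fin n → Fin n → ℝ) :
    ∑ i, ∑ j, v i j * offDiag (∑ u ∈ S, w u • P u) i j =
      ∑ u ∈ S, ∑ p ∈ upperPairs n, w u * (v p.1 p.2 + v p.2 p.1) * P u p.1 p.2 := by
  have h1 : ∀ i j, v i j * offDiag (∑ u ∈ S, w u • P u) i j =
      if i = j then 0 else v i j * (∑ u ∈ S, w u * P u i j) := fun i j => by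
    rw [offDiag_apply]
    split_ifs <;> simp [Matrix.sum_apply]
  simp only [h1]
  rw [sum_sum_ne_eq_sum_upperPairs, Finset.sum_comm]
  refine Finset.sum_congr rfl fun p _ => ?_
  rw [Finset.mul_sum, Finset.mul_sum, ← Finset.sum_add_distrib]
  refine Finset.sum_congr rfl fun u hu => ?_
  rw [hP u hu p.2 p.1]
  ring

lemma sum_upperPairs_le {n : ℕ} (f : Fin n → Fin n → ℝ) (hf : ∀ i j, 0 ≤ f i j) :
    ∑ p ∈ upperPairs n, (f p.1 p.2 + f p.2 p.1) ≤ ∑ i, ∑ j, f i j := by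
  rw [← sum_sum_ne_eq_sum_upperPairs]
  refine Finset.sum_le_sum fun i _ => Finset.sum_le_sum fun j _ => ?_
  split_ifs
  · exact hf i j
  · exact le_rfl

/-- Bernstein's inequality for the centered, weighted sums of the adjacency matrices. -/
lemma IsDynamicNetwork.measure_bilinear_ge_le [IsProbabilityMeasure μ]
    (hA : IsDynamicNetwork μ T d P A) {S : Finset ℤ}
    (hS : ∀ u ∈ S, u ∈ Set.Icc (1 : ℤ) T) {q : ℝ} (hP0 : ∀ u ∈ S, ∀ i j, 0 ≤ P u i j)
    (hPq : ∀ u ∈ S, ∀ i j, P u i j ≤ q) (hq : 0 ≤ q)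
    (hPs : ∀ u ∈ S, ∀ i j, P u i j = P u j i)
    {w : ℤ → ℝ} {Wmax : ℝ} (hW : ∀ u ∈ S, |w u| ≤ Wmax) {v : Fin n → Fin n → ℝ} {b : ℝ}
    (hvb : ∀ i j, |v i j| ≤ b) (hv : ∑ i, ∑ j, v i j ^ 2 ≤ 1) {lam : ℝ} (hlam : 0 ≤ lam)
    (hsmall : 2 * lam * Wmax * b ≤ 1) (h : ℝ) :
    μ {ω | 2 * lam ^ 2 * Wmax ^ 2 * (q * S.card) + h ≤
        lam * ∑ i, ∑ j, v i j * offDiag (∑ u ∈ S, w u • (A u ω - P u)) i j} ≤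
      ENNReal.ofReal (Real.exp (-h)) := by
  refine le_trans (measure_mono ?_) (hA.measure_weighted_sum_ge_le hS hP0
    (fun u i j => lam * (w u * (v i j + v j i))) h)
  intro ω hω
  simp only [Set.mem_ofPred_eq] at hω ⊢
  have e1 : ∑ i, ∑ j, v i j * offDiag (∑ u ∈ S, w u • (A u ω - P u)) i j =
      ∑ u ∈ S, ∑ p ∈ upperPairs n, w u * (v p.1 p.2 + v p.2 p.1) * A u ω p.1 p.2 -
      ∑ u ∈ S, ∑ p ∈ upperPairs n, w u * (v p.1 p.2 + v p.2 p.1) * P u p.1 p.2 := by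
    rw [← hA.sum_weighted_eq hS, ← sum_weighted_prob_eq hPs, ← Finset.sum_sub_distrib]
    refine Finset.sum_congr rfl fun i _ => ?_
    rw [← Finset.sum_sub_distrib]
    refine Finset.sum_congr rfl fun j _ => ?_
    simp only [smul_sub, Finset.sum_sub_distrib]
    rw [← mul_sub, offDiag_apply, offDiag_apply, offDiag_apply]
    split_ifs <;> simp
  have e2 : ∀ u ∈ S, ∑ p ∈ upperPairs n,
      P u p.1 p.2 * (Real.exp (lam * (w u * (v p.1 p.2 + v p.2 p.1))) - 1) ≤
      lam * ∑ p ∈ upperPairs n, w u * (v p.1 p.2 + v p.2 p.1) * P u p.1 p.2 +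
        2 * lam ^ 2 * Wmax ^ 2 * q := by
    intro u hu
    have hw2 : w u ^ 2 ≤ Wmax ^ 2 := sq_le_sq.2 ((hW u hu).trans (le_abs_self _))
    have hW0 : 0 ≤ Wmax := (abs_nonneg _).trans (hW u hu)
    have step : ∀ p ∈ upperPairs n,
        P u p.1 p.2 * (Real.exp (lam * (w u * (v p.1 p.2 + v p.2 p.1))) - 1) ≤
        lam * (w u * (v p.1 p.2 + v p.2 p.1) * P u p.1 p.2) +
          q * (lam ^ 2 * Wmax ^ 2 * (2 * (v p.1 p.2 ^ 2 + v p.2 p.1 ^ 2))) := by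
      intro p _
      set x := lam * (w u * (v p.1 p.2 + v p.2 p.1)) with hx
      have hx1 : |x| ≤ 1 := by
        rw [hx, abs_mul, abs_mul, abs_of_nonneg hlam]
        have h1 : |v p.1 p.2 + v p.2 p.1| ≤ 2 * b :=
          (abs_add_le _ _).trans (by linarith [hvb p.1 p.2, hvb p.2 p.1])
        calc lam * (|w u| * |v p.1 p.2 + v p.2 p.1|) ≤ lam * (Wmax * (2 * b)) := by
              gcongr
              exact hW u hu
          _ ≤ 1 := by linarith
      -- The linear terms add up to the mean subtracted in `e1`, so only the quadratic ones survive.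
      have hx2 : Real.exp x - 1 ≤ x + x ^ 2 := by
        linarith [(abs_le.1 (Real.abs_exp_sub_one_sub_id_le hx1)).2]
      -- Each unordered pair carries the two entries `v i j` and `v j i`; `(a + b)² ≤ 2 (a² + b²)`
      -- is the source of the factor 2 in the variance term.
      have hx3 : x ^ 2 ≤ lam ^ 2 * Wmax ^ 2 * (2 * (v p.1 p.2 ^ 2 + v p.2 p.1 ^ 2)) := by
        rw [hx, mul_pow, mul_pow, ← mul_assoc]
        gcongr
        nlinarith [sq_nonneg (v p.1 p.2 - v p.2 p.1)]
      calc P u p.1 p.2 * (Real.exp x - 1) ≤ P u p.1 p.2 * (x + x ^ 2) :=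
            mul_le_mul_of_nonneg_left hx2 (hP0 u hu _ _)
        _ = lam * (w u * (v p.1 p.2 + v p.2 p.1) * P u p.1 p.2) + P u p.1 p.2 * x ^ 2 := by
            rw [hx]; ring
        _ ≤ _ := by
            gcongr
            exact hPq u hu _ _
    refine (Finset.sum_le_sum step).trans ?_
    rw [Finset.sum_add_distrib, Finset.mul_sum]
    gcongr
    rw [← Finset.mul_sum, ← Finset.mul_sum, ← Finset.mul_sum]
    have hs := (sum_upperPairs_le (fun i j => v i j ^ 2) fun _ _ => sq_nonneg _).trans hv
    calc _ ≤ q * (lam ^ 2 * Wmax ^ 2 * (2 * 1)) := by gcongr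
      _ = _ := by ring
  have e3 := Finset.sum_le_sum e2
  rw [Finset.sum_add_distrib, ← Finset.mul_sum, Finset.sum_const, nsmul_eq_mul] at e3
  have e4 : ∑ u ∈ S, ∑ p ∈ upperPairs n, lam * (w u * (v p.1 p.2 + v p.2 p.1)) * A u ω p.1 p.2 =
      lam * ∑ u ∈ S, ∑ p ∈ upperPairs n, w u * (v p.1 p.2 + v p.2 p.1) * A u ω p.1 p.2 := by
    rw [Finset.mul_sum]
    refine Finset.sum_congr rfl fun u _ => ?_
    rw [Finset.mul_sum]
    exact Finset.sum_congr rfl fun p _ => by ring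
  rw [e1] at hω
  rw [e4]
  linarith

/-- Chernoff's inequality for the number of edges between two sets of nodes. -/
lemma IsDynamicNetwork.measure_edgeCount_ge_le [IsProbabilityMeasure μ]
    (hA : IsDynamicNetwork μ T d P A) {S : Finset ℤ}
    (hS : ∀ u ∈ S, u ∈ Set.Icc (1 : ℤ) T) {q : ℝ} (hP0 : ∀ u ∈ S, ∀ i j, 0 ≤ P u i j)
    (hPq : ∀ u ∈ S, ∀ i j, P u i j ≤ q) (hq : 0 ≤ q)
    (I J : Finset (Fin n)) {θ : ℝ} (hθ : 0 ≤ θ) (h : ℝ) :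
    μ {ω | q * S.card * (I.card * J.card) * ((Real.exp (2 * θ) - 1) / 2) + h ≤
        θ * ∑ i ∈ I, ∑ j ∈ J, offDiag (∑ u ∈ S, A u ω) i j} ≤
      ENNReal.ofReal (Real.exp (-h)) := by
  classical
  let v : Fin n → Fin n → ℝ := fun i j => if i ∈ I ∧ j ∈ J then 1 else 0
  have hv01 : ∀ i j, v i j = 0 ∨ v i j = 1 := fun i j => by
    simp only [v]; split_ifs <;> simp
  have hvsum : ∑ i, ∑ j, v i j = I.card * J.card := by
    have h1 : ∀ i j, v i j = (if i ∈ I then 1 else 0) * (if j ∈ J then 1 else 0) := fun i j => by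
      by_cases hi : i ∈ I <;> by_cases hj : j ∈ J <;> simp [v, hi, hj]
    simp only [h1, ← Finset.mul_sum, ← Finset.sum_mul]
    simp
  refine le_trans (measure_mono ?_) (hA.measure_weighted_sum_ge_le hS hP0
    (fun u i j => θ * (v i j + v j i)) h)
  intro ω hω
  simp only [Set.mem_ofPred_eq] at hω ⊢
  have e1 : ∑ i ∈ I, ∑ j ∈ J, offDiag (∑ u ∈ S, A u ω) i j =
      ∑ u ∈ S, ∑ p ∈ upperPairs n, (v p.1 p.2 + v p.2 p.1) * A u ω p.1 p.2 := by
    have h2 := hA.sum_weighted_eq hS (fun _ => 1) v ω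
    simp only [one_smul, one_mul] at h2
    rw [← h2, ← Finset.sum_filter_add_sum_filter_not Finset.univ (· ∈ I)]
    rw [Finset.filter_mem_eq_inter, Finset.univ_inter]
    have h3 : ∑ i with i ∉ I, ∑ j, v i j * offDiag (∑ u ∈ S, A u ω) i j = 0 := by
      refine Finset.sum_eq_zero fun i hi => Finset.sum_eq_zero fun j _ => ?_
      simp [v, (Finset.mem_filter.1 hi).2]
    rw [h3, add_zero]
    refine Finset.sum_congr rfl fun i hi => ?_
    simp [v, hi]
  -- A pair inside `I ∩ J` is counted twice and has exponent `2 θ`. Pairs counted once have exponent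
  -- `θ`, and `exp θ - 1 ≤ (exp (2 θ) - 1) / 2` puts both cases in one form linear in the
  -- multiplicity.
  have hexp : ∀ p ∈ upperPairs n, Real.exp (θ * (v p.1 p.2 + v p.2 p.1)) - 1 ≤
      (v p.1 p.2 + v p.2 p.1) * ((Real.exp (2 * θ) - 1) / 2) := by
    intro p _
    have hsq : Real.exp (2 * θ) = Real.exp θ ^ 2 := by rw [← Real.exp_nat_mul]; norm_num
    rcases hv01 p.1 p.2 with h1 | h1 <;> rcases hv01 p.2 p.1 with h2 | h2
    · simp [h1, h2]
    · simp only [h1, h2, zero_add, mul_one, one_mul, hsq]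
      nlinarith [sq_nonneg (Real.exp θ - 1)]
    · simp only [h1, h2, add_zero, mul_one, one_mul, hsq]
      nlinarith [sq_nonneg (Real.exp θ - 1)]
    · rw [h1, h2, show θ * ((1 : ℝ) + 1) = 2 * θ by ring]
      linarith
  have hE0 : 0 ≤ (Real.exp (2 * θ) - 1) / 2 := by
    have := Real.one_le_exp (show 0 ≤ 2 * θ by linarith)
    linarith
  have e2 : ∀ u ∈ S, ∑ p ∈ upperPairs n,
      P u p.1 p.2 * (Real.exp (θ * (v p.1 p.2 + v p.2 p.1)) - 1) ≤
      q * ((I.card * J.card) * ((Real.exp (2 * θ) - 1) / 2)) := by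
    intro u hu
    calc _ ≤ ∑ p ∈ upperPairs n, q * ((v p.1 p.2 + v p.2 p.1) * ((Real.exp (2 * θ) - 1) / 2)) := by
          refine Finset.sum_le_sum fun p hp => ?_
          refine (mul_le_mul_of_nonneg_left (hexp p hp) (hP0 u hu _ _)).trans ?_
          refine mul_le_mul_of_nonneg_right (hPq u hu _ _) (mul_nonneg ?_ hE0)
          rcases hv01 p.1 p.2 with h1 | h1 <;> rcases hv01 p.2 p.1 with h2 | h2 <;> simp [h1, h2]
      _ ≤ _ := by
          rw [← Finset.mul_sum, ← Finset.sum_mul]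
          gcongr
          rw [← hvsum]
          refine sum_upperPairs_le v fun i j => ?_
          rcases hv01 i j with h1 | h1 <;> simp [h1]
  have e3 := Finset.sum_le_sum e2
  rw [Finset.sum_const, nsmul_eq_mul] at e3
  have e4 : ∑ u ∈ S, ∑ p ∈ upperPairs n, θ * (v p.1 p.2 + v p.2 p.1) * A u ω p.1 p.2 =
      θ * ∑ u ∈ S, ∑ p ∈ upperPairs n, (v p.1 p.2 + v p.2 p.1) * A u ω p.1 p.2 := by
    rw [Finset.mul_sum]
    refine Finset.sum_congr rfl fun u _ => ?_
    rw [Finset.mul_sum]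
    exact Finset.sum_congr rfl fun p _ => by ring
  rw [e1] at hω
  rw [e4]
  linarith

end Network

/-! Heavy pairs: a deterministic bound from bounded degrees and bounded discrepancy -/

/-- `b log (e n / b)`, a bound on the logarithm of the number of subsets of size `b`. -/
noncomputable def setEntropy (n b : ℕ) : ℝ := b * (1 + Real.log (n / b))

/-- A geometric sum is controlled by its largest admitted term. The bound 2 alone is not inductive:
to add a first term `c ≤ 1`, the tail, which starts at `c / 2`, must be known to be at most `c`. -/
lemma sum_dyadic_le (M : ℕ) : ∀ c : ℝ, 0 < c →
    ∑ s ∈ Finset.range M, (if c * (1 / 2) ^ s ≤ 1 then c * (1 / 2 : ℝ) ^ s else 0) ≤ min 2 (2 * c) := by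
  induction M with
  | zero => intro c hc; simp; positivity
  | succ M ih =>
    intro c hc
    rw [Finset.sum_range_succ']
    have h := ih (c / 2) (by positivity)
    have e : ∀ s, c / 2 * (1 / 2 : ℝ) ^ s = c * (1 / 2) ^ (s + 1) := fun s => by ring
    simp only [e] at h
    have h1 := h.trans (min_le_left _ _)
    have h2 := h.trans (min_le_right _ _)
    simp only [pow_zero, mul_one]
    refine le_min ?_ ?_ <;> split_ifs with hc1 <;> linarith

/-- The same for an increasing geometric sum: the second bound says that all earlier terms amount to
at most a third of the next one. -/
lemma sum_pow_four_le (M : ℕ) (q : ℝ) (hq : 0 < q) :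
    ∑ t ∈ Finset.range M, (if q * 4 ^ t ≤ 1 then q * (4 : ℝ) ^ t else 0) ≤ min 2 (q * 4 ^ M / 3) := by
  induction M with
  | zero => simp; positivity
  | succ M ih =>
    rw [Finset.sum_range_succ]
    have h1 := ih.trans (min_le_left _ _)
    have h2 := ih.trans (min_le_right _ _)
    have h3 : 0 < q * 4 ^ M := by positivity
    have h4 : q * 4 ^ (M + 1) = 4 * (q * 4 ^ M) := by ring
    rw [h4]
    refine le_min ?_ ?_ <;> split_ifs with hc1 <;> linarith

lemma mul_log_inv_le {b : ℝ} (hb : 0 < b) : b * Real.log (1 / b) ≤ 2 * √b := by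
  have hs : 0 < √b := Real.sqrt_pos.2 hb
  have h1 : Real.log (1 / b) = 2 * Real.log (1 / √b) := by
    rw [one_div, one_div, Real.log_inv, Real.log_inv, Real.log_sqrt hb.le]; ring
  have h2 : Real.log (1 / √b) ≤ 1 / √b :=
    (Real.log_le_sub_one_of_pos (by positivity)).trans (by linarith)
  have h3 : b = √b * √b := (Real.mul_self_sqrt hb.le).symm
  calc b * Real.log (1 / b) ≤ b * (2 * (1 / √b)) := by rw [h1]; gcongr
    _ = 2 * √b := by
      nth_rewrite 1 [h3]
      field_simp

/-- Here `x` and `y` are the sizes of the coordinates on two levels, `a` and `b` the cardinalities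
of the levels and `e` the number of edges between them. The discrepancy inequality is divided by `ℓ
= log ρ ≥ 2`, and the issue is the entropy `b log (n / b)`. With `β = b y²` one has `log (n / b) =
log (n y²) + log (1 / β)`, and `ρ / z = 4 n y²` gives `log (n y²) ≤ ℓ + log (1 / z)`. If `log (1 /
β)` is at most `log (n y²)`, the entropy is absorbed by `ℓ` and `log (1 / z)`. Otherwise `β` is so
small that `β log (1 / β) ≤ 2 √β ≤ 2 / (√n y)`. Finally `z log (1 / z) ≤ 2 √z` leaves a factor `√z`,
which makes the sum over levels geometric. -/
lemma edge_count_level_le {n d x y a b e κ : ℝ} (hn : 0 < n) (hd : 0 < d) (hx : 0 < x) (hy : 0 < y)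
    (ha : 0 ≤ a) (hb : 0 < b) (hκ : 0 ≤ κ) (hρ : Real.exp 2 ≤ n * (x * y) / √d)
    (hz : x ≤ 4 * √d * y)
    (hdisc : 1 / 2 * Real.log (n * (x * y) / √d) * e ≤
      κ * (b * (1 + Real.log (n / b))) + d / n * (a * b) * (n * (x * y) / √d / 2)) :
    x * y * e ≤ 4 * √d * κ * √(x / (4 * √d * y)) * (9 * (b * y ^ 2) + 4 * (1 / (√n * y))) +
      √d * (a * x ^ 2) * (b * y ^ 2) / 2 := by
  have hsd : 0 < √d := Real.sqrt_pos.2 hd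
  have hsn : 0 < √n := Real.sqrt_pos.2 hn
  have hdd : √d * √d = d := Real.mul_self_sqrt hd.le
  have hnn : √n * √n = n := Real.mul_self_sqrt hn.le
  set ρ := n * (x * y) / √d with hρdef
  have hρ0 : 0 < ρ := by positivity
  set ℓ := Real.log ρ with hℓ
  have hℓ2 : 2 ≤ ℓ := by rw [hℓ, Real.le_log_iff_exp_le hρ0]; exact hρ
  set z := x / (4 * √d * y) with hzdef
  have hz0 : 0 < z := by positivity
  have hz1 : z ≤ 1 := by rw [hzdef, div_le_one (by positivity)]; exact hz
  have hlz : 0 ≤ Real.log (1 / z) := Real.log_nonneg (by rw [le_div_iff₀ hz0]; linarith)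
  set β := b * y ^ 2 with hβ
  have hβ0 : 0 < β := by positivity
  have hxz : x = 4 * √d * y * z := by rw [hzdef]; field_simp
  set g := Real.log (n * y ^ 2) with hg
  have hgle : g ≤ ℓ + Real.log (1 / z) := by
    rw [hg, hℓ, ← Real.log_mul hρ0.ne' (by positivity)]
    apply Real.log_le_log (by positivity)
    have : ρ * (1 / z) = 4 * (n * y ^ 2) := by
      rw [hρdef, hzdef]; field_simp
    rw [this]
    nlinarith [show 0 < n * y ^ 2 by positivity]
  have hnb : Real.log (n / b) = g + Real.log (1 / β) := by
    rw [hg, ← Real.log_mul (by positivity) (by positivity)]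
    congr 1
    rw [hβ]; field_simp
  have claim : β * (1 + Real.log (n / b)) ≤
      β + 2 * β * (ℓ + Real.log (1 / z)) + 4 * (1 / (√n * y)) := by
    rw [hnb]
    have hpos : 0 < 1 / (√n * y) := by positivity
    by_cases hc : Real.log (1 / β) ≤ g
    · linear_combination 2 * mul_le_mul_of_nonneg_left hgle hβ0.le +
        mul_le_mul_of_nonneg_left hc hβ0.le + 4 * hpos.le
    · push Not at hc
      have h1 : n * y ^ 2 < 1 / β := (Real.log_lt_log_iff (by positivity) (by positivity)).1 hc
      have h2 : √β ≤ 1 / (√n * y) := by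
        rw [Real.sqrt_le_left (by positivity)]
        rw [lt_div_iff₀ hβ0] at h1
        rw [div_pow, le_div_iff₀ (by positivity), mul_pow, sq (√n), hnn]
        linarith
      have h3 := mul_log_inv_le hβ0
      have h4 := mul_le_mul_of_nonneg_left hc.le hβ0.le
      have h5 : 0 ≤ 2 * β * (ℓ + Real.log (1 / z)) := by positivity
      linear_combination h4 + 2 * h3 + 4 * h2 + h5
  have hzs : z ≤ √z := by
    rw [Real.le_sqrt hz0.le hz0.le]; nlinarith
  have hzlog := mul_log_inv_le hz0
  set A := κ * (b * (1 + Real.log (n / b))) with hA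
  set D := d / n * (a * b) * (ρ / 2) with hD
  have hdisc' : x * y * (ℓ * e) ≤ x * y * (2 * A + 2 * D) := by
    gcongr
    linarith
  have hD2 : x * y * (2 * D) = √d * (a * x ^ 2) * (b * y ^ 2) := by
    rw [hD, hρdef]
    field_simp
    rw [sq, hdd]
    ring
  have hA2 : x * y * (2 * A) = 8 * √d * κ * z * (β * (1 + Real.log (n / b))) := by
    rw [hA, hβ]
    nth_rewrite 1 [hxz]
    ring
  have hK : 0 ≤ 8 * √d * κ * z := by positivity
  have hq : 0 < 1 / (√n * y) := by positivity
  have step1 : 2 * (β + 2 * β * (ℓ + Real.log (1 / z)) + 4 * (1 / (√n * y))) ≤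
      ℓ * (5 * β + 2 * β * Real.log (1 / z) + 4 * (1 / (√n * y))) := by
    have : 0 ≤ (ℓ - 2) * (β + 2 * β * Real.log (1 / z) + 4 * (1 / (√n * y))) := by
      apply mul_nonneg (by linarith); positivity
    linear_combination this
  have step2 : z * (5 * β + 2 * β * Real.log (1 / z) + 4 * (1 / (√n * y))) ≤
      √z * (9 * β + 4 * (1 / (√n * y))) := by
    have h1 := mul_le_mul_of_nonneg_right hzs (show 0 ≤ 5 * β + 4 * (1 / (√n * y)) by positivity)
    have h2 := mul_le_mul_of_nonneg_left hzlog (show 0 ≤ 2 * β by positivity)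
    linear_combination h1 + h2
  have hfin : ℓ * (x * y * e) ≤ ℓ * (4 * √d * κ * √z * (9 * β + 4 * (1 / (√n * y))) +
      √d * (a * x ^ 2) * (b * y ^ 2) / 2) := by
    have hE : √d * (a * x ^ 2) * (b * y ^ 2) ≤ ℓ * (√d * (a * x ^ 2) * (b * y ^ 2) / 2) := by
      have : 0 ≤ (ℓ - 2) * (√d * (a * x ^ 2) * (b * y ^ 2)) :=
        mul_nonneg (by linarith) (by positivity)
      linear_combination (1 / 2) * this
    calc ℓ * (x * y * e) = x * y * (ℓ * e) := by ring
      _ ≤ x * y * (2 * A + 2 * D) := hdisc'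
      _ = 8 * √d * κ * z * (β * (1 + Real.log (n / b))) + √d * (a * x ^ 2) * (b * y ^ 2) := by
          rw [mul_add, hA2, hD2]
      _ ≤ 8 * √d * κ * z * (β + 2 * β * (ℓ + Real.log (1 / z)) + 4 * (1 / (√n * y))) +
          √d * (a * x ^ 2) * (b * y ^ 2) := by gcongr
      _ = 4 * √d * κ * z * (2 * (β + 2 * β * (ℓ + Real.log (1 / z)) + 4 * (1 / (√n * y)))) +
          √d * (a * x ^ 2) * (b * y ^ 2) := by ring
      _ ≤ 4 * √d * κ * z * (ℓ * (5 * β + 2 * β * Real.log (1 / z) + 4 * (1 / (√n * y)))) +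
          √d * (a * x ^ 2) * (b * y ^ 2) := by gcongr
      _ = ℓ * (4 * √d * κ * (z * (5 * β + 2 * β * Real.log (1 / z) + 4 * (1 / (√n * y))))) +
          √d * (a * x ^ 2) * (b * y ^ 2) := by ring
      _ ≤ ℓ * (4 * √d * κ * (√z * (9 * β + 4 * (1 / (√n * y))))) +
          ℓ * (√d * (a * x ^ 2) * (b * y ^ 2) / 2) := by
          gcongr
      _ = _ := by ring
  exact le_of_mul_le_mul_left hfin (by linarith)

/-- The edge density between sets of nodes, in the range of densities which matters for the
heavy pairs. -/
def HasBoundedDiscrepancy {n : ℕ} (κ d : ℝ) (M : Fin n → Fin n → ℝ) : Prop :=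
  ∀ (k : ℕ) (I J : Finset (Fin n)), I.card ≤ J.card → Real.exp 2 ≤ n * (1 / 4 : ℝ) ^ k / √d →
    1 / 2 * Real.log (n * (1 / 4 : ℝ) ^ k / √d) * ∑ i ∈ I, ∑ j ∈ J, M i j ≤
      κ * setEntropy n J.card + d / n * (I.card * J.card) * (n * (1 / 4 : ℝ) ^ k / √d / 2)

/-- The bounds for pairs of levels are summable: for fixed `t` the factor `√z` is geometric in `s`
with ratio 1/2, and the term `1 / (√n y)` is geometric in `t` with ratio 4. In both directions the
conditions on the levels cut the geometric sum where its terms reach 1. -/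
lemma sum_levels_le {n : ℕ} (hn : 0 < n) {κ d : ℝ} (hκ : 0 ≤ κ) (hd : 0 < d)
    {M : Fin n → Fin n → ℝ} (hM : HasBoundedDiscrepancy κ d M)
    (I J : ℕ → Finset (Fin n)) (m : ℕ)
    (hI : ∑ s ∈ Finset.range m, ((I s).card : ℝ) * ((1 / 4 : ℝ) ^ s) ^ 2 ≤ 16)
    (hJ : ∑ s ∈ Finset.range m, ((J s).card : ℝ) * ((1 / 4 : ℝ) ^ s) ^ 2 ≤ 16) :
    ∑ s ∈ Finset.range m, ∑ t ∈ Finset.range m,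
      (if Real.exp 2 ≤ n * ((1 / 4 : ℝ) ^ s * (1 / 4 : ℝ) ^ t) / √d ∧
          (1 / 4 : ℝ) ^ s ≤ 4 * √d * (1 / 4 : ℝ) ^ t ∧ (I s).card ≤ (J t).card then
        (1 / 4 : ℝ) ^ s * (1 / 4 : ℝ) ^ t * ∑ i ∈ I s, ∑ j ∈ J t, M i j else 0) ≤
      (1216 * κ + 128) * √d := by
  have hn' : (0 : ℝ) < n := by exact_mod_cast hn
  have hsd : 0 < √d := Real.sqrt_pos.2 hd
  have hsn : 0 < √(n : ℝ) := Real.sqrt_pos.2 hn'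
  set c : ℕ → ℝ := fun t => 1 / √(4 * √d * (1 / 4 : ℝ) ^ t) with hc
  have hc0 : ∀ t, 0 < c t := fun t => by simp only [hc]; positivity
  have hcs : ∀ s t, √((1 / 4 : ℝ) ^ s / (4 * √d * (1 / 4 : ℝ) ^ t)) = c t * (1 / 2) ^ s := by
    intro s t
    rw [Real.sqrt_div (by positivity), hc]
    have : √((1 / 4 : ℝ) ^ s) = (1 / 2) ^ s := by
      rw [show ((1 : ℝ) / 4) = (1 / 2) ^ 2 by norm_num, ← pow_mul, mul_comm, pow_mul,
        Real.sqrt_sq (by positivity)]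
    rw [this]; ring
  set β : ℕ → ℝ := fun t => ((J t).card : ℝ) * ((1 / 4 : ℝ) ^ t) ^ 2 with hβ
  set α : ℕ → ℝ := fun s => ((I s).card : ℝ) * ((1 / 4 : ℝ) ^ s) ^ 2 with hα
  have hβ0 : ∀ t, 0 ≤ β t := fun t => by simp only [hβ]; positivity
  have hα0 : ∀ t, 0 ≤ α t := fun t => by simp only [hα]; positivity
  set q : ℝ := 1 / √(n : ℝ) with hq
  have hq0 : 0 < q := by positivity
  have hterm : ∀ s t, (if Real.exp 2 ≤ n * ((1 / 4 : ℝ) ^ s * (1 / 4 : ℝ) ^ t) / √d ∧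
          (1 / 4 : ℝ) ^ s ≤ 4 * √d * (1 / 4 : ℝ) ^ t ∧ (I s).card ≤ (J t).card then
        (1 / 4 : ℝ) ^ s * (1 / 4 : ℝ) ^ t * ∑ i ∈ I s, ∑ j ∈ J t, M i j else 0) ≤
      4 * √d * κ * ((9 * β t + 4 * (if q * 4 ^ t ≤ 1 then q * 4 ^ t else 0)) *
        (if c t * (1 / 2) ^ s ≤ 1 then c t * (1 / 2) ^ s else 0)) + √d * α s * β t / 2 := by
    intro s t
    have hrhs : 0 ≤ 4 * √d * κ * ((9 * β t + 4 * (if q * 4 ^ t ≤ 1 then q * 4 ^ t else 0)) *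
        (if c t * (1 / 2) ^ s ≤ 1 then c t * (1 / 2) ^ s else 0)) + √d * α s * β t / 2 := by
      have := hβ0 t
      have := hα0 s
      have h1 : 0 ≤ (if q * (4 : ℝ) ^ t ≤ 1 then q * (4 : ℝ) ^ t else 0) := by
        split_ifs <;> positivity
      have h2 : 0 ≤ (if c t * (1 / 2) ^ s ≤ 1 then c t * (1 / 2) ^ s else 0) := by
        have := hc0 t
        split_ifs <;> positivity
      positivity
    by_cases h : Real.exp 2 ≤ n * ((1 / 4 : ℝ) ^ s * (1 / 4 : ℝ) ^ t) / √d ∧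
        (1 / 4 : ℝ) ^ s ≤ 4 * √d * (1 / 4 : ℝ) ^ t ∧ (I s).card ≤ (J t).card
    swap
    · rw [if_neg h]
      exact hrhs
    rw [if_pos h]
    obtain ⟨h1, h2, h3⟩ := h
    rcases Nat.eq_zero_or_pos (J t).card with hJ0 | hJ0
    · rw [Finset.card_eq_zero.1 hJ0]
      simp only [Finset.sum_empty, Finset.sum_const_zero, mul_zero]
      exact hrhs
    have hyt : (0 : ℝ) < (1 / 4 : ℝ) ^ t := by positivity
    have hxs : (0 : ℝ) < (1 / 4 : ℝ) ^ s := by positivity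
    have hdisc := hM (s + t) (I s) (J t) h3 (by rw [pow_add]; exact h1)
    rw [pow_add] at hdisc
    have key := edge_count_level_le hn' hd hxs hyt (Nat.cast_nonneg (I s).card)
      (Nat.cast_pos.2 hJ0) hκ h1 h2 hdisc
    have hcond1 : c t * (1 / 2) ^ s ≤ 1 := by
      rw [← hcs]
      exact Real.sqrt_le_iff.2 ⟨zero_le_one, by rw [one_pow, div_le_one (by positivity)]; exact h2⟩
    -- The two conditions on the levels give `exp 2 ≤ ρ ≤ 4 n y²`, so `y` is at least `1 / √n`.
    have hcond2 : q * 4 ^ t ≤ 1 := by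
      have e1 : n * ((1 / 4 : ℝ) ^ s * (1 / 4 : ℝ) ^ t) / √d ≤ 4 * (n * ((1 / 4 : ℝ) ^ t) ^ 2) := by
        rw [div_le_iff₀ hsd]
        have := mul_le_mul_of_nonneg_left h2 (show 0 ≤ n * (1 / 4 : ℝ) ^ t by positivity)
        nlinarith
      have e2 : (4 : ℝ) ≤ Real.exp 2 := by
        have := Real.quadratic_le_exp_of_nonneg (show (0 : ℝ) ≤ 2 by norm_num)
        linarith
      have e3 : 1 ≤ n * ((1 / 4 : ℝ) ^ t) ^ 2 := by linarith
      have e4 : 1 ≤ √(n : ℝ) * (1 / 4 : ℝ) ^ t := by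
        have := Real.sqrt_le_sqrt e3
        rwa [Real.sqrt_one, Real.sqrt_mul hn'.le, Real.sqrt_sq hyt.le] at this
      have e5 : (1 / 4 : ℝ) ^ t = 1 / 4 ^ t := by rw [one_div_pow]
      rw [e5, mul_one_div, le_div_iff₀ (by positivity)] at e4
      rw [hq, one_div, inv_mul_le_iff₀ hsn]
      linarith
    rw [if_pos hcond1, if_pos hcond2]
    rw [hcs] at key
    have e6 : 1 / (√(n : ℝ) * (1 / 4 : ℝ) ^ t) = q * 4 ^ t := by
      rw [hq, one_div_pow]; field_simp
    rw [e6] at key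
    refine key.trans (le_of_eq ?_)
    simp only [hβ, hα]
    ring
  refine (Finset.sum_le_sum fun s _ => Finset.sum_le_sum fun t _ => hterm s t).trans ?_
  simp only [Finset.sum_add_distrib]
  -- The sum over `s` is at most 2, the remaining sum over `t` at most `9 * 16 + 4 * 2 = 152`, and
  -- `4 * 2 * 152 = 1216`. In `hsecond`, `16 * 16 / 2 = 128`.
  have hfirst : ∑ s ∈ Finset.range m, ∑ t ∈ Finset.range m,
      4 * √d * κ * ((9 * β t + 4 * (if q * 4 ^ t ≤ 1 then q * 4 ^ t else 0)) *
        (if c t * (1 / 2) ^ s ≤ 1 then c t * (1 / 2) ^ s else 0)) ≤ 1216 * κ * √d := by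
    rw [Finset.sum_comm]
    simp only [← Finset.mul_sum]
    have h1 : ∑ t ∈ Finset.range m, ((9 * β t + 4 * (if q * 4 ^ t ≤ 1 then q * 4 ^ t else 0)) *
        ∑ s ∈ Finset.range m, (if c t * (1 / 2) ^ s ≤ 1 then c t * (1 / 2) ^ s else 0)) ≤
        ∑ t ∈ Finset.range m, ((9 * β t + 4 * (if q * 4 ^ t ≤ 1 then q * 4 ^ t else 0)) * 2) := by
      refine Finset.sum_le_sum fun t _ => ?_
      refine mul_le_mul_of_nonneg_left ((sum_dyadic_le m (c t) (hc0 t)).trans (min_le_left _ _)) ?_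
      have := hβ0 t
      have h1 : 0 ≤ (if q * (4 : ℝ) ^ t ≤ 1 then q * (4 : ℝ) ^ t else 0) := by
        split_ifs <;> positivity
      positivity
    have h2 := (sum_pow_four_le m q hq0).trans (min_le_left _ _)
    rw [← Finset.sum_mul, Finset.sum_add_distrib, ← Finset.mul_sum, ← Finset.mul_sum] at h1
    have h3 := mul_le_mul_of_nonneg_left (h1.trans (show _ ≤ (304 : ℝ) by linarith))
      (show 0 ≤ 4 * √d * κ by positivity)
    linarith
  have hsecond : ∑ s ∈ Finset.range m, ∑ t ∈ Finset.range m, √d * α s * β t / 2 ≤ 128 * √d := by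
    have e : ∀ s t, √d * α s * β t / 2 = √d / 2 * (α s * β t) := fun s t => by ring
    simp only [e, ← Finset.mul_sum, ← Finset.sum_mul]
    have h1 : (∑ s ∈ Finset.range m, α s) * ∑ t ∈ Finset.range m, β t ≤ 16 * 16 :=
      mul_le_mul hI hJ (Finset.sum_nonneg fun t _ => hβ0 t) (by norm_num)
    nlinarith
  linarith

lemma exists_level {n : ℕ} (x : Fin n → ℝ) (hx : ∑ i, x i ^ 2 ≤ 1) :
    ∃ l : Fin n → ℕ, ∀ i, x i ≠ 0 → (1 / 4 : ℝ) ^ (l i + 1) < |x i| ∧ |x i| ≤ (1 / 4 : ℝ) ^ l i := by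
  have h : ∀ i, ∃ k : ℕ, x i ≠ 0 → (1 / 4 : ℝ) ^ (k + 1) < |x i| ∧ |x i| ≤ (1 / 4 : ℝ) ^ k := by
    intro i
    by_cases hi : x i = 0
    · exact ⟨0, fun h => absurd hi h⟩
    · have h1 : |x i| ≤ 1 := by
        have := (Finset.single_le_sum (f := fun i => x i ^ 2) (fun _ _ => sq_nonneg _)
          (Finset.mem_univ i)).trans hx
        exact (sq_le_one_iff_abs_le_one _).1 this
      obtain ⟨k, hk⟩ := exists_nat_pow_near_of_lt_one (abs_pos.2 hi) h1
        (show (0 : ℝ) < 1 / 4 by norm_num) (by norm_num)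
      exact ⟨k, fun _ => hk⟩
  choose l hl using h
  exact ⟨l, hl⟩

/-- A node of level `s` has `|x i| > (1 / 4) ^ (s + 1)`, so rounding up to its level costs at most a
factor 16 in the squares. -/
lemma sum_card_level_le {n : ℕ} (x : Fin n → ℝ) (hx : ∑ i, x i ^ 2 ≤ 1) (l : Fin n → ℕ)
    (hl : ∀ i, x i ≠ 0 → (1 / 4 : ℝ) ^ (l i + 1) < |x i| ∧ |x i| ≤ (1 / 4 : ℝ) ^ l i) (m : ℕ) :
    ∑ s ∈ Finset.range m, ((Finset.univ.filter fun i => x i ≠ 0 ∧ l i = s).card : ℝ) *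
      ((1 / 4 : ℝ) ^ s) ^ 2 ≤ 16 := by
  have h1 : ∀ s, ((Finset.univ.filter fun i => x i ≠ 0 ∧ l i = s).card : ℝ) *
      ((1 / 4 : ℝ) ^ s) ^ 2 ≤ ∑ i, if l i = s then 16 * x i ^ 2 else 0 := by
    intro s
    rw [← nsmul_eq_mul, ← Finset.sum_const, Finset.sum_filter]
    refine Finset.sum_le_sum fun i _ => ?_
    split_ifs with h2 h3 h3
    · have h4 := (hl i h2.1).1
      rw [h3, pow_succ] at h4
      have h5 : (0 : ℝ) < (1 / 4) ^ s := by positivity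
      rw [← sq_abs (x i)]
      nlinarith
    · exact absurd h2.2 h3
    · positivity
    · exact le_rfl
  calc _ ≤ ∑ s ∈ Finset.range m, ∑ i, if l i = s then 16 * x i ^ 2 else 0 :=
        Finset.sum_le_sum fun s _ => h1 s
    _ ≤ ∑ i, 16 * x i ^ 2 := by
        rw [Finset.sum_comm]
        refine Finset.sum_le_sum fun i _ => ?_
        rw [Finset.sum_ite_eq]
        split_ifs
        · exact le_rfl
        · positivity
    _ ≤ 16 := by rw [← Finset.mul_sum]; linarith

/-- The contribution of the heavy pairs to the bilinear form of a nonnegative matrix with bounded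
degrees and bounded discrepancy. -/
theorem sum_heavy_pairs_le {n : ℕ} (hn : 0 < n) {κ₁ κ₂ d : ℝ} (hκ₂ : 0 ≤ κ₂)
    (hd : 0 < d) {M : Fin n → Fin n → ℝ} (hM0 : ∀ i j, 0 ≤ M i j)
    (hMs : ∀ i j, M i j = M j i) (hdeg : ∀ i, ∑ j, M i j ≤ κ₁ * d)
    (hdisc : HasBoundedDiscrepancy κ₂ d M) (x y : Fin n → ℝ) (hx : ∑ i, x i ^ 2 ≤ 1)
    (hy : ∑ i, y i ^ 2 ≤ 1) :
    ∑ i, ∑ j, (if Real.exp 2 * √d / n < |x i * y j| then |x i * y j| * M i j else 0) ≤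
      (2 * κ₁ + 2 * (1216 * κ₂ + 128)) * √d := by
  classical
  have hn' : (0 : ℝ) < n := by exact_mod_cast hn
  have hsd : 0 < √d := Real.sqrt_pos.2 hd
  have hdd : √d * √d = d := Real.mul_self_sqrt hd.le
  obtain ⟨l, hl⟩ := exists_level x hx
  obtain ⟨l', hl'⟩ := exists_level y hy
  set I : ℕ → Finset (Fin n) := fun s => Finset.univ.filter fun i => x i ≠ 0 ∧ l i = s with hI
  set J : ℕ → Finset (Fin n) := fun s => Finset.univ.filter fun i => y i ≠ 0 ∧ l' i = s with hJ
  obtain ⟨m, hm, hm'⟩ : ∃ m, (∀ i, l i < m) ∧ ∀ i, l' i < m := by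
    refine ⟨Finset.univ.sup l ⊔ Finset.univ.sup l' + 1, fun i => ?_, fun i => ?_⟩
    · have := Finset.le_sup (f := l) (Finset.mem_univ i)
      omega
    · have := Finset.le_sup (f := l') (Finset.mem_univ i)
      omega
  have hIs := sum_card_level_le x hx l hl m
  have hJs := sum_card_level_le y hy l' hl' m
  have hA := sum_levels_le hn hκ₂ hd hdisc I J m hIs hJs
  have hB := sum_levels_le hn hκ₂ hd hdisc J I m hJs hIs
  -- contribution of the pairs of comparable size
  set mid : Fin n → Fin n → ℝ := fun i j =>
    if Real.exp 2 * √d / n < |x i * y j| ∧ |x i| < √d * |y j| ∧ |y j| < √d * |x i| then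
      |x i * y j| * M i j else 0 with hmid
  -- Replacing coordinates by powers of `1 / 4` loses at most a factor 4 in each comparison, whence
  -- `4 * √d`. Heaviness is inherited because the levels bound the coordinates from above.
  set F : ℕ → ℕ → ℝ := fun s t =>
    if Real.exp 2 ≤ n * ((1 / 4 : ℝ) ^ s * (1 / 4 : ℝ) ^ t) / √d ∧
      (1 / 4 : ℝ) ^ s ≤ 4 * √d * (1 / 4 : ℝ) ^ t ∧ (1 / 4 : ℝ) ^ t ≤ 4 * √d * (1 / 4 : ℝ) ^ s then
      (1 / 4 : ℝ) ^ s * (1 / 4 : ℝ) ^ t * ∑ i ∈ I s, ∑ j ∈ J t, M i j else 0 with hF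
  have hmidle : ∑ i, ∑ j, mid i j ≤ ∑ s ∈ Finset.range m, ∑ t ∈ Finset.range m, F s t := by
    have h1 : ∀ i j, mid i j ≤ ∑ s ∈ Finset.range m, ∑ t ∈ Finset.range m,
        (if Real.exp 2 ≤ n * ((1 / 4 : ℝ) ^ s * (1 / 4 : ℝ) ^ t) / √d ∧
          (1 / 4 : ℝ) ^ s ≤ 4 * √d * (1 / 4 : ℝ) ^ t ∧
          (1 / 4 : ℝ) ^ t ≤ 4 * √d * (1 / 4 : ℝ) ^ s then
        (1 / 4 : ℝ) ^ s * (1 / 4 : ℝ) ^ t *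
          (if i ∈ I s then (if j ∈ J t then M i j else 0) else 0) else 0) := by
      intro i j
      have hnn : ∀ s t, 0 ≤ (if Real.exp 2 ≤ n * ((1 / 4 : ℝ) ^ s * (1 / 4 : ℝ) ^ t) / √d ∧
          (1 / 4 : ℝ) ^ s ≤ 4 * √d * (1 / 4 : ℝ) ^ t ∧
          (1 / 4 : ℝ) ^ t ≤ 4 * √d * (1 / 4 : ℝ) ^ s then
        (1 / 4 : ℝ) ^ s * (1 / 4 : ℝ) ^ t *
          (if i ∈ I s then (if j ∈ J t then M i j else 0) else 0) else 0) := by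
        intro s t
        have := hM0 i j
        split_ifs <;> positivity
      simp only [hmid]
      split_ifs with h
      swap
      · exact Finset.sum_nonneg fun s _ => Finset.sum_nonneg fun t _ => hnn s t
      obtain ⟨h1, h2, h3⟩ := h
      have hxi : x i ≠ 0 := by
        rintro h0
        rw [h0, abs_zero, mul_zero] at h3
        exact absurd h3 (not_lt.2 (abs_nonneg _))
      have hyj : y j ≠ 0 := by
        rintro h0
        rw [h0, abs_zero, mul_zero] at h2
        exact absurd h2 (not_lt.2 (abs_nonneg _))
      have hli := hl i hxi
      have hlj := hl' j hyj
      refine le_trans ?_ (Finset.single_le_sum (fun s _ => Finset.sum_nonneg fun t _ => hnn s t)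
        (Finset.mem_range.2 (hm i)))
      refine le_trans ?_ (Finset.single_le_sum (fun t _ => hnn (l i) t)
        (Finset.mem_range.2 (hm' j)))
      have hiI : i ∈ I (l i) := by simp [hI, hxi]
      have hjJ : j ∈ J (l' j) := by simp [hJ, hyj]
      have hprod : |x i * y j| ≤ (1 / 4 : ℝ) ^ l i * (1 / 4 : ℝ) ^ l' j := by
        rw [abs_mul]
        exact mul_le_mul hli.2 hlj.2 (abs_nonneg _) (by positivity)
      rw [pow_succ] at hli hlj
      rw [if_pos, if_pos hiI, if_pos hjJ]
      · exact mul_le_mul_of_nonneg_right hprod (hM0 i j)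
      · refine ⟨?_, ?_, ?_⟩
        · rw [le_div_iff₀ hsd]
          rw [div_lt_iff₀ hn'] at h1
          have := mul_le_mul_of_nonneg_left hprod hn'.le
          linarith
        · have := mul_le_mul_of_nonneg_left hlj.2 hsd.le
          linarith
        · have := mul_le_mul_of_nonneg_left hli.2 hsd.le
          linarith
    refine (Finset.sum_le_sum fun i _ => Finset.sum_le_sum fun j _ => h1 i j).trans (le_of_eq ?_)
    have h2 : ∀ s t, F s t = ∑ i, ∑ j,
        (if Real.exp 2 ≤ n * ((1 / 4 : ℝ) ^ s * (1 / 4 : ℝ) ^ t) / √d ∧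
          (1 / 4 : ℝ) ^ s ≤ 4 * √d * (1 / 4 : ℝ) ^ t ∧
          (1 / 4 : ℝ) ^ t ≤ 4 * √d * (1 / 4 : ℝ) ^ s then
        (1 / 4 : ℝ) ^ s * (1 / 4 : ℝ) ^ t *
          (if i ∈ I s then (if j ∈ J t then M i j else 0) else 0) else 0) := by
      intro s t
      simp only [hF]
      split_ifs with h
      · simp only [← Finset.mul_sum]
        congr 1
        rw [← Finset.sum_filter_add_sum_filter_not Finset.univ (· ∈ I s)]
        rw [Finset.filter_mem_eq_inter, Finset.univ_inter]
        rw [Finset.sum_eq_zero (s := Finset.univ.filter (· ∉ I s)), add_zero]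
        · refine Finset.sum_congr rfl fun i hi => ?_
          simp [hi]
        · intro i hi
          simp [(Finset.mem_filter.1 hi).2]
      · simp
    simp only [h2]
    rw [Finset.sum_comm' (t' := Finset.univ) (s' := fun _ => Finset.univ) (by simp)]
    rw [Finset.sum_congr rfl fun j _ => Finset.sum_comm]
    rw [Finset.sum_comm]
    refine Finset.sum_congr rfl fun s _ => ?_
    rw [Finset.sum_congr rfl fun j _ => Finset.sum_comm]
    rw [Finset.sum_comm]
    refine Finset.sum_congr rfl fun t _ => ?_
    rw [Finset.sum_comm]
  have hFle : ∑ s ∈ Finset.range m, ∑ t ∈ Finset.range m, F s t ≤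
      2 * (1216 * κ₂ + 128) * √d := by
    rw [Finset.sum_comm] at hB
    -- Bounded discrepancy requires the first set to be the smaller one. The other case is the same
    -- statement with the two vectors exchanged, by symmetry of `M`; this doubles the constant.
    have h1 : ∀ s t, F s t ≤
        (if Real.exp 2 ≤ n * ((1 / 4 : ℝ) ^ s * (1 / 4 : ℝ) ^ t) / √d ∧
          (1 / 4 : ℝ) ^ s ≤ 4 * √d * (1 / 4 : ℝ) ^ t ∧ (I s).card ≤ (J t).card then
        (1 / 4 : ℝ) ^ s * (1 / 4 : ℝ) ^ t * ∑ i ∈ I s, ∑ j ∈ J t, M i j else 0) +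
        (if Real.exp 2 ≤ n * ((1 / 4 : ℝ) ^ t * (1 / 4 : ℝ) ^ s) / √d ∧
          (1 / 4 : ℝ) ^ t ≤ 4 * √d * (1 / 4 : ℝ) ^ s ∧ (J t).card ≤ (I s).card then
        (1 / 4 : ℝ) ^ t * (1 / 4 : ℝ) ^ s * ∑ i ∈ J t, ∑ j ∈ I s, M i j else 0) := by
      intro s t
      have hsymm : ∑ i ∈ J t, ∑ j ∈ I s, M i j = ∑ i ∈ I s, ∑ j ∈ J t, M i j := by
        rw [Finset.sum_comm]
        exact Finset.sum_congr rfl fun i _ => Finset.sum_congr rfl fun j _ => hMs _ _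
      rw [hsymm, mul_comm ((1 / 4 : ℝ) ^ t) ((1 / 4 : ℝ) ^ s)]
      have hnn : 0 ≤ (1 / 4 : ℝ) ^ s * (1 / 4 : ℝ) ^ t * ∑ i ∈ I s, ∑ j ∈ J t, M i j :=
        mul_nonneg (by positivity)
          (Finset.sum_nonneg fun i _ => Finset.sum_nonneg fun j _ => hM0 i j)
      simp only [hF]
      split_ifs with a1 a2 a3 a3 <;> try linarith
      rcases le_total (I s).card (J t).card with h | h
      · exact absurd ⟨a1.1, a1.2.1, h⟩ a2
      · exact absurd ⟨a1.1, a1.2.2, h⟩ a3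
    have h2 := Finset.sum_le_sum fun s (_ : s ∈ Finset.range m) =>
      Finset.sum_le_sum fun t (_ : t ∈ Finset.range m) => h1 s t
    simp only [Finset.sum_add_distrib] at h2
    linarith
  -- contribution of the other pairs
  have hpt : ∀ i j, (if Real.exp 2 * √d / n < |x i * y j| then |x i * y j| * M i j else 0) ≤
      x i ^ 2 / √d * M i j + y j ^ 2 / √d * M i j + mid i j := by
    intro i j
    have hM := hM0 i j
    have h1 : 0 ≤ x i ^ 2 / √d * M i j := by positivity
    have h2 : 0 ≤ y j ^ 2 / √d * M i j := by positivity
    have h3 : 0 ≤ mid i j := by simp only [hmid]; split_ifs <;> positivity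
    split_ifs with h
    swap
    · positivity
    -- For coordinates of very unequal size, the product is at most the larger square over `√d`, and
    -- the degree bound suffices.
    by_cases hxy : √d * |y j| ≤ |x i|
    · have : |x i * y j| ≤ x i ^ 2 / √d := by
        rw [le_div_iff₀ hsd, abs_mul, ← sq_abs]
        nlinarith [mul_le_mul_of_nonneg_left hxy (abs_nonneg (x i))]
      nlinarith [mul_le_mul_of_nonneg_right this hM]
    by_cases hyx : √d * |x i| ≤ |y j|
    · have : |x i * y j| ≤ y j ^ 2 / √d := by
        rw [le_div_iff₀ hsd, abs_mul, ← sq_abs (y j)]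
        nlinarith [mul_le_mul_of_nonneg_left hyx (abs_nonneg (y j))]
      nlinarith [mul_le_mul_of_nonneg_right this hM]
    · have : mid i j = |x i * y j| * M i j := by
        simp only [hmid]
        rw [if_pos ⟨h, not_le.1 hxy, not_le.1 hyx⟩]
      linarith
  have hdegx : ∀ x : Fin n → ℝ, ∑ i, x i ^ 2 ≤ 1 →
      ∑ i, ∑ j, x i ^ 2 / √d * M i j ≤ κ₁ * √d := by
    intro x hx
    have hκd : 0 ≤ κ₁ * d :=
      (Finset.sum_nonneg fun j _ => hM0 ⟨0, hn⟩ j).trans (hdeg ⟨0, hn⟩)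
    calc _ ≤ ∑ i, x i ^ 2 / √d * (κ₁ * d) := by
          refine Finset.sum_le_sum fun i _ => ?_
          rw [← Finset.mul_sum]
          exact mul_le_mul_of_nonneg_left (hdeg i) (by positivity)
      _ = (∑ i, x i ^ 2) * (κ₁ * d) / √d := by
          rw [Finset.sum_mul, Finset.sum_div]
          exact Finset.sum_congr rfl fun i _ => by ring
      _ ≤ 1 * (κ₁ * d) / √d := by gcongr
      _ = κ₁ * √d := by
          rw [div_eq_iff hsd.ne', mul_assoc, hdd, one_mul]
  have h1 := Finset.sum_le_sum fun i (_ : i ∈ Finset.univ) =>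
    Finset.sum_le_sum fun j (_ : j ∈ Finset.univ) => hpt i j
  simp only [Finset.sum_add_distrib] at h1
  have h2 := hdegx x hx
  have h3 : ∑ i, ∑ j, y j ^ 2 / √d * M i j ≤ κ₁ * √d := by
    rw [Finset.sum_comm]
    refine le_trans (le_of_eq ?_) (hdegx y hy)
    exact Finset.sum_congr rfl fun i _ => Finset.sum_congr rfl fun j _ => by rw [hMs]
  linarith

/-! Concentration of the weighted sums of adjacency matrices -/

lemma measure_exists_mem_le {Ω ι : Type*} [MeasurableSpace Ω] {μ : Measure Ω} (s : Finset ι)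
    (p : ι → Ω → Prop) {b : ι → ℝ} {B : ℝ} (hb : ∀ i ∈ s, 0 ≤ b i) (hB : ∑ i ∈ s, b i ≤ B)
    (h : ∀ i ∈ s, μ {ω | p i ω} ≤ ENNReal.ofReal (b i)) :
    μ {ω | ∃ i ∈ s, p i ω} ≤ ENNReal.ofReal B := by
  have e : {ω | ∃ i ∈ s, p i ω} = ⋃ i ∈ s, {ω | p i ω} := by ext; simp
  rw [e]
  refine (measure_biUnion_finset_le s _).trans ((Finset.sum_le_sum h).trans ?_)
  rw [← ENNReal.ofReal_sum_of_nonneg hb]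
  exact ENNReal.ofReal_le_ofReal hB

lemma measure_or_le {Ω : Type*} [MeasurableSpace Ω] {μ : Measure Ω} {p q : Ω → Prop} {a b : ℝ}
    (ha : 0 ≤ a) (hb : 0 ≤ b) (hp : μ {ω | p ω} ≤ ENNReal.ofReal a)
    (hq : μ {ω | q ω} ≤ ENNReal.ofReal b) : μ {ω | p ω ∨ q ω} ≤ ENNReal.ofReal (a + b) := by
  rw [ENNReal.ofReal_add ha hb]
  exact (measure_union_le {ω | p ω} {ω | q ω}).trans (add_le_add hp hq)

lemma setEntropy_mono {n a b : ℕ} (hab : a ≤ b) (hbn : b ≤ n) :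
    setEntropy n a ≤ setEntropy n b := by
  unfold setEntropy
  have hlog : ∀ b : ℕ, 0 < b → b ≤ n → 0 ≤ Real.log ((n : ℝ) / b) := fun b hb hbn => by
    apply Real.log_nonneg
    rw [le_div_iff₀ (by exact_mod_cast hb), one_mul]
    exact_mod_cast hbn
  rcases Nat.eq_zero_or_pos a with rfl | ha
  · rcases Nat.eq_zero_or_pos b with rfl | hb
    · simp
    · have := hlog b hb hbn
      simp only [Nat.cast_zero, zero_mul]
      positivity
  have hb : 0 < b := ha.trans_le hab
  have hn : 0 < n := hb.trans_le hbn
  have ha' : (0 : ℝ) < a := by exact_mod_cast ha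
  have hb' : (0 : ℝ) < b := by exact_mod_cast hb
  have hn' : (0 : ℝ) < n := by exact_mod_cast hn
  have h1 : Real.log ((n : ℝ) / a) = Real.log (n / b) + Real.log (b / a) := by
    rw [← Real.log_mul (by positivity) (by positivity)]
    congr 1
    field_simp
  have h2 : Real.log ((b : ℝ) / a) ≤ b / a - 1 := Real.log_le_sub_one_of_pos (by positivity)
  have h3 := mul_le_mul_of_nonneg_left h2 ha'.le
  have h4 : (a : ℝ) * (b / a - 1) = b - a := by field_simp
  have h5 := mul_le_mul_of_nonneg_right (show (a : ℝ) ≤ b by exact_mod_cast hab) (hlog b hb hbn)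
  rw [h1]
  nlinarith

/-- Each cardinality `a` contributes at most 1, because `n.choose a ≤ n ^ a / a!` and `a ^ a / a! ≤
exp a`. Thus `setEntropy` is the price of a union bound over all sets of nodes. -/
lemma sum_exp_neg_setEntropy_le (n : ℕ) :
    ∑ I : Finset (Fin n), Real.exp (-setEntropy n I.card) ≤ n + 1 := by
  rcases Nat.eq_zero_or_pos n with rfl | hn
  · simp [setEntropy]
  have hn' : (0 : ℝ) < n := by exact_mod_cast hn
  rw [← Finset.powerset_univ,
    Finset.sum_powerset_apply_card (fun k => Real.exp (-setEntropy n k)) (x := Finset.univ)]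
  have h : ∀ a ∈ Finset.range ((Finset.univ : Finset (Fin n)).card + 1),
      (Finset.univ : Finset (Fin n)).card.choose a • Real.exp (-setEntropy n a) ≤ 1 := by
    intro a _
    rw [Finset.card_univ, Fintype.card_fin, nsmul_eq_mul]
    rcases Nat.eq_zero_or_pos a with rfl | ha
    · simp [setEntropy]
    have ha' : (0 : ℝ) < a := by exact_mod_cast ha
    have h1 : Real.exp (-setEntropy n a) = (a / n : ℝ) ^ a / Real.exp a := by
      rw [eq_div_iff (Real.exp_pos _).ne', ← Real.exp_add, setEntropy]
      have : -((a : ℝ) * (1 + Real.log (n / a))) + a = a * Real.log (a / n) := by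
        rw [← inv_div (n : ℝ) a, Real.log_inv]; ring
      rw [this, Real.exp_nat_mul, Real.exp_log (by positivity)]
    rw [h1]
    have h2 := Nat.choose_le_pow_div (α := ℝ) a n
    have h3 := Real.pow_div_factorial_le_exp (a : ℝ) ha'.le a
    calc (n.choose a : ℝ) * ((a / n : ℝ) ^ a / Real.exp a)
        ≤ ((n : ℝ) ^ a / a.factorial) * ((a / n : ℝ) ^ a / Real.exp a) := by gcongr
      _ = ((a : ℝ) ^ a / a.factorial) / Real.exp a := by
          rw [div_pow]; field_simp
      _ ≤ 1 := by rw [div_le_one (Real.exp_pos _)]; exact h3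
  refine (Finset.sum_le_sum h).trans ?_
  simp

/-- Entries of the bilinear form of `Y` on light pairs. -/
noncomputable def lightPart {n : ℕ} (b : ℝ) (x y : Fin n → ℝ) (i j : Fin n) : ℝ :=
  if b < |x i * y j| then 0 else x i * y j

lemma abs_lightPart_le {n : ℕ} {b : ℝ} (hb : 0 ≤ b) (x y : Fin n → ℝ) (i j : Fin n) :
    |lightPart b x y i j| ≤ b := by
  unfold lightPart
  split_ifs with h
  · simpa using hb
  · exact not_lt.1 h

lemma sum_mul_sq_le_one {n : ℕ} {x y : Fin n → ℝ} (hx : ∑ i, x i ^ 2 ≤ 1)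
    (hy : ∑ i, y i ^ 2 ≤ 1) : ∑ i, ∑ j, (x i * y j) ^ 2 ≤ 1 := by
  simp only [mul_pow, ← Finset.mul_sum, ← Finset.sum_mul]
  exact mul_le_one₀ hx (Finset.sum_nonneg fun _ _ => sq_nonneg _) hy

lemma sum_lightPart_sq_le {n : ℕ} (b : ℝ) {x y : Fin n → ℝ} (hx : ∑ i, x i ^ 2 ≤ 1)
    (hy : ∑ i, y i ^ 2 ≤ 1) : ∑ i, ∑ j, lightPart b x y i j ^ 2 ≤ 1 := by
  refine le_trans ?_ (sum_mul_sq_le_one hx hy)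
  refine Finset.sum_le_sum fun i _ => Finset.sum_le_sum fun j _ => ?_
  unfold lightPart
  split_ifs
  · simpa using sq_nonneg (x i * y j)
  · exact le_rfl

/-- A deterministic bound of a bilinear form by its light and heavy pairs. -/
lemma abs_bilinear_le {n : ℕ} (hn : 0 < n) {d Wmax κ₁ κ₂ a : ℝ} (hd : 0 < d) (hW : 0 ≤ Wmax)
    (hκ₂ : 0 ≤ κ₂)
    {M Y : Fin n → Fin n → ℝ} (hM0 : ∀ i j, 0 ≤ M i j) (hMs : ∀ i j, M i j = M j i)
    (hY : ∀ i j, |Y i j| ≤ Wmax * (M i j + d / n))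
    (hdeg : ∀ i, ∑ j, M i j ≤ κ₁ * d) (hdisc : HasBoundedDiscrepancy κ₂ d M)
    {x y : Fin n → ℝ} (hx : ∑ i, x i ^ 2 ≤ 1) (hy : ∑ i, y i ^ 2 ≤ 1)
    (hlight : |∑ i, ∑ j, lightPart (Real.exp 2 * √d / n) x y i j * Y i j| ≤ a) :
    |∑ i, ∑ j, x i * y j * Y i j| ≤
      a + Wmax * ((2 * κ₁ + 2 * (1216 * κ₂ + 128) + 1) * √d) := by
  have hn' : (0 : ℝ) < n := by exact_mod_cast hn
  have hsd : 0 < √d := Real.sqrt_pos.2 hd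
  have hdd : √d * √d = d := Real.mul_self_sqrt hd.le
  set b := Real.exp 2 * √d / n with hb
  have hb0 : 0 < b := by positivity
  have heavy := sum_heavy_pairs_le hn hκ₂ hd hM0 hMs hdeg hdisc x y hx hy
  have hsplit : ∑ i, ∑ j, x i * y j * Y i j = ∑ i, ∑ j, lightPart b x y i j * Y i j +
      ∑ i, ∑ j, (if b < |x i * y j| then x i * y j * Y i j else 0) := by
    rw [← Finset.sum_add_distrib]
    refine Finset.sum_congr rfl fun i _ => ?_
    rw [← Finset.sum_add_distrib]
    refine Finset.sum_congr rfl fun j _ => ?_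
    unfold lightPart
    split_ifs <;> ring
  have hpt : ∀ i j, |if b < |x i * y j| then x i * y j * Y i j else 0| ≤
      Wmax * ((if b < |x i * y j| then |x i * y j| * M i j else 0) +
        d / n * ((x i * y j) ^ 2 / b)) := by
    intro i j
    have hpos : 0 ≤ d / n * ((x i * y j) ^ 2 / b) := by positivity
    split_ifs with h
    · rw [abs_mul]
      -- On heavy pairs the mean part `d / n` is harmless: one factor is exchanged for `1 / b`, and
      -- the squares sum to at most 1.
      have h1 : |x i * y j| ≤ (x i * y j) ^ 2 / b := by
        rw [le_div_iff₀ hb0, ← sq_abs (x i * y j)]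
        nlinarith [abs_nonneg (x i * y j)]
      have h2 : 0 ≤ d / n := by positivity
      calc |x i * y j| * |Y i j| ≤ |x i * y j| * (Wmax * (M i j + d / n)) := by
            gcongr; exact hY i j
        _ = Wmax * (|x i * y j| * M i j + d / n * |x i * y j|) := by ring
        _ ≤ _ := by gcongr
    · simp only [abs_zero, zero_add]
      positivity
  have hheavy : |∑ i, ∑ j, (if b < |x i * y j| then x i * y j * Y i j else 0)| ≤
      Wmax * ((2 * κ₁ + 2 * (1216 * κ₂ + 128) + 1) * √d) := by
    refine (Finset.abs_sum_le_sum_abs _ _).trans ?_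
    refine (Finset.sum_le_sum fun i _ => (Finset.abs_sum_le_sum_abs _ _).trans
      (Finset.sum_le_sum fun j _ => hpt i j)).trans ?_
    simp only [← Finset.mul_sum, Finset.sum_add_distrib, ← Finset.sum_div]
    gcongr
    have h2 : d / n * ((∑ i, ∑ j, (x i * y j) ^ 2) / b) ≤ √d := by
      calc _ ≤ d / n * (1 / b) := by gcongr; exact sum_mul_sq_le_one hx hy
        _ = √d / Real.exp 2 := by
            rw [hb]; field_simp
            rw [sq, hdd]
        _ ≤ √d := div_le_self hsd.le (Real.one_le_exp (by norm_num))
    linarith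
  rw [hsplit]
  exact (abs_add_le _ _).trans (add_le_add hlight hheavy)

/-! ### Probability bounds for degrees, discrepancy and light pairs -/

section Network

variable {Ω : Type*} [MeasurableSpace Ω] {μ : Measure Ω} [IsProbabilityMeasure μ] {n T : ℕ} {dg : ℝ}
  {P : ℤ → Matrix (Fin n) (Fin n) ℝ} {A : ℤ → Ω → Matrix (Fin n) (Fin n) ℝ}

lemma exp_neg_mul_log_eq {n : ℕ} (hn : 0 < n) (κ : ℝ) :
    Real.exp (-(κ * Real.log n)) = (n : ℝ) ^ (-κ) := by
  rw [Real.rpow_def_of_pos (by exact_mod_cast hn)]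
  congr 1
  ring

/-- Chernoff's bound with `θ = 1 / 2` and `(exp 1 - 1) / 2 ≤ 1`. The deviation `(κ + 1) log n`
contains one extra `log n` for the union over the nodes, and it is of the order of the mean degree
because of the sparsity condition. -/
lemma IsDynamicNetwork.measure_degree_le (hA : IsDynamicNetwork μ T dg P A) (hn : 0 < n)
    {S : Finset ℤ}
    (hS : ∀ u ∈ S, u ∈ Set.Icc (1 : ℤ) T) {q : ℝ} (hP0 : ∀ u ∈ S, ∀ i j, 0 ≤ P u i j)
    (hPq : ∀ u ∈ S, ∀ i j, P u i j ≤ q) (hq : 0 ≤ q) {c : ℝ} (hc : 0 < c)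
    (hd : c * Real.log n ≤ n * (q * S.card)) {κ : ℝ} (hκ : 0 ≤ κ) :
    μ {ω | ∃ i ∈ Finset.univ, ¬ ∑ j, offDiag (∑ u ∈ S, A u ω) i j ≤
        (2 * ((κ + 1) / c) + 2) * (n * (q * S.card))} ≤ ENNReal.ofReal ((n : ℝ) ^ (-κ)) := by
  have hn' : (0 : ℝ) < n := by exact_mod_cast hn
  refine measure_exists_mem_le (b := fun _ => (n : ℝ) ^ (-(κ + 1))) _ _ (fun i _ => by positivity)
    ?_ fun i _ => ?_
  · rw [Finset.sum_const, Finset.card_univ, Fintype.card_fin, nsmul_eq_mul]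
    rw [neg_add, Real.rpow_add hn', Real.rpow_neg_one]
    apply le_of_eq
    field_simp
  have key := hA.measure_edgeCount_ge_le hS hP0 hPq hq {i} Finset.univ
    (show (0 : ℝ) ≤ 1 / 2 by norm_num) ((κ + 1) * Real.log n)
  rw [exp_neg_mul_log_eq hn] at key
  refine le_trans (measure_mono fun ω hω => ?_) key
  simp only [Set.mem_ofPred_eq, Finset.card_singleton, Finset.sum_singleton, Finset.card_univ,
    Fintype.card_fin, not_le] at hω ⊢
  rw [show (2 : ℝ) * (1 / 2) = 1 by norm_num]
  have he : Real.exp 1 ≤ 3 := Real.exp_one_lt_three.le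
  have h1 : (κ + 1) * Real.log n ≤ (κ + 1) / c * (n * (q * S.card)) := by
    rw [div_mul_eq_mul_div, le_div_iff₀ hc]
    nlinarith
  have h2 : 0 ≤ n * (q * S.card) := by positivity
  push_cast
  nlinarith

/-- Chernoff's bound with `exp (2 θ) = ρ`, followed by a union over levels `k` and pairs of sets. Of
the `κ + 5` units of entropy, two pay for the choice of `I` and `J`. The other `κ + 3` give `n ^
(-(κ + 3))`, since the entropy of a nonempty set is at least `1 + log n`. Three powers of `n` are
then spent: one on the levels, as `ρ ≥ exp 2` forces `4 ^ k ≤ n / √d`, and two on the entropy sums,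
each at most `n + 1`. -/
lemma IsDynamicNetwork.measure_discrepancy_le (hA : IsDynamicNetwork μ T dg P A) (hn : 0 < n)
    {S : Finset ℤ}
    (hS : ∀ u ∈ S, u ∈ Set.Icc (1 : ℤ) T) {q : ℝ} (hP0 : ∀ u ∈ S, ∀ i j, 0 ≤ P u i j)
    (hPq : ∀ u ∈ S, ∀ i j, P u i j ≤ q) (hq : 0 ≤ q) {D : ℝ} (hd : 0 < n * (q * S.card))
    (hD : 1 / √(n * (q * S.card)) ≤ D) {κ : ℝ} (hκ : 0 ≤ κ) :
    μ {ω | ¬ HasBoundedDiscrepancy (κ + 5) (n * (q * S.card))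
        (offDiag (∑ u ∈ S, A u ω) : Fin n → Fin n → ℝ)} ≤
      ENNReal.ofReal (4 * (D + 2) * (n : ℝ) ^ (-κ)) := by
  classical
  have hn' : (0 : ℝ) < n := by exact_mod_cast hn
  have hn1 : (1 : ℝ) ≤ n := by exact_mod_cast hn
  have hdn : q * S.card = n * (q * S.card) / n := by field_simp
  set d := n * (q * S.card)
  clear_value d
  have hsd : 0 < √d := Real.sqrt_pos.2 hd
  have hD0 : 0 ≤ D := le_trans (by positivity) hD
  set Kn := ⌈n / √d⌉₊ + 1 with hKn
  let p : ℕ × Finset (Fin n) × Finset (Fin n) → Ω → Prop := fun e ω =>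
    e.2.1.card ≤ e.2.2.card ∧ Real.exp 2 ≤ n * (1 / 4 : ℝ) ^ e.1 / √d ∧ 0 < e.2.2.card ∧
    ¬ 1 / 2 * Real.log (n * (1 / 4 : ℝ) ^ e.1 / √d) *
      ∑ i ∈ e.2.1, ∑ j ∈ e.2.2, (offDiag (∑ u ∈ S, A u ω) : Fin n → Fin n → ℝ) i j ≤
      (κ + 5) * setEntropy n e.2.2.card +
        d / n * (e.2.1.card * e.2.2.card) * (n * (1 / 4 : ℝ) ^ e.1 / √d / 2)
  let b : ℕ × Finset (Fin n) × Finset (Fin n) → ℝ := fun e =>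
    (n : ℝ) ^ (-(κ + 3)) * (Real.exp (-setEntropy n e.2.1.card) *
      Real.exp (-setEntropy n e.2.2.card))
  have hcardn : ∀ I : Finset (Fin n), I.card ≤ n := fun I => by
    simpa using Finset.card_le_univ I
  have key : μ {ω | ∃ e ∈ Finset.range Kn ×ˢ (Finset.univ ×ˢ Finset.univ), p e ω} ≤
      ENNReal.ofReal (4 * (D + 2) * (n : ℝ) ^ (-κ)) := by
    refine measure_exists_mem_le (b := b) _ _ (fun e _ => by positivity) ?_ ?_
    · rw [Finset.sum_product]
      simp only [b]
      simp only [Finset.sum_product, ← Finset.mul_sum, ← Finset.sum_mul, Finset.sum_const,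
        Finset.card_range, nsmul_eq_mul]
      have h1 := sum_exp_neg_setEntropy_le n
      have h0 : 0 ≤ ∑ I : Finset (Fin n), Real.exp (-setEntropy n I.card) :=
        Finset.sum_nonneg fun _ _ => (Real.exp_pos _).le
      have h2 : (Kn : ℝ) ≤ (D + 2) * n := by
        rw [hKn]
        push_cast
        have h3 := (Nat.ceil_lt_add_one (show 0 ≤ n / √d by positivity)).le
        have h4 : n / √d ≤ D * n := by
          rw [div_eq_mul_one_div, mul_comm]
          gcongr
        linarith
      have h3 : (n : ℝ) ^ (-(κ + 3)) * (n : ℝ) ^ (3 : ℕ) = (n : ℝ) ^ (-κ) := by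
        rw [← Real.rpow_natCast, ← Real.rpow_add hn']
        congr 1
        push_cast; ring
      calc _ = (Kn : ℝ) * ((n : ℝ) ^ (-(κ + 3)) * ((∑ I : Finset (Fin n),
            Real.exp (-setEntropy n I.card)) * ∑ I : Finset (Fin n),
            Real.exp (-setEntropy n I.card))) := by ring
        _ ≤ (D + 2) * n * ((n : ℝ) ^ (-(κ + 3)) * ((n + 1) * (n + 1))) := by gcongr
        _ ≤ (D + 2) * n * ((n : ℝ) ^ (-(κ + 3)) * ((n + n) * (n + n))) := by gcongr
        _ = 4 * (D + 2) * ((n : ℝ) ^ (-(κ + 3)) * (n : ℝ) ^ (3 : ℕ)) := by ring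
        _ = _ := by rw [h3]
    · rintro ⟨k, I, J⟩ -
      by_cases hcond : I.card ≤ J.card ∧ Real.exp 2 ≤ n * (1 / 4 : ℝ) ^ k / √d ∧ 0 < J.card
      swap
      · have : {ω | p (k, I, J) ω} = ∅ := by
          ext ω
          simp only [p, Set.mem_ofPred_eq, Set.mem_empty_iff_false, iff_false]
          tauto
        rw [this]
        simp
      obtain ⟨hIJ, hρ, hJ⟩ := hcond
      set ρ := n * (1 / 4 : ℝ) ^ k / √d with hρdef
      have hρ0 : 0 < ρ := by positivity
      have hlog : 2 ≤ Real.log ρ := by rwa [Real.le_log_iff_exp_le hρ0]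
      have h1 := hA.measure_edgeCount_ge_le hS hP0 hPq hq I J
        (show 0 ≤ 1 / 2 * Real.log ρ by linarith) ((κ + 5) * setEntropy n J.card)
      rw [show 2 * (1 / 2 * Real.log ρ) = Real.log ρ by ring, Real.exp_log hρ0, hdn] at h1
      refine le_trans (measure_mono fun ω hω => ?_) (h1.trans (ENNReal.ofReal_le_ofReal ?_))
      · simp only [p, Set.mem_ofPred_eq, not_le] at hω ⊢
        have h3 := hω.2.2.2
        have : 0 ≤ d / n * (I.card * J.card) := by positivity
        nlinarith
      · simp only [b]
        rw [← exp_neg_mul_log_eq hn, ← Real.exp_add, ← Real.exp_add]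
        apply Real.exp_le_exp.2
        have h2 := setEntropy_mono hIJ (hcardn J)
        have h3 := setEntropy_mono (show 1 ≤ J.card from hJ) (hcardn J)
        have h4 : setEntropy n 1 = 1 + Real.log n := by simp [setEntropy]
        rw [h4] at h3
        have h5 := mul_le_mul_of_nonneg_left h3 (show 0 ≤ κ + 3 by linarith)
        linarith
  refine le_trans (measure_mono fun ω hω => ?_) key
  simp only [Set.mem_ofPred_eq, HasBoundedDiscrepancy] at hω ⊢
  push Not at hω
  obtain ⟨k, I, J, hIJ, hρ, hlt⟩ := hω
  refine ⟨(k, I, J), ?_, hIJ, hρ, ?_, not_le.2 hlt⟩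
  · simp only [Finset.mem_product, Finset.mem_range, Finset.mem_univ, and_true]
    rw [hKn, Nat.lt_succ_iff]
    have h1 : (k : ℝ) ≤ n / √d := by
      have h2 : (k : ℝ) ≤ 4 ^ k := by exact_mod_cast (Nat.lt_pow_self (by norm_num : 1 < 4)).le
      have h3 : 1 ≤ n * (1 / 4 : ℝ) ^ k / √d := (Real.one_le_exp (by norm_num)).trans hρ
      refine h2.trans ?_
      rw [one_div_pow, mul_one_div, div_div, le_div_iff₀ (by positivity), one_mul] at h3
      rwa [le_div_iff₀ hsd]
    exact_mod_cast h1.trans (Nat.le_ceil _)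
  · by_contra h0
    have hJ0 : J.card = 0 := Nat.eq_zero_of_not_pos h0
    have hI0 : I.card = 0 := by omega
    simp [Finset.card_eq_zero.1 hJ0, Finset.card_eq_zero.1 hI0, setEntropy] at hlt

/-- The parameter `lam` is the largest one allowed by Bernstein's inequality for entries bounded by
`exp 2 * √d / n`. The variance term is then at most `n`. The deviation `(κ + 4) n` pays `4 n` for
the at most `25 ^ n ≤ exp (4 n)` pairs of points of the net and leaves `exp (-κ n)`. -/
lemma IsDynamicNetwork.measure_light_le (hA : IsDynamicNetwork μ T dg P A) (hn : 0 < n)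
    {S : Finset ℤ}
    (hS : ∀ u ∈ S, u ∈ Set.Icc (1 : ℤ) T) {q : ℝ} (hP0 : ∀ u ∈ S, ∀ i j, 0 ≤ P u i j)
    (hPq : ∀ u ∈ S, ∀ i j, P u i j ≤ q) (hq : 0 ≤ q) (hPs : ∀ u ∈ S, ∀ i j, P u i j = P u j i)
    {w : ℤ → ℝ} {Wmax : ℝ} (hW : ∀ u ∈ S, |w u| ≤ Wmax) (hW0 : 0 < Wmax)
    (hd : 0 < n * (q * S.card)) {κ : ℝ} (hκ : 0 ≤ κ) {N : Finset (Fin n → ℝ)}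
    (hNc : N.card ≤ 5 ^ n) (hN1 : ∀ x ∈ N, ∑ i, x i ^ 2 ≤ 1) :
    μ {ω | ∃ e ∈ N ×ˢ N, ¬ |∑ i, ∑ j,
        lightPart (Real.exp 2 * √(n * (q * S.card)) / n) e.1 e.2 i j *
          offDiag (∑ u ∈ S, w u • (A u ω - P u)) i j| ≤
        2 * Real.exp 2 * (κ + 5) * Wmax * √(n * (q * S.card))} ≤
      ENNReal.ofReal (2 * (n : ℝ) ^ (-κ)) := by
  have hn' : (0 : ℝ) < n := by exact_mod_cast hn
  have hdn : q * S.card = n * (q * S.card) / n := by field_simp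
  set d := n * (q * S.card)
  clear_value d
  have hsd : 0 < √d := Real.sqrt_pos.2 hd
  have hsq : √d ^ 2 = d := Real.sq_sqrt hd.le
  set bb := Real.exp 2 * √d / n with hbb
  have hbb0 : 0 ≤ bb := by positivity
  set lam := n / (2 * Real.exp 2 * Wmax * √d) with hlam
  have hlam0 : 0 < lam := by positivity
  have hsmall : 2 * lam * Wmax * bb ≤ 1 := by
    rw [hlam, hbb]
    apply le_of_eq
    field_simp
  have hquad : 2 * lam ^ 2 * Wmax ^ 2 * (q * S.card) ≤ n := by
    rw [hdn, hlam]
    have : 2 * (n / (2 * Real.exp 2 * Wmax * √d)) ^ 2 * Wmax ^ 2 * (d / n) =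
        n / (2 * Real.exp 2 ^ 2) := by
      nth_rewrite 2 [← hsq]
      field_simp
    rw [this]
    apply div_le_self hn'.le
    nlinarith [Real.one_le_exp (show (0 : ℝ) ≤ 2 by norm_num)]
  set h := (κ + 4) * n with hh
  refine measure_exists_mem_le (b := fun _ => 2 * Real.exp (-h)) _ _ (fun e _ => by positivity)
    ?_ ?_
  · rw [Finset.sum_const, nsmul_eq_mul, Finset.card_product]
    have h1 : ((N.card * N.card : ℕ) : ℝ) ≤ Real.exp (4 * n) := by
      have h2 : (N.card : ℝ) ≤ 5 ^ n := by exact_mod_cast hNc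
      have h3 : (25 : ℝ) ≤ Real.exp 4 := by
        have h5 : Real.exp 4 = Real.exp 1 ^ 4 := by rw [← Real.exp_nat_mul]; norm_num
        have h6 := Real.exp_one_gt_d9.le
        rw [h5]
        calc (25 : ℝ) ≤ 2.7 ^ 4 := by norm_num
          _ ≤ _ := by gcongr; linarith
      push_cast
      calc (N.card : ℝ) * N.card ≤ 5 ^ n * 5 ^ n := by gcongr
        _ = 25 ^ n := by rw [← mul_pow]; norm_num
        _ ≤ Real.exp 4 ^ n := by gcongr
        _ = Real.exp (4 * n) := by rw [← Real.exp_nat_mul, mul_comm]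
    calc _ ≤ Real.exp (4 * n) * (2 * Real.exp (-h)) := by gcongr
      _ = 2 * Real.exp (-(κ * n)) := by
          rw [mul_left_comm, ← Real.exp_add, hh]
          congr 2
          ring
      _ ≤ 2 * Real.exp (-(κ * Real.log n)) := by
          gcongr
          exact (Real.log_le_sub_one_of_pos hn').trans (by linarith)
      _ = _ := by rw [exp_neg_mul_log_eq hn]
  · rintro ⟨x, y⟩ he
    have hx := hN1 x (Finset.mem_product.1 he).1
    have hy := hN1 y (Finset.mem_product.1 he).2
    have hv := sum_lightPart_sq_le bb hx hy
    have k1 := hA.measure_bilinear_ge_le hS hP0 hPq hq hPs hW (abs_lightPart_le hbb0 x y) hv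
      hlam0.le hsmall h
    have k2 := hA.measure_bilinear_ge_le hS hP0 hPq hq hPs hW
      (v := fun i j => -lightPart bb x y i j)
      (fun i j => by rw [abs_neg]; exact abs_lightPart_le hbb0 x y i j)
      (by simpa only [neg_sq] using hv) hlam0.le hsmall h
    have k := measure_or_le (Real.exp_pos _).le (Real.exp_pos _).le k1 k2
    rw [← two_mul] at k
    refine le_trans (measure_mono fun ω hω => ?_) k
    simp only [Set.mem_ofPred_eq, not_le, lt_abs, neg_mul, Finset.sum_neg_distrib] at hω ⊢
    have e1 : lam * (2 * Real.exp 2 * (κ + 5) * Wmax * √d) = n + h := by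
      rw [hlam, hh]
      field_simp
      ring
    rcases hω with hω | hω
    · left
      have := mul_le_mul_of_nonneg_left hω.le hlam0.le
      linarith
    · right
      have := mul_le_mul_of_nonneg_left hω.le hlam0.le
      linarith

end Network

/-- Concentration of the weighted sums of independent sparse adjacency matrices in the spectral norm,
without logarithmic factors. -/
theorem exists_specNorm_noise_concentration {c Wmax : ℝ} (hc : 0 < c) (hW0 : 0 < Wmax) :
    ∃ C₁ C₂ : ℝ, 0 < C₁ ∧ 0 < C₂ ∧ ∀ {Ω : Type*} [MeasurableSpace Ω] {μ : Measure Ω}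
      [IsProbabilityMeasure μ] {n T : ℕ} {dg : ℝ} {P : ℤ → Matrix (Fin n) (Fin n) ℝ}
      {A : ℤ → Ω → Matrix (Fin n) (Fin n) ℝ}, IsDynamicNetwork μ T dg P A → 2 ≤ n →
      ∀ {S : Finset ℤ}, (∀ u ∈ S, u ∈ Set.Icc (1 : ℤ) T) →
      ∀ {q : ℝ}, (∀ u ∈ S, ∀ i j, 0 ≤ P u i j) → (∀ u ∈ S, ∀ i j, P u i j ≤ q) → 0 ≤ q →
      (∀ u ∈ S, ∀ i j, P u i j = P u j i) → ∀ {w : ℤ → ℝ}, (∀ u ∈ S, |w u| ≤ Wmax) →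
      c * Real.log n ≤ n * (q * S.card) → ∀ {κ : ℝ}, 0 ≤ κ →
      μ {ω | ¬ specNorm (offDiag (∑ u ∈ S, w u • (A u ω - P u))) ≤
        C₁ * (κ + 1) * √(n * (q * S.card))} ≤ ENNReal.ofReal (C₂ * (n : ℝ) ^ (-κ)) := by
  set D : ℝ := 1 / √(c * Real.log 2) with hD
  have hlog2 : 0 < Real.log 2 := Real.log_pos (by norm_num)
  have hD0 : 0 < D := by positivity
  -- The factor 4 is the loss on the net. The bracket collects the light and heavy constants after
  -- `κ + 5 ≤ 5 (κ + 1)`, so that the bound is linear in `κ`. The second constant adds the failure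
  -- probabilities for degrees, discrepancy and light pairs.
  refine ⟨4 * (Wmax * (10 * Real.exp 2 + (2 * (2 / c + 2) + 2 * (1216 * 5 + 128) + 1))),
    1 + 4 * (D + 2) + 2, by positivity, by positivity, ?_⟩
  intro Ω _ μ _ n T dg P A hA hn S hS q hP0 hPq hq hPs w hW hcd κ hκ
  have hn0 : 0 < n := by omega
  have hn' : (0 : ℝ) < n := by exact_mod_cast hn0
  have hlogn : Real.log 2 ≤ Real.log n :=
    Real.log_le_log (by norm_num) (by exact_mod_cast hn)
  have hd2 : c * Real.log 2 ≤ n * (q * S.card) :=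
    (mul_le_mul_of_nonneg_left hlogn hc.le).trans hcd
  have hd : 0 < n * (q * S.card) := lt_of_lt_of_le (by positivity) hd2
  have hDle : 1 / √(n * (q * S.card)) ≤ D := by
    rw [hD]
    gcongr
  obtain ⟨N, hNc, hN1, hNd⟩ := exists_net n
  have k1 := hA.measure_degree_le hn0 hS hP0 hPq hq hc hcd hκ
  have k2 := hA.measure_discrepancy_le hn0 hS hP0 hPq hq hd hDle hκ
  have k3 := hA.measure_light_le hn0 hS hP0 hPq hq hPs hW hW0 hd hκ hNc hN1
  have hr : 0 ≤ (n : ℝ) ^ (-κ) := by positivity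
  have k := measure_or_le (by positivity) (by positivity)
    (measure_or_le (by positivity) (by positivity) k1 k2) k3
  rw [show (1 + 4 * (D + 2) + 2) * (n : ℝ) ^ (-κ) =
    (n : ℝ) ^ (-κ) + 4 * (D + 2) * (n : ℝ) ^ (-κ) + 2 * (n : ℝ) ^ (-κ) by ring]
  refine le_trans (measure_mono fun ω hω => ?_) k
  simp only [Set.mem_ofPred_eq] at hω ⊢
  by_contra hcon
  apply hω
  push Not at hcon
  obtain ⟨⟨hdeg, hdisc⟩, hlight⟩ := hcon
  have hdn : q * S.card = n * (q * S.card) / n := by field_simp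
  set d := n * (q * S.card)
  clear_value d
  have hsd : 0 < √d := Real.sqrt_pos.2 hd
  have hAuv : ∀ u ∈ S, ∀ i j, i ≠ j → 0 ≤ A u ω i j := fun u hu i j hij => by
    rcases hA.binary u (hS u hu) ω i j hij with h | h <;> simp [h]
  have hM0 : ∀ i j, 0 ≤ offDiag (∑ u ∈ S, A u ω) i j := fun i j => by
    rw [offDiag_apply]
    split_ifs with h
    · exact le_rfl
    · rw [Matrix.sum_apply]
      exact Finset.sum_nonneg fun u hu => hAuv u hu i j h
  have hMs : ∀ i j, offDiag (∑ u ∈ S, A u ω) i j = offDiag (∑ u ∈ S, A u ω) j i := fun i j => by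
    simp only [offDiag_apply, eq_comm (a := j), Matrix.sum_apply]
    split_ifs
    · rfl
    · exact Finset.sum_congr rfl fun u hu => hA.symm u (hS u hu) ω i j
  have hY : ∀ i j, |offDiag (∑ u ∈ S, w u • (A u ω - P u)) i j| ≤
      Wmax * (offDiag (∑ u ∈ S, A u ω) i j + d / n) := fun i j => by
    rw [offDiag_apply, offDiag_apply]
    split_ifs with h
    · rw [abs_zero]; positivity
    · rw [Matrix.sum_apply, Matrix.sum_apply, ← hdn, mul_comm q, ← nsmul_eq_mul, ← Finset.sum_const,
        ← Finset.sum_add_distrib, Finset.mul_sum]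
      refine (Finset.abs_sum_le_sum_abs _ _).trans (Finset.sum_le_sum fun u hu => ?_)
      simp only [Matrix.smul_apply, Matrix.sub_apply, smul_eq_mul, abs_mul]
      have h1 := hAuv u hu i j h
      have h2 := hP0 u hu i j
      have h3 := hPq u hu i j
      have h4 : |A u ω i j - P u i j| ≤ A u ω i j + q := by
        exact abs_le.2 ⟨by linarith, by linarith⟩
      exact mul_le_mul (hW u hu) h4 (abs_nonneg _) hW0.le
  refine (specNorm_le_of_net N hNd _ ((Wmax * (10 * Real.exp 2 +
    (2 * (2 / c + 2) + 2 * (1216 * 5 + 128) + 1))) * (κ + 1) * √d) ?_).trans (le_of_eq (by ring))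
  intro x hx y hy
  have hb := abs_bilinear_le hn0 hd hW0.le (show 0 ≤ κ + 5 by linarith) hM0 hMs hY
    (fun i => hdeg i (Finset.mem_univ i)) hdisc (hN1 x hx) (hN1 y hy)
    (hlight (x, y) (Finset.mem_product.2 ⟨hx, hy⟩))
  have e1 : x ⬝ᵥ (offDiag (∑ u ∈ S, w u • (A u ω - P u))).mulVec y =
      ∑ i, ∑ j, x i * y j * offDiag (∑ u ∈ S, w u • (A u ω - P u)) i j := by
    simp only [dotProduct, Matrix.mulVec, Finset.mul_sum]
    exact Finset.sum_congr rfl fun i _ => Finset.sum_congr rfl fun j _ => by ring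
  rw [e1]
  refine hb.trans ?_
  have hE := Real.exp_pos 2
  have h6 : 2 * Real.exp 2 * (κ + 5) * Wmax * √d +
      Wmax * ((2 * (2 * ((κ + 1) / c) + 2) + 2 * (1216 * (κ + 5) + 128) + 1) * √d) =
      Wmax * √d * (2 * Real.exp 2 * (κ + 5) +
        (2 * (2 / c * (κ + 1) + 2) + 2 * (1216 * (κ + 5) + 128) + 1)) := by ring
  rw [h6, show Wmax * (10 * Real.exp 2 + (2 * (2 / c + 2) + 2 * (1216 * 5 + 128) + 1)) * (κ + 1) * √d
    = Wmax * √d * (10 * Real.exp 2 * (κ + 1) + (2 * (2 / c * (κ + 1) + 2 * (κ + 1)) +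
      2 * (1216 * (5 * (κ + 1)) + 128 * (κ + 1)) + (κ + 1))) by ring]
  have h7 : 0 ≤ κ * Real.exp 2 := by positivity
  gcongr Wmax * √d * ?_
  nlinarith

/-! Taylor expansion of Hölder functions -/

/-- Induction on the order, applied to the derivative: the expansion of `f'` is integrated term by
term, and the remainder is carried over by the mean value inequality on the segment. The
coefficients are left unspecified, because the kernel annihilates any polynomial without constant
term of degree at most `l`. -/
lemma exists_taylor_bound {γ L : ℝ} (hγ : 0 < γ) (hL : 0 ≤ L) (l : ℕ) :
    ∀ f : ℝ → ℝ, ContDiffOn ℝ (l : ℕ∞) f (Set.Icc 0 1) →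
      (∀ x ∈ Set.Icc (0 : ℝ) 1, ∀ y ∈ Set.Icc (0 : ℝ) 1,
        |iteratedDerivWithin l f (Set.Icc 0 1) x - iteratedDerivWithin l f (Set.Icc 0 1) y| ≤
          L * |x - y| ^ γ) →
      ∀ x ∈ Set.Icc (0 : ℝ) 1, ∃ c : ℕ → ℝ, ∀ y ∈ Set.Icc (0 : ℝ) 1,
        |f y - f x - ∑ k ∈ Finset.range l, c k * (y - x) ^ (k + 1)| ≤
          L * |y - x| ^ ((l : ℝ) + γ) := by
  have hu : UniqueDiffOn ℝ (Set.Icc (0 : ℝ) 1) := uniqueDiffOn_Icc zero_lt_one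
  induction l with
  | zero =>
    intro f _ hf x hx
    refine ⟨0, fun y hy => ?_⟩
    simpa using hf y hy x hx
  | succ l ih =>
    intro f hf1 hf x hx
    set g := derivWithin f (Set.Icc 0 1) with hg
    have hdiff : DifferentiableOn ℝ f (Set.Icc 0 1) :=
      hf1.differentiableOn (by simp)
    have hg1 : ContDiffOn ℝ (l : ℕ∞) g (Set.Icc 0 1) :=
      hf1.derivWithin hu (by push_cast; exact le_rfl)
    have hiter : ∀ z ∈ Set.Icc (0 : ℝ) 1, iteratedDerivWithin (l + 1) f (Set.Icc 0 1) z =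
        iteratedDerivWithin l g (Set.Icc 0 1) z := fun z _ => congrFun iteratedDerivWithin_succ' z
    obtain ⟨c, hc⟩ := ih g hg1 (fun a ha b hb => by
      rw [← hiter a ha, ← hiter b hb]; exact hf a ha b hb) x hx
    refine ⟨fun k => if k = 0 then g x else c (k - 1) / (k + 1), fun y hy => ?_⟩
    rw [Finset.sum_range_succ']
    simp only [Nat.add_eq_zero_iff, one_ne_zero, and_false, if_false, Nat.add_sub_cancel, if_true,
      zero_add, pow_one]
    set h : ℝ → ℝ := fun z => f z - f x -
      (∑ k ∈ Finset.range l, c k / ((k + 1 : ℕ) + 1) * (z - x) ^ (k + 1 + 1) + g x * (z - x)) with hh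
    have hseg : segment ℝ x y ⊆ Set.Icc (0 : ℝ) 1 := (convex_Icc 0 1).segment_subset hx hy
    have hder : ∀ z ∈ segment ℝ x y, HasDerivWithinAt h
        (g z - g x - ∑ k ∈ Finset.range l, c k * (z - x) ^ (k + 1)) (segment ℝ x y) z := by
      intro z hz
      have h1 : HasDerivWithinAt f (g z) (segment ℝ x y) z :=
        (hdiff z (hseg hz)).hasDerivWithinAt.mono hseg
      have h2 : HasDerivAt (fun z => ∑ k ∈ Finset.range l,
          c k / ((k + 1 : ℕ) + 1) * (z - x) ^ (k + 1 + 1) + g x * (z - x))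
          (∑ k ∈ Finset.range l, c k * (z - x) ^ (k + 1) + g x) z := by
        refine HasDerivAt.add (HasDerivAt.fun_sum fun k _ => ?_) ?_
        · have h3 := (((hasDerivAt_id z).sub_const x).pow (k + 1 + 1)).const_mul
            (c k / ((k + 1 : ℕ) + 1))
          simp only [id_eq, Nat.add_sub_cancel] at h3
          refine h3.congr_deriv ?_
          push_cast
          field_simp
        · simpa using ((hasDerivAt_id z).sub_const x).const_mul (g x)
      exact ((h1.sub_const (f x)).sub h2.hasDerivWithinAt).congr_deriv (by ring)
    have hbound : ∀ z ∈ segment ℝ x y,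
        ‖g z - g x - ∑ k ∈ Finset.range l, c k * (z - x) ^ (k + 1)‖ ≤
          L * |y - x| ^ ((l : ℝ) + γ) := by
      intro z hz
      refine (hc z (hseg hz)).trans ?_
      refine mul_le_mul_of_nonneg_left (Real.rpow_le_rpow (abs_nonneg _) ?_ (by positivity)) hL
      obtain ⟨a, b, ha, hb, hab, rfl⟩ := hz
      have : a • x + b • y - x = b * (y - x) := by
        simp only [smul_eq_mul]
        linear_combination x * hab
      rw [this, abs_mul, abs_of_nonneg hb]
      exact mul_le_of_le_one_left (abs_nonneg _) (by linarith)
    have key := (convex_segment x y).norm_image_sub_le_of_norm_hasDerivWithin_le hder hbound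
      (left_mem_segment ℝ x y) (right_mem_segment ℝ x y)
    have hx0 : h x = 0 := by simp [hh]
    rw [hx0, sub_zero, Real.norm_eq_abs, Real.norm_eq_abs, mul_assoc] at key
    refine key.trans (le_of_eq ?_)
    congr 1
    rcases eq_or_ne (y - x) 0 with h0 | h0
    · rw [h0, abs_zero, mul_zero, Real.zero_rpow (by positivity)]
    · rw [← Real.rpow_add_one (abs_ne_zero.2 h0)]
      congr 1
      push_cast
      ring

lemma holderOrder_lt {β : ℝ} (hβ : 0 < β) : 0 < β - (holderOrder β : ℝ) := by
  unfold holderOrder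
  have h1 : 0 < ⌈β⌉₊ := Nat.ceil_pos.2 hβ
  have h2 := Nat.ceil_lt_add_one hβ.le
  rw [Nat.cast_sub h1]
  push_cast
  linarith

/-- The error of averaging a Hölder function with a discrete kernel. -/
lemma abs_kernel_average_sub_le {β L Wmax : ℝ} (hβ : 0 < β) (hL : 0 ≤ L) {f : ℝ → ℝ}
    (hf : f ∈ HolderClass β L) {F : Finset ℤ} {w : ℤ → ℝ} {r T : ℕ} (hT : 0 < T) {t : ℤ}
    (ht : t ∈ Set.Icc (1 : ℤ) T) (hF : ∀ i ∈ F, t + i ∈ Set.Icc (1 : ℤ) T ∧ |i| ≤ r)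
    (hF0 : 0 < F.card)
    (hw : ∀ i ∈ F, |w i| ≤ Wmax)
    (hmom : ∀ k ≤ holderOrder β, (F.card : ℝ)⁻¹ * ∑ i ∈ F, (i : ℝ) ^ k * w i =
      if k = 0 then 1 else 0) :
    |(F.card : ℝ)⁻¹ * ∑ i ∈ F, w i * f (((t + i : ℤ) : ℝ) / T) - f ((t : ℝ) / T)| ≤
      Wmax * L * ((r : ℝ) / T) ^ β := by
  have hT' : (0 : ℝ) < T := by exact_mod_cast hT
  have hFc : (0 : ℝ) < F.card := by exact_mod_cast hF0
  have hmem : ∀ u : ℤ, u ∈ Set.Icc (1 : ℤ) T → (u : ℝ) / T ∈ Set.Icc (0 : ℝ) 1 := by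
    intro u hu
    have h1 : (1 : ℝ) ≤ u := by exact_mod_cast hu.1
    have h2 : (u : ℝ) ≤ T := by exact_mod_cast hu.2
    exact ⟨by positivity, by rwa [div_le_one hT']⟩
  obtain ⟨c, hc⟩ := exists_taylor_bound (holderOrder_lt hβ) hL (holderOrder β) f hf.1 hf.2 _
    (hmem t ht)
  set x := (t : ℝ) / T with hx
  set l := holderOrder β with hl
  have hy : ∀ i : ℤ, ((t + i : ℤ) : ℝ) / T - x = i / T := fun i => by
    rw [hx]; push_cast; ring
  -- The vanishing moments of orders 1 to `l` remove the whole Taylor polynomial; its index `k < l`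
  -- stands for the power `k + 1`.
  have hzero : ∑ i ∈ F, w i * ∑ k ∈ Finset.range l, c k * ((i : ℝ) / T) ^ (k + 1) = 0 := by
    simp only [Finset.mul_sum]
    rw [Finset.sum_comm]
    refine Finset.sum_eq_zero fun k hk => ?_
    have h1 := hmom (k + 1) (Finset.mem_range.1 hk)
    rw [if_neg (by omega)] at h1
    have h2 : ∑ i ∈ F, (i : ℝ) ^ (k + 1) * w i = 0 := by
      rcases mul_eq_zero.1 h1 with h | h
      · exact absurd h (inv_ne_zero hFc.ne')
      · exact h
    calc ∑ i ∈ F, w i * (c k * ((i : ℝ) / T) ^ (k + 1)) =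
        c k / T ^ (k + 1) * ∑ i ∈ F, (i : ℝ) ^ (k + 1) * w i := by
          rw [Finset.mul_sum]
          refine Finset.sum_congr rfl fun i _ => ?_
          rw [div_pow]; ring
      _ = 0 := by rw [h2, mul_zero]
  have hone : (F.card : ℝ)⁻¹ * ∑ i ∈ F, w i = 1 := by simpa using hmom 0 (Nat.zero_le _)
  have hrep : (F.card : ℝ)⁻¹ * ∑ i ∈ F, w i * f (((t + i : ℤ) : ℝ) / T) - f x =
      (F.card : ℝ)⁻¹ * ∑ i ∈ F, w i * (f (((t + i : ℤ) : ℝ) / T) - f x -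
        ∑ k ∈ Finset.range l, c k * ((i : ℝ) / T) ^ (k + 1)) := by
    simp only [mul_sub, Finset.sum_sub_distrib]
    rw [hzero, ← Finset.sum_mul, mul_zero, sub_zero, ← mul_assoc, hone, one_mul]
  rw [hrep, abs_mul, abs_of_pos (inv_pos.2 hFc), inv_mul_le_iff₀ hFc]
  refine (Finset.abs_sum_le_sum_abs _ _).trans ?_
  rw [← nsmul_eq_mul, ← Finset.sum_const]
  refine Finset.sum_le_sum fun i hi => ?_
  have h3 := hc _ (hmem _ (hF i hi).1)
  rw [hy] at h3
  rw [abs_mul, mul_assoc]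
  have hW0 : 0 ≤ Wmax := (abs_nonneg _).trans (hw i hi)
  refine mul_le_mul (hw i hi) (h3.trans ?_) (abs_nonneg _) hW0
  gcongr ?_ * ?_
  rw [show (l : ℝ) + (β - l) = β by ring, abs_div, abs_of_pos hT']
  gcongr
  have := (hF i hi).2
  have h4 : ((|i| : ℤ) : ℝ) ≤ ((r : ℤ) : ℝ) := by exact_mod_cast this
  simpa using h4

/-! Reduction of `smooth` to a single window -/

/-- For `2 * r ≤ T` the three time domains are disjoint and cover `1, …, T`, so exactly one term of
`smooth` is nonzero. Its window stays inside the time range and has enough points for the noise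
level at width `r`. -/
lemma exists_window (T r : ℕ) (hr : 2 * r ≤ T) {t : ℤ} (ht : t ∈ Set.Icc (1 : ℤ) T) :
    ∃ j : Fin 3, (∀ i ∈ window r j, t + i ∈ Set.Icc (1 : ℤ) T ∧ |i| ≤ r) ∧
      max r 1 ≤ (window r j).card ∧
      ∀ (W : Fin 3 → ℕ → ℤ → ℝ) (n : ℕ) (X : ℤ → Matrix (Fin n) (Fin n) ℝ),
        smooth W T r X t = ((window r j).card : ℝ)⁻¹ • ∑ i ∈ window r j, W j r i • X (t + i) := by
  obtain ⟨h1, h2⟩ := ht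
  rcases lt_or_ge (r : ℤ) t with ha | ha
  · rcases lt_or_ge ((T : ℤ) - r) t with hb | hb
    · refine ⟨2, ?_, ?_, ?_⟩
      · intro i hi
        simp only [window, Matrix.cons_val, Finset.mem_Icc] at hi
        rw [Set.mem_Icc, abs_le]
        omega
      · simp [window]; omega
      · intro W n X
        simp only [smooth, Fin.sum_univ_three, timeDomain, Matrix.cons_val_zero,
          Matrix.cons_val_one, Matrix.cons_val, Finset.mem_Icc]
        rw [if_neg (by omega), if_neg (by omega), if_pos (by omega), zero_add, zero_add]
    · refine ⟨0, ?_, ?_, ?_⟩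
      · intro i hi
        simp only [window, Matrix.cons_val_zero, Finset.mem_Icc] at hi
        rw [Set.mem_Icc, abs_le]
        omega
      · simp [window]; omega
      · intro W n X
        simp only [smooth, Fin.sum_univ_three, timeDomain, Matrix.cons_val_zero,
          Matrix.cons_val_one, Matrix.cons_val, Finset.mem_Icc]
        rw [if_pos (by omega), if_neg (by omega), if_neg (by omega), add_zero, add_zero]
  · refine ⟨1, ?_, ?_, ?_⟩
    · intro i hi
      simp only [window, Matrix.cons_val_one, Matrix.cons_val_zero, Finset.mem_Icc] at hi
      rw [Set.mem_Icc, abs_le]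
      omega
    · simp [window]
    · intro W n X
      simp only [smooth, Fin.sum_univ_three, timeDomain, Matrix.cons_val_zero,
        Matrix.cons_val_one, Matrix.cons_val, Finset.mem_Icc]
      rw [if_neg (by omega), if_pos (by omega), if_neg (by omega), zero_add, add_zero]

/-! Symmetric matrices -/

lemma exists_eigenbasis {m : ℕ} {M : Matrix (Fin m) (Fin m) ℝ} (hM : M.IsSymm) :
    ∃ (lam : Fin m → ℝ) (u : Fin m → Fin m → ℝ), (∀ k, lam k ∈ spectrum ℝ M) ∧
      (∀ k, M.mulVec (u k) = lam k • u k) ∧ (∀ k, u k ≠ 0) ∧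
      ∀ x : Fin m → ℝ, ∑ i, x i ^ 2 = ∑ k, (u k ⬝ᵥ x) ^ 2 ∧
        x ⬝ᵥ M.mulVec x = ∑ k, lam k * (u k ⬝ᵥ x) ^ 2 ∧
        ∑ i, (M.mulVec x) i ^ 2 = ∑ k, lam k ^ 2 * (u k ⬝ᵥ x) ^ 2 := by
  have hH : M.IsHermitian := by
    rw [Matrix.IsHermitian, Matrix.conjTranspose_eq_transpose_of_trivial]; exact hM
  set b := hH.eigenvectorBasis with hb
  have hinner : ∀ (x y : Fin m → ℝ), inner ℝ (WithLp.toLp 2 x : EuclideanSpace ℝ (Fin m))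
      (WithLp.toLp 2 y) = x ⬝ᵥ y := fun x y => by
    rw [EuclideanSpace.inner_eq_star_dotProduct]
    simp [dotProduct_comm]
  have hsum : ∀ x y : Fin m → ℝ, x ⬝ᵥ y =
      ∑ k, ((b k : Fin m → ℝ) ⬝ᵥ x) * ((b k : Fin m → ℝ) ⬝ᵥ y) := fun x y => by
    rw [← hinner x y, ← OrthonormalBasis.sum_inner_mul_inner b]
    refine Finset.sum_congr rfl fun k _ => ?_
    rw [real_inner_comm]
    congr 1
    · exact hinner (b k) x
    · exact hinner (b k) y
  have hmv : ∀ (k : Fin m) (x : Fin m → ℝ), (b k : Fin m → ℝ) ⬝ᵥ M.mulVec x =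
      hH.eigenvalues k * ((b k : Fin m → ℝ) ⬝ᵥ x) := fun k x => by
    rw [Matrix.dotProduct_mulVec, ← Matrix.mulVec_transpose, hM.eq, hb,
      hH.mulVec_eigenvectorBasis, smul_dotProduct, smul_eq_mul]
  have hsq : ∀ x : Fin m → ℝ, ∑ i, x i ^ 2 = x ⬝ᵥ x := fun x => by
    simp [dotProduct, sq]
  refine ⟨hH.eigenvalues, fun k => b k, fun k => hH.eigenvalues_mem_spectrum_real k,
    fun k => hH.mulVec_eigenvectorBasis k, fun k h0 => ?_, fun x => ⟨?_, ?_, ?_⟩⟩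
  · have h1 := b.orthonormal.1 k
    have h2 : b k = 0 := by
      ext i
      exact congrFun h0 i
    rw [h2] at h1
    simp at h1
  · rw [hsq, hsum]
    exact Finset.sum_congr rfl fun k _ => by ring
  · rw [hsum]
    exact Finset.sum_congr rfl fun k _ => by rw [hmv]; ring
  · rw [hsq, hsum]
    exact Finset.sum_congr rfl fun k _ => by rw [hmv]; ring

lemma quadraticForm_bounds {m : ℕ} {M : Matrix (Fin m) (Fin m) ℝ} (hM : M.IsSymm) {a Cl : ℝ}
    (ha : 0 < a) (hCl : 1 ≤ Cl) (h : ∀ x ∈ spectrum ℝ (a⁻¹ • M), Cl⁻¹ ≤ x ∧ x ≤ Cl)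
    (x : Fin m → ℝ) :
    a / Cl * ∑ i, x i ^ 2 ≤ x ⬝ᵥ M.mulVec x ∧ x ⬝ᵥ M.mulVec x ≤ a * Cl * ∑ i, x i ^ 2 ∧
      ∑ i, (M.mulVec x) i ^ 2 ≤ (a * Cl) ^ 2 * ∑ i, x i ^ 2 := by
  have hS : (a⁻¹ • M).IsSymm := by
    rw [Matrix.IsSymm, Matrix.transpose_smul, hM.eq]
  obtain ⟨lam, u, hlam, -, -, hq⟩ := exists_eigenbasis hS
  obtain ⟨h1, h2, h3⟩ := hq x
  have hMa : M.mulVec x = a • (a⁻¹ • M).mulVec x := by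
    rw [Matrix.smul_mulVec, smul_smul, mul_inv_cancel₀ ha.ne', one_smul]
  have hCl0 : 0 < Cl := by linarith
  rw [hMa, dotProduct_smul, smul_eq_mul, h1, h2]
  refine ⟨?_, ?_, ?_⟩
  · rw [div_eq_mul_inv, mul_assoc]
    refine mul_le_mul_of_nonneg_left ?_ ha.le
    rw [Finset.mul_sum]
    gcongr with k
    exact (h _ (hlam k)).1
  · rw [mul_assoc]
    refine mul_le_mul_of_nonneg_left ?_ ha.le
    rw [Finset.mul_sum]
    gcongr with k
    exact (h _ (hlam k)).2
  · simp only [Pi.smul_apply, smul_eq_mul, mul_pow]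
    rw [← Finset.mul_sum, h3, mul_assoc]
    refine mul_le_mul_of_nonneg_left ?_ (sq_nonneg a)
    rw [Finset.mul_sum]
    gcongr with k
    · exact (inv_pos.2 hCl0).le.trans (h _ (hlam k)).1
    · exact (h _ (hlam k)).2

/-- A row is the image of a unit vector, so its norm is at most the largest eigenvalue. There is no
factor `K` here, which is what produces the `1 / K` in `√(s α / K)`. -/
lemma sum_row_sq_le {m : ℕ} {M : Matrix (Fin m) (Fin m) ℝ} (hM : M.IsSymm) {a Cl : ℝ}
    (ha : 0 < a) (hCl : 1 ≤ Cl) (h : ∀ x ∈ spectrum ℝ (a⁻¹ • M), Cl⁻¹ ≤ x ∧ x ≤ Cl) (k : Fin m) :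
    ∑ l, M k l ^ 2 ≤ (a * Cl) ^ 2 := by
  have h3 := (quadraticForm_bounds hM ha hCl h (Pi.single k 1)).2.2
  have e : ∑ i, (Pi.single k (1 : ℝ) : Fin m → ℝ) i ^ 2 = 1 := by simp [Pi.single_apply]
  rw [e, mul_one] at h3
  refine le_trans (le_of_eq (Finset.sum_congr rfl fun l _ => ?_)) h3
  rw [Matrix.mulVec_single_one, Matrix.col_apply, hM.apply]

/-! Bias -/

lemma edgeProb_apply {n K : ℕ} (g : Fin n → Fin K) (B : Matrix (Fin K) (Fin K) ℝ) (i j : Fin n) :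
    edgeProb g B i j = B (g i) (g j) := by
  simp [edgeProb, clusterMatrix, Matrix.mul_apply]

lemma sum_label_eq {n K : ℕ} (g : Fin n → Fin K) (f : Fin K → ℝ) :
    ∑ i, f (g i) = ∑ k, (community g k).card * f k := by
  rw [← Finset.sum_fiberwise Finset.univ g]
  refine Finset.sum_congr rfl fun k _ => ?_
  rw [Finset.sum_congr rfl (g := fun _ => f k) fun i hi => by rw [(Finset.mem_filter.1 hi).2],
    Finset.sum_const, nsmul_eq_mul]
  rfl

lemma card_switch_le {n K s T : ℕ} {g : ℤ → Fin n → Fin K} (hg : AtMostSwitches s T g) (m : ℕ) :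
    ∀ u : ℤ, 1 ≤ u → u + m ≤ T →
      (Finset.univ.filter fun i => g u i ≠ g (u + m) i).card ≤ s * m := by
  classical
  induction m with
  | zero => intro u _ _; simp
  | succ m ih =>
    intro u h1 h2
    push_cast at h2
    have h3 := ih u h1 (by omega)
    have h4 := hg (u + m) (by omega) (by omega)
    have hsub : (Finset.univ.filter fun i => g u i ≠ g (u + (m + 1 : ℕ)) i) ⊆
        (Finset.univ.filter fun i => g u i ≠ g (u + m) i) ∪
          (Finset.univ.filter fun i => g (u + m) i ≠ g (u + m + 1) i) := by
      intro i hi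
      simp only [Finset.mem_filter, Finset.mem_univ, true_and, Finset.mem_union] at hi ⊢
      by_contra hcon
      push Not at hcon
      apply hi
      rw [hcon.1, hcon.2]
      push_cast
      rw [add_assoc]
    refine (Finset.card_le_card hsub).trans ((Finset.card_union_le _ _).trans ?_)
    rw [mul_add, mul_one]
    omega

lemma card_switch_le_abs {n K s T : ℕ} {g : ℤ → Fin n → Fin K} (hg : AtMostSwitches s T g)
    {t i : ℤ} {r : ℕ} (ht : t ∈ Set.Icc (1 : ℤ) T) (hti : t + i ∈ Set.Icc (1 : ℤ) T)
    (hi : |i| ≤ r) :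
    (Finset.univ.filter fun a => g (t + i) a ≠ g t a).card ≤ s * r := by
  rw [abs_le] at hi
  rcases le_total 0 i with h | h
  · obtain ⟨m, rfl⟩ := Int.eq_ofNat_of_zero_le h
    have := card_switch_le hg m t ht.1 hti.2
    simp only [ne_comm] at this ⊢
    exact this.trans (Nat.mul_le_mul_left _ (by omega))
  · obtain ⟨m, hm⟩ := Int.eq_ofNat_of_zero_le (show 0 ≤ -i by omega)
    have := card_switch_le hg m (t + i) hti.1 (by have := ht.2; omega)
    rw [show t + i + (m : ℤ) = t by omega] at this
    exact this.trans (Nat.mul_le_mul_left _ (by omega))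

lemma sum_sq_sub_le {n K : ℕ} (g g' : Fin n → Fin K) {B : Matrix (Fin K) (Fin K) ℝ} {R : ℝ}
    (h : Fin n → Fin K) (hR : ∀ k, ∑ b, B k (h b) ^ 2 ≤ R) :
    ∑ a, ∑ b, (B (g' a) (h b) - B (g a) (h b)) ^ 2 ≤
      (Finset.univ.filter fun a => g' a ≠ g a).card * (4 * R) := by
  classical
  rw [← nsmul_eq_mul, ← Finset.sum_const, Finset.sum_filter]
  refine Finset.sum_le_sum fun a _ => ?_
  split_ifs with ha
  · calc ∑ b, (B (g' a) (h b) - B (g a) (h b)) ^ 2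
        ≤ ∑ b, (2 * B (g' a) (h b) ^ 2 + 2 * B (g a) (h b) ^ 2) := by
          refine Finset.sum_le_sum fun b _ => ?_
          nlinarith [sq_nonneg (B (g' a) (h b) + B (g a) (h b))]
      _ ≤ 4 * R := by
          rw [Finset.sum_add_distrib, ← Finset.mul_sum, ← Finset.mul_sum]
          linarith [hR (g' a), hR (g a)]
  · push Not at ha
    simp [ha]

/-- The effect of changes of the communities on the matrix of edge probabilities. -/
lemma specNorm_edgeProb_sub_le {n K : ℕ} {g g' : Fin n → Fin K} {B : Matrix (Fin K) (Fin K) ℝ}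
    (hB : B.IsSymm) {R : ℝ} (hR : ∀ k, ∑ b, B k (g b) ^ 2 ≤ R)
    (hR' : ∀ k, ∑ b, B k (g' b) ^ 2 ≤ R) {N : ℝ}
    (hN : ((Finset.univ.filter fun a => g' a ≠ g a).card : ℝ) ≤ N) (hR0 : 0 ≤ R) :
    specNorm (edgeProb g' B - edgeProb g B) ≤ 4 * √(N * R) := by
  -- The labels are changed first in the rows, then in the columns. Each difference is supported on
  -- the rows, respectively columns, of the nodes that switched.
  set D₁ : Matrix (Fin n) (Fin n) ℝ := Matrix.of fun a b => B (g' a) (g' b) - B (g a) (g' b)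
  set D₂ : Matrix (Fin n) (Fin n) ℝ := Matrix.of fun a b => B (g a) (g' b) - B (g a) (g b)
  have e : edgeProb g' B - edgeProb g B = D₁ + D₂ := by
    ext a b
    simp [edgeProb_apply, D₁, D₂]
  have h1 : frobSq D₁ ≤ N * (4 * R) := (sum_sq_sub_le g g' g' hR').trans (by gcongr)
  have h2 : frobSq D₂ ≤ N * (4 * R) := by
    rw [frobSq, Finset.sum_comm]
    refine le_trans (le_of_eq ?_) ((sum_sq_sub_le g g' g hR).trans (by gcongr))
    refine Finset.sum_congr rfl fun b _ => Finset.sum_congr rfl fun a _ => ?_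
    simp only [D₂, Matrix.of_apply]
    rw [hB.apply (g' b) (g a), hB.apply (g b) (g a)]
  have hs : √(N * (4 * R)) = 2 * √(N * R) := by
    rw [show N * (4 * R) = 2 ^ 2 * (N * R) by ring, Real.sqrt_mul (by norm_num),
      Real.sqrt_sq (by norm_num)]
  rw [e]
  have h3 := (specNorm_le_sqrt_frobSq D₁).trans (Real.sqrt_le_sqrt h1)
  have h4 := (specNorm_le_sqrt_frobSq D₂).trans (Real.sqrt_le_sqrt h2)
  rw [hs] at h3 h4
  linarith [specNorm_add_le D₁ D₂]

lemma specNorm_le_of_abs_apply_le {n : ℕ} (M : Matrix (Fin n) (Fin n) ℝ) {b : ℝ} (hb : 0 ≤ b)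
    (h : ∀ i j, |M i j| ≤ b) : specNorm M ≤ n * b := by
  refine (specNorm_le_sqrt_frobSq M).trans ?_
  refine Real.sqrt_le_iff.2 ⟨by positivity, ?_⟩
  calc frobSq M ≤ ∑ _i : Fin n, ∑ _j : Fin n, b ^ 2 :=
        Finset.sum_le_sum fun i _ => Finset.sum_le_sum fun j _ =>
          sq_le_sq.2 ((h i j).trans (le_abs_self b))
    _ = (n * b) ^ 2 := by simp; ring

lemma specNorm_sum_le {n : ℕ} {ι : Type*} (s : Finset ι) (M : ι → Matrix (Fin n) (Fin n) ℝ) :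
    specNorm (∑ i ∈ s, M i) ≤ ∑ i ∈ s, specNorm (M i) := by
  simp only [specNorm, map_sum]
  exact norm_sum_le _ _

/-- `P (t + i) - P t` is split through the matrix with the communities of time `t` and the
connectivity of time `t + i`. The first difference involves at most `s * r` switched nodes and is
measured in Frobenius norm. The second is averaged entrywise by the kernel, using smoothness. -/
lemma specNorm_bias_le {n K T s : ℕ} {α β L Cl C₂ Wmax : ℝ} (hT : 0 < T) (hα : 0 < α)
    (hβ : 0 < β) (hL : 0 ≤ L) (hCl : 1 ≤ Cl) (hC₂ : 0 < C₂)
    {g : ℤ → Fin n → Fin K} {B : ℤ → Matrix (Fin K) (Fin K) ℝ} {W : Fin 3 → ℕ → ℤ → ℝ}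
    (hB : ∀ t ∈ Set.Icc (1 : ℤ) T, (B t).IsSymm)
    (hH : SmoothInTime β L T (fun t => α⁻¹ • B t)) (hg : AtMostSwitches s T g)
    (hspec : ∀ t ∈ Set.Icc (1 : ℤ) T, ∀ x ∈ spectrum ℝ (α⁻¹ • B t), Cl⁻¹ ≤ x ∧ x ≤ Cl)
    (hW : IsDiscreteKernel (holderOrder β) Wmax W)
    (hbal : ∀ t ∈ Set.Icc (1 : ℤ) T, ∀ k : Fin K,
      ((community (g t) k).card : ℝ) ≤ C₂ * ((n : ℝ) / K))
    {t : ℤ} (ht : t ∈ Set.Icc (1 : ℤ) T) {r : ℕ} (hr : 2 * r ≤ T) :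
    specNorm (smooth W T r (fun u => edgeProb (g u) (B u)) t - edgeProb (g t) (B t)) ≤
      Wmax * (4 * √(s * r * (C₂ * (n / K) * (α * Cl) ^ 2))) +
        n * (α * (Wmax * L * ((r : ℝ) / T) ^ β)) := by
  obtain ⟨j, hwin, hcard, hsm⟩ := exists_window T r hr ht
  set F := window r j with hF
  have hF0 : 0 < F.card := by omega
  have hFc : (0 : ℝ) < F.card := by exact_mod_cast hF0
  obtain ⟨hWb, hmom⟩ := hW j r
  obtain ⟨i0, hi0⟩ := Finset.card_pos.1 hF0
  have hW0 : 0 ≤ Wmax := (abs_nonneg _).trans (hWb i0 hi0)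
  have hrow : ∀ u ∈ Set.Icc (1 : ℤ) T, ∀ u' ∈ Set.Icc (1 : ℤ) T, ∀ k,
      ∑ b, B u k (g u' b) ^ 2 ≤ C₂ * (n / K) * (α * Cl) ^ 2 := by
    intro u hu u' hu' k
    rw [sum_label_eq (g u') fun l => B u k l ^ 2]
    calc _ ≤ ∑ l, C₂ * (n / K) * B u k l ^ 2 := by
          gcongr with l
          exact hbal u' hu' l
      _ ≤ _ := by
          rw [← Finset.mul_sum]
          gcongr
          exact sum_row_sq_le (hB u hu) hα hCl (hspec u hu) k
  have hsplit : smooth W T r (fun u => edgeProb (g u) (B u)) t - edgeProb (g t) (B t) =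
      ((F.card : ℝ)⁻¹ • ∑ i ∈ F, W j r i •
        (edgeProb (g (t + i)) (B (t + i)) - edgeProb (g t) (B (t + i)))) +
      ((F.card : ℝ)⁻¹ • ∑ i ∈ F, W j r i • edgeProb (g t) (B (t + i)) -
        edgeProb (g t) (B t)) := by
    rw [hsm]
    simp only [smul_sub, Finset.sum_sub_distrib]
    abel
  rw [hsplit]
  refine (specNorm_add_le _ _).trans (add_le_add ?_ ?_)
  · rw [specNorm_smul, abs_of_pos (inv_pos.2 hFc), inv_mul_le_iff₀ hFc]
    refine (specNorm_sum_le _ _).trans ?_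
    rw [← nsmul_eq_mul, ← Finset.sum_const]
    refine Finset.sum_le_sum fun i hi => ?_
    obtain ⟨h1, h2⟩ := hwin i hi
    rw [specNorm_smul]
    refine mul_le_mul (hWb i hi) ?_ (specNorm_nonneg _) hW0
    refine specNorm_edgeProb_sub_le (hB _ h1) (hrow _ h1 _ ht) (hrow _ h1 _ h1) ?_ (by positivity)
    exact_mod_cast card_switch_le_abs hg ht h1 h2
  · refine specNorm_le_of_abs_apply_le _ (by positivity) fun a b => ?_
    have hentry : ∀ k k' : Fin K, |(F.card : ℝ)⁻¹ * ∑ i ∈ F, W j r i * B (t + i) k k' - B t k k'| ≤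
        α * (Wmax * L * ((r : ℝ) / T) ^ β) := by
      have main : ∀ k k' : Fin K, k ≤ k' →
          |(F.card : ℝ)⁻¹ * ∑ i ∈ F, W j r i * B (t + i) k k' - B t k k'| ≤
          α * (Wmax * L * ((r : ℝ) / T) ^ β) := by
        intro k k' hk
        obtain ⟨f, hf, hft⟩ := hH k k' hk
        have hBf : ∀ u ∈ Set.Icc (1 : ℤ) T, B u k k' = α * f ((u : ℝ) / T) := fun u hu => by
          rw [← hft u hu]
          simp only [Matrix.smul_apply, smul_eq_mul]
          field_simp
        have hav := abs_kernel_average_sub_le hβ hL hf hT ht hwin hF0 hWb hmom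
        have e1 : (F.card : ℝ)⁻¹ * ∑ i ∈ F, W j r i * B (t + i) k k' - B t k k' =
            α * ((F.card : ℝ)⁻¹ * ∑ i ∈ F, W j r i * f (((t + i : ℤ) : ℝ) / T) -
              f ((t : ℝ) / T)) := by
          have e0 : ∑ i ∈ F, W j r i * B (t + i) k k' =
              α * ∑ i ∈ F, W j r i * f (((t + i : ℤ) : ℝ) / T) := by
            rw [Finset.mul_sum]
            refine Finset.sum_congr rfl fun i hi => ?_
            rw [hBf _ (hwin i hi).1]
            ring
          rw [hBf t ht, e0]
          ring
        rw [e1, abs_mul, abs_of_pos hα]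
        gcongr
      intro k k'
      rcases le_total k k' with h | h
      · exact main k k' h
      · have e2 : (F.card : ℝ)⁻¹ * ∑ i ∈ F, W j r i * B (t + i) k k' - B t k k' =
            (F.card : ℝ)⁻¹ * ∑ i ∈ F, W j r i * B (t + i) k' k - B t k' k := by
          rw [(hB t ht).apply k' k, Finset.sum_congr rfl fun i hi => by
            rw [(hB _ (hwin i hi).1).apply k' k]]
        rw [e2]
        exact main k' k h
    have := hentry (g t a) (g t b)
    simpa [edgeProb_apply, Matrix.sum_apply] using this

/-! Perturbation of the leading eigenvectors -/

lemma dotProduct_self_eq_sum_sq {n : ℕ} (x : Fin n → ℝ) : x ⬝ᵥ x = ∑ i, x i ^ 2 := by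
  simp [dotProduct, sq]

/-- On vectors orthogonal to all the leading eigenvectors except the `k₀`-th, the quadratic form is
bounded by the `k₀`-th eigenvalue. -/
lemma dotProduct_mulVec_le_of_leading {n K : ℕ} {M : Matrix (Fin n) (Fin n) ℝ} (hM : M.IsSymm)
    {U : Matrix (Fin n) (Fin K) ℝ} {lam : Fin K → ℝ} (hU : U.transpose * U = 1)
    (hMU : M * U = U * Matrix.diagonal lam)
    (hlead : ∀ (v : Fin n → ℝ) (x : ℝ), v ≠ 0 → M.mulVec v = x • v → U.transpose.mulVec v = 0 →
      ∀ k, x ≤ lam k) (k₀ : Fin K) (w : Fin n → ℝ)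
    (hw : ∀ k, k ≠ k₀ → (U.transpose.mulVec w) k = 0) :
    w ⬝ᵥ M.mulVec w ≤ lam k₀ * ∑ i, w i ^ 2 := by
  -- Deflation: in `N` all leading eigenvalues are replaced by `lam k₀`, while the form at `w` is
  -- unchanged. An eigenvector of `N` orthogonal to `U` is an eigenvector of `M`, to which `hlead`
  -- applies; any other one has eigenvalue `lam k₀`. Hence `N ≤ lam k₀`.
  set D : Matrix (Fin K) (Fin K) ℝ := Matrix.diagonal fun k => lam k - lam k₀ with hD
  set N := M - U * D * U.transpose with hN
  have hNs : N.IsSymm := by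
    rw [Matrix.IsSymm, hN, Matrix.transpose_sub, hM.eq, Matrix.transpose_mul, Matrix.transpose_mul,
      Matrix.transpose_transpose, hD, Matrix.diagonal_transpose, Matrix.mul_assoc]
  have hUM : U.transpose * M = Matrix.diagonal lam * U.transpose := by
    have := congrArg Matrix.transpose hMU
    rwa [Matrix.transpose_mul, Matrix.transpose_mul, hM.eq, Matrix.diagonal_transpose] at this
  have hUN : U.transpose * N = lam k₀ • U.transpose := by
    rw [hN, Matrix.mul_sub, hUM, ← Matrix.mul_assoc, ← Matrix.mul_assoc, hU, Matrix.one_mul,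
      ← Matrix.sub_mul, hD, Matrix.diagonal_sub]
    ext k i
    simp [Matrix.diagonal_mul]
  obtain ⟨ev, u, -, hev, hu0, hq⟩ := exists_eigenbasis hNs
  have hle : ∀ k, ev k ≤ lam k₀ := by
    intro k
    by_cases ha : U.transpose.mulVec (u k) = 0
    · refine hlead (u k) (ev k) (hu0 k) ?_ ha k₀
      rw [← hev k, hN, Matrix.sub_mulVec, ← Matrix.mulVec_mulVec, ha, Matrix.mulVec_zero, sub_zero]
    · have h1 : U.transpose.mulVec (N.mulVec (u k)) = lam k₀ • U.transpose.mulVec (u k) := by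
        rw [Matrix.mulVec_mulVec, hUN, Matrix.smul_mulVec]
      rw [hev k, Matrix.mulVec_smul] at h1
      have h2 : (ev k - lam k₀) • U.transpose.mulVec (u k) = 0 := by
        rw [sub_smul, h1, sub_self]
      rcases smul_eq_zero.1 h2 with h | h
      · linarith
      · exact absurd h ha
  have hwN : w ⬝ᵥ N.mulVec w = w ⬝ᵥ M.mulVec w := by
    have : (U * D * U.transpose).mulVec w = 0 := by
      rw [← Matrix.mulVec_mulVec, ← Matrix.mulVec_mulVec, hD]
      have : (Matrix.diagonal fun k => lam k - lam k₀).mulVec (U.transpose.mulVec w) = 0 := by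
        ext k
        rw [Matrix.mulVec_diagonal]
        by_cases hk : k = k₀
        · simp [hk]
        · simp [hw k hk]
      rw [this, Matrix.mulVec_zero]
    rw [hN, Matrix.sub_mulVec, this, sub_zero]
  obtain ⟨h1, h2, -⟩ := hq w
  rw [← hwN, h2, h1, Finset.mul_sum]
  gcongr with k
  exact hle k

/-- The mean of `v` over the community of each node. -/
noncomputable def blockMean {n K : ℕ} (g : Fin n → Fin K) (v : Fin n → ℝ) (k : Fin K) : ℝ :=
  ((community g k).card : ℝ)⁻¹ * ∑ i ∈ community g k, v i

lemma sum_mul_sub_blockMean {n K : ℕ} {g : Fin n → Fin K} (hg : ∀ k, 0 < (community g k).card)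
    (v : Fin n → ℝ) (φ : Fin K → ℝ) :
    ∑ i, φ (g i) * (v i - blockMean g v (g i)) = 0 := by
  rw [← Finset.sum_fiberwise Finset.univ g]
  refine Finset.sum_eq_zero fun k _ => ?_
  have h1 : ∀ i ∈ Finset.univ.filter (fun i => g i = k),
      φ (g i) * (v i - blockMean g v (g i)) = φ k * (v i - blockMean g v k) := by
    intro i hi
    rw [(Finset.mem_filter.1 hi).2]
  rw [Finset.sum_congr rfl h1, ← Finset.mul_sum, Finset.sum_sub_distrib, Finset.sum_const,
    nsmul_eq_mul]
  have h2 : ((community g k).card : ℝ) ≠ 0 := by exact_mod_cast (hg k).ne'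
  change φ k * (∑ i ∈ community g k, v i - ((community g k).card : ℝ) * blockMean g v k) = 0
  rw [blockMean, mul_inv_cancel_left₀ h2, sub_self, mul_zero]

lemma offDiag_edgeProb_mulVec {n K : ℕ} (g : Fin n → Fin K) (B : Matrix (Fin K) (Fin K) ℝ)
    (v : Fin n → ℝ) (i : Fin n) : (offDiag (edgeProb g B)).mulVec v i =
      ∑ j, B (g i) (g j) * v j - B (g i) (g i) * v i := by
  rw [offDiag, Matrix.sub_mulVec, Pi.sub_apply, Matrix.mulVec_diagonal, edgeProb_apply]
  simp [Matrix.mulVec, dotProduct, edgeProb_apply]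

/-- A `sin Θ` theorem for the stochastic block model without self-loops: the leading eigenvectors are
close to the vectors which are constant on the communities. -/
lemma sum_sq_sub_blockMean_le {n K : ℕ} {g : Fin n → Fin K} {B : Matrix (Fin K) (Fin K) ℝ}
    (hB : B.IsSymm) {α Cl m : ℝ} (hα : 0 < α) (hCl : 1 ≤ Cl)
    (hspec : ∀ x ∈ spectrum ℝ (α⁻¹ • B), Cl⁻¹ ≤ x ∧ x ≤ Cl)
    (hm : ∀ k, m ≤ (community g k).card) (hmCl : Cl ^ 2 ≤ m)
    {M : Matrix (Fin n) (Fin n) ℝ} (hM : M.IsSymm) {d Δ : ℝ}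
    (hE : specNorm (M - (d • (1 : Matrix (Fin n) (Fin n) ℝ) + offDiag (edgeProb g B))) ≤ Δ)
    {U : Matrix (Fin n) (Fin K) ℝ} (hU : IsLeadingEigenvectors M U) (k₀ : Fin K) :
    ∑ i, (U i k₀ - blockMean g (fun i => U i k₀) (g i)) ^ 2 ≤
      4 * Δ ^ 2 / (α * m / Cl ^ 3) ^ 2 := by
  obtain ⟨hUU, lam, -, hMU, hlead⟩ := hU
  have hCl0 : 0 < Cl := by linarith
  have hm0 : 0 < m := lt_of_lt_of_le (by positivity) hmCl
  have hg : ∀ k, 0 < (community g k).card := fun k => by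
    have := hm0.trans_le (hm k)
    exact_mod_cast this
  set Q := offDiag (edgeProb g B) with hQ
  set E := M - (d • (1 : Matrix (Fin n) (Fin n) ℝ) + Q) with hEdef
  have hΔ0 : 0 ≤ Δ := (specNorm_nonneg _).trans hE
  have hMdec : ∀ v : Fin n → ℝ, M.mulVec v = d • v + Q.mulVec v + E.mulVec v := fun v => by
    have h1 : M = d • (1 : Matrix (Fin n) (Fin n) ℝ) + Q + E := by rw [hEdef]; abel
    nth_rewrite 1 [h1]
    rw [Matrix.add_mulVec, Matrix.add_mulVec, Matrix.smul_mulVec, Matrix.one_mulVec]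
  have hBdiag : ∀ k, α / Cl ≤ B k k ∧ B k k ≤ α * Cl := fun k => by
    obtain ⟨h1, h2, -⟩ := quadraticForm_bounds hB hα hCl hspec (Pi.single k 1)
    have e : ∑ i, (Pi.single k (1 : ℝ) : Fin K → ℝ) i ^ 2 = 1 := by simp [Pi.single_apply]
    rw [e, mul_one] at h1 h2
    simpa using And.intro h1 h2
  -- a lower bound of the eigenvalue
  have hlam : d + m * (α / Cl) - α * Cl - Δ ≤ lam k₀ := by
    -- Courant–Fischer by counting dimensions: the coordinate `k₀` of `F` is zero, so `F` is not
    -- surjective, hence not injective. A nonzero `φ` in the kernel gives a vector constant on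
    -- communities and orthogonal to all columns of `U` but the `k₀`-th.
    let F : (Fin K → ℝ) →ₗ[ℝ] (Fin K → ℝ) :=
      { toFun := fun φ k => if k = k₀ then 0 else ∑ i, U i k * φ (g i)
        map_add' := fun φ ψ => by
          ext k
          simp only [Pi.add_apply]
          split_ifs
          · simp
          · rw [← Finset.sum_add_distrib]
            exact Finset.sum_congr rfl fun i _ => by ring
        map_smul' := fun c φ => by
          ext k
          simp only [Pi.smul_apply, smul_eq_mul, RingHom.id_apply]
          split_ifs
          · simp
          · rw [Finset.mul_sum]
            exact Finset.sum_congr rfl fun i _ => by ring }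
    have hnsurj : ¬ Function.Surjective F := fun h => by
      obtain ⟨φ, hφ⟩ := h (Pi.single k₀ 1)
      have := congrFun hφ k₀
      simp [F] at this
    have hninj : ¬ Function.Injective F := fun h =>
      hnsurj (LinearMap.injective_iff_surjective.1 h)
    rw [← LinearMap.ker_eq_bot, Submodule.eq_bot_iff] at hninj
    push Not at hninj
    obtain ⟨φ, hφ, hφ0⟩ := hninj
    rw [LinearMap.mem_ker] at hφ
    set w : Fin n → ℝ := fun i => φ (g i) with hw
    have hwU : ∀ k, k ≠ k₀ → (U.transpose.mulVec w) k = 0 := fun k hk => by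
      have := congrFun hφ k
      simp only [F, LinearMap.coe_mk, AddHom.coe_mk, if_neg hk, Pi.zero_apply] at this
      simpa [Matrix.mulVec, dotProduct] using this
    have hup := dotProduct_mulVec_le_of_leading hM hUU hMU hlead k₀ w hwU
    have hwsq : ∑ i, w i ^ 2 = ∑ k, (community g k).card * φ k ^ 2 :=
      sum_label_eq g fun k => φ k ^ 2
    have hwpos : 0 < ∑ i, w i ^ 2 := by
      rw [hwsq]
      obtain ⟨k, hk⟩ := Function.ne_iff.1 hφ0
      refine Finset.sum_pos' (fun k _ => by positivity) ⟨k, Finset.mem_univ k, ?_⟩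
      have h1 : (0 : ℝ) < (community g k).card := by exact_mod_cast hg k
      have h2 : φ k ≠ 0 := hk
      positivity
    set y : Fin K → ℝ := fun k => (community g k).card * φ k with hy
    have hquad : w ⬝ᵥ Q.mulVec w = y ⬝ᵥ B.mulVec y - ∑ i, B (g i) (g i) * w i ^ 2 := by
      have h1 : ∀ i, w i * (Q.mulVec w) i = φ (g i) * (B.mulVec y) (g i) -
          B (g i) (g i) * w i ^ 2 := fun i => by
        rw [hQ, offDiag_edgeProb_mulVec]
        have : ∑ j, B (g i) (g j) * w j = (B.mulVec y) (g i) := by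
          rw [hw, sum_label_eq g fun k => B (g i) k * φ k]
          simp only [Matrix.mulVec, dotProduct, hy]
          exact Finset.sum_congr rfl fun k _ => by ring
        rw [this]
        simp only [hw]
        ring
      rw [dotProduct, Finset.sum_congr rfl fun i _ => h1 i, Finset.sum_sub_distrib,
        sum_label_eq g fun k => φ k * (B.mulVec y) k]
      congr 1
      simp only [dotProduct, hy]
      exact Finset.sum_congr rfl fun k _ => by ring
    have hlow1 : m * (α / Cl) * ∑ i, w i ^ 2 ≤ y ⬝ᵥ B.mulVec y := by
      refine le_trans ?_ (quadraticForm_bounds hB hα hCl hspec y).1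
      rw [mul_comm m, mul_assoc]
      gcongr
      rw [hwsq, Finset.mul_sum]
      refine Finset.sum_le_sum fun k _ => ?_
      have h1 := mul_le_mul_of_nonneg_right (hm k)
        (show 0 ≤ (community g k).card * φ k ^ 2 by positivity)
      refine h1.trans (le_of_eq ?_)
      simp only [hy]
      ring
    have hlow2 : ∑ i, B (g i) (g i) * w i ^ 2 ≤ α * Cl * ∑ i, w i ^ 2 := by
      rw [Finset.mul_sum]
      gcongr with i
      exact (hBdiag _).2
    have hlow3 : -(Δ * ∑ i, w i ^ 2) ≤ w ⬝ᵥ E.mulVec w := by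
      have h1 := abs_dotProduct_mulVec_le E w w
      rw [Real.mul_self_sqrt hwpos.le] at h1
      have h2 := mul_le_mul_of_nonneg_right hE hwpos.le
      linarith [(abs_le.1 h1).1]
    rw [hMdec, dotProduct_add, dotProduct_add, dotProduct_smul, dotProduct_self_eq_sum_sq,
      smul_eq_mul, hquad] at hup
    have hfin : (d + m * (α / Cl) - α * Cl - Δ) * ∑ i, w i ^ 2 ≤ lam k₀ * ∑ i, w i ^ 2 := by
      linarith
    exact le_of_mul_le_mul_right hfin hwpos
  -- the component orthogonal to the communities
  set u : Fin n → ℝ := fun i => U i k₀ with hu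
  set h : Fin n → ℝ := fun i => blockMean g u (g i) with hh
  set z : Fin n → ℝ := fun i => u i - h i with hz
  have horth : ∀ φ : Fin K → ℝ, ∑ i, φ (g i) * z i = 0 := sum_mul_sub_blockMean hg u
  have hunit : ∑ i, u i ^ 2 = 1 := by
    have h1 := congrFun (congrFun hUU k₀) k₀
    simp only [Matrix.mul_apply, Matrix.transpose_apply, Matrix.one_apply_eq] at h1
    rw [← h1]
    exact Finset.sum_congr rfl fun i _ => by simp only [hu]; ring
  have hMu : M.mulVec u = lam k₀ • u := by
    ext i
    have h1 := congrFun (congrFun hMU i) k₀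
    rw [Matrix.mul_diagonal, Matrix.mul_apply] at h1
    simp only [Matrix.mulVec, dotProduct, Pi.smul_apply, smul_eq_mul, hu]
    rw [h1, mul_comm]
  have hzu : z ⬝ᵥ u = ∑ i, z i ^ 2 := by
    have h1 := horth (blockMean g u)
    have h2 : z ⬝ᵥ u = ∑ i, z i ^ 2 + ∑ i, blockMean g u (g i) * z i := by
      rw [dotProduct, ← Finset.sum_add_distrib]
      exact Finset.sum_congr rfl fun i _ => by simp only [hz, hh]; ring
    rw [h2, h1, add_zero]
  -- Against `z`, everything constant on communities vanishes; only the removed diagonal acts, with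
  -- a favourable sign.
  have hzQ : z ⬝ᵥ Q.mulVec u = -∑ i, B (g i) (g i) * z i ^ 2 := by
    have h1 := horth fun k => ∑ j, B k (g j) * u j
    have h2 := horth fun k => B k k * blockMean g u k
    have h3 : z ⬝ᵥ Q.mulVec u = ∑ i, (∑ j, B (g i) (g j) * u j) * z i -
        ∑ i, B (g i) (g i) * blockMean g u (g i) * z i - ∑ i, B (g i) (g i) * z i ^ 2 := by
      rw [dotProduct, ← Finset.sum_sub_distrib, ← Finset.sum_sub_distrib]
      refine Finset.sum_congr rfl fun i _ => ?_
      rw [hQ, offDiag_edgeProb_mulVec]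
      simp only [hz, hh]
      ring
    rw [h3, h1, h2]
    ring
  set a := √(∑ i, z i ^ 2) with ha
  have hasq : ∑ i, z i ^ 2 = a ^ 2 :=
    (Real.sq_sqrt (Finset.sum_nonneg fun _ _ => sq_nonneg _)).symm
  have ha0 : 0 ≤ a := Real.sqrt_nonneg _
  have ha1 : a ≤ 1 := by
    have h1 : ∑ i, u i ^ 2 = ∑ i, z i ^ 2 + ∑ i, h i ^ 2 := by
      have h2 := horth (blockMean g u)
      have h3 : ∑ i, u i ^ 2 = ∑ i, z i ^ 2 + ∑ i, h i ^ 2 + 2 * ∑ i, blockMean g u (g i) * z i := by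
        rw [Finset.mul_sum, ← Finset.sum_add_distrib, ← Finset.sum_add_distrib]
        exact Finset.sum_congr rfl fun i _ => by simp only [hz, hh]; ring
      rw [h3, h2, mul_zero, add_zero]
    have h2 : 0 ≤ ∑ i, h i ^ 2 := Finset.sum_nonneg fun _ _ => sq_nonneg _
    exact Real.sqrt_le_one.2 (by linarith)
  have hmain : (lam k₀ - d + α / Cl) * a ^ 2 ≤ Δ * a := by
    have h1 : z ⬝ᵥ M.mulVec u = lam k₀ * a ^ 2 := by
      rw [hMu, dotProduct_smul, hzu, smul_eq_mul, hasq]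
    rw [hMdec, dotProduct_add, dotProduct_add, dotProduct_smul, hzu, hzQ, hasq, smul_eq_mul] at h1
    have h2 : α / Cl * a ^ 2 ≤ ∑ i, B (g i) (g i) * z i ^ 2 := by
      rw [← hasq, Finset.mul_sum]
      gcongr with i
      exact (hBdiag _).1
    have h3 := abs_dotProduct_mulVec_le E z u
    rw [hunit, Real.sqrt_one, mul_one, ← ha] at h3
    have h4 := mul_le_mul_of_nonneg_right hE ha0
    linarith [(abs_le.1 h3).2]
  set γ := α * m / Cl ^ 3 with hγ
  have hγ0 : 0 < γ := by positivity
  have hgap : γ - Δ ≤ lam k₀ - d + α / Cl := by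
    -- Removing the diagonal costs `α Cl` in the lower bound of the eigenvalue and returns `α / Cl`
    -- on `z`. The factorisation below shows that `Cl ^ 2 ≤ m` is what keeps the gap at least `α m /
    -- Cl ^ 3`.
    have h1 : γ ≤ m * (α / Cl) - α * Cl + α / Cl := by
      have h2 : m * (α / Cl) - α * Cl + α / Cl - γ =
          α / Cl ^ 3 * ((m - Cl ^ 2) * (Cl ^ 2 - 1)) := by
        rw [hγ]
        field_simp
        ring
      have h3 : 0 ≤ α / Cl ^ 3 * ((m - Cl ^ 2) * (Cl ^ 2 - 1)) :=
        mul_nonneg (by positivity) (mul_nonneg (by linarith) (by nlinarith))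
      linarith
    linarith
  -- If `Δ` exceeds half the gap, the bound is trivial because `a ≤ 1`.
  have hbound : γ * a ≤ 2 * Δ := by
    rcases le_or_gt (2 * Δ) γ with h1 | h1
    · rcases eq_or_lt_of_le ha0 with h2 | h2
      · rw [← h2]; linarith
      · have h3 : (γ - Δ) * a ≤ Δ := by
          have h4 : (γ - Δ) * a * a ≤ Δ * a := by
            calc (γ - Δ) * a * a = (γ - Δ) * a ^ 2 := by ring
              _ ≤ (lam k₀ - d + α / Cl) * a ^ 2 := by gcongr
              _ ≤ Δ * a := hmain
          exact le_of_mul_le_mul_right h4 h2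
        nlinarith
    · nlinarith
  change ∑ i, z i ^ 2 ≤ _
  rw [hasq, le_div_iff₀ (by positivity), show 4 * Δ ^ 2 = (2 * Δ) ^ 2 by ring, ← mul_pow, mul_comm a]
  gcongr

/-! Approximate `K`-means -/

/-- The rows of the centers of the communities are well separated. -/
lemma inv_card_add_le_sum_sq_sub {n K : ℕ} {g : Fin n → Fin K}
    (hg : ∀ k, 0 < (community g k).card) {U : Matrix (Fin n) (Fin K) ℝ} (hU : U.transpose * U = 1)
    {δ : ℝ} (hδ : ∑ i, ∑ c, (U i c - blockMean g (fun i => U i c) (g i)) ^ 2 ≤ δ)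
    {k l : Fin K} (hkl : k ≠ l) :
    (1 - δ) * (((community g k).card : ℝ)⁻¹ + ((community g l).card : ℝ)⁻¹) ≤
      ∑ c, (blockMean g (fun i => U i c) k - blockMean g (fun i => U i c) l) ^ 2 := by
  set N : Fin K → ℝ := fun k => (community g k).card with hN
  have hN0 : ∀ k, 0 < N k := fun k => by simp only [hN]; exact_mod_cast hg k
  -- `V` has the normalised indicators of the communities as orthonormal columns and `Y = Vᵀ U`. The
  -- residuals `U - V Y` and `V - U Yᵀ` have Gram matrices `1 - Yᵀ Y` and `1 - Y Yᵀ`, of equal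
  -- trace. So closeness of `U` to the span of `V` transfers to closeness of `V` to the span of `U`.
  set V : Matrix (Fin n) (Fin K) ℝ := Matrix.of fun i k => if g i = k then (√(N k))⁻¹ else 0 with hV
  have hVV : V.transpose * V = 1 := by
    ext a b
    simp only [Matrix.mul_apply, Matrix.transpose_apply, hV, Matrix.of_apply, Matrix.one_apply]
    rcases eq_or_ne a b with rfl | hab
    · have h1 : ∀ i, (if g i = a then (√(N a))⁻¹ else 0) * (if g i = a then (√(N a))⁻¹ else 0) =
          if g i = a then (N a)⁻¹ else 0 := fun i => by
        split_ifs
        · rw [← mul_inv, Real.mul_self_sqrt (hN0 a).le]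
        · simp
      rw [if_pos rfl, Finset.sum_congr rfl fun i _ => h1 i, ← Finset.sum_filter, Finset.sum_const,
        nsmul_eq_mul]
      exact mul_inv_cancel₀ (hN0 a).ne'
    · rw [if_neg hab]
      refine Finset.sum_eq_zero fun i _ => ?_
      split_ifs with h1 h2
      · exact absurd (h1.symm.trans h2) hab
      all_goals simp
  set Y := V.transpose * U with hY
  have hYmean : ∀ a c, Y a c = √(N a) * blockMean g (fun i => U i c) a := by
    intro a c
    simp only [hY, Matrix.mul_apply, Matrix.transpose_apply, hV, Matrix.of_apply, ite_mul, zero_mul]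
    rw [← Finset.sum_filter, ← Finset.mul_sum, blockMean, ← mul_assoc]
    congr 1
    change _ = √(N a) * (N a)⁻¹
    nth_rewrite 3 [← Real.mul_self_sqrt (hN0 a).le]
    have := (Real.sqrt_pos.2 (hN0 a)).ne'
    field_simp
  have frob_eq : ∀ {p : ℕ} (X : Matrix (Fin p) (Fin K) ℝ),
      ∑ i, ∑ c, X i c ^ 2 = (X.transpose * X).trace := fun X => by
    rw [Finset.sum_comm]
    simp [Matrix.trace, Matrix.mul_apply, sq]
  set D := U - V * Y with hDdef
  set R := V - U * Y.transpose with hRdef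
  have hDD : D.transpose * D = 1 - Y.transpose * Y := by
    have h1 : U.transpose * (V * Y) = Y.transpose * Y := by
      rw [← Matrix.mul_assoc, hY, Matrix.transpose_mul, Matrix.transpose_transpose]
    have h2 : (V * Y).transpose * U = Y.transpose * Y := by
      rw [Matrix.transpose_mul, Matrix.mul_assoc, ← hY]
    have h3 : (V * Y).transpose * (V * Y) = Y.transpose * Y := by
      rw [Matrix.transpose_mul, Matrix.mul_assoc, ← Matrix.mul_assoc V.transpose, hVV, Matrix.one_mul]
    rw [hDdef, Matrix.transpose_sub, Matrix.sub_mul, Matrix.mul_sub, Matrix.mul_sub, hU, h1, h2, h3]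
    abel
  have hRR : R.transpose * R = 1 - Y * Y.transpose := by
    have h0 : U.transpose * V = Y.transpose := by
      rw [hY, Matrix.transpose_mul, Matrix.transpose_transpose]
    have h1 : V.transpose * (U * Y.transpose) = Y * Y.transpose := by
      rw [← Matrix.mul_assoc, ← hY]
    have h2 : (U * Y.transpose).transpose * V = Y * Y.transpose := by
      rw [Matrix.transpose_mul, Matrix.transpose_transpose, Matrix.mul_assoc, h0]
    have h3 : (U * Y.transpose).transpose * (U * Y.transpose) = Y * Y.transpose := by
      rw [Matrix.transpose_mul, Matrix.transpose_transpose, Matrix.mul_assoc,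
        ← Matrix.mul_assoc U.transpose, hU, Matrix.one_mul]
    rw [hRdef, Matrix.transpose_sub, Matrix.sub_mul, Matrix.mul_sub, Matrix.mul_sub, hVV, h1, h2, h3]
    abel
  have hR : ∑ i, ∑ c, R i c ^ 2 ≤ δ := by
    have h1 : ∑ i, ∑ c, R i c ^ 2 = ∑ i, ∑ c, D i c ^ 2 := by
      rw [frob_eq, frob_eq, hDD, hRR, Matrix.trace_sub, Matrix.trace_sub, Matrix.trace_mul_comm Y]
    rw [h1]
    refine le_trans (le_of_eq ?_) hδ
    refine Finset.sum_congr rfl fun i _ => Finset.sum_congr rfl fun c _ => ?_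
    congr 1
    rw [hDdef, Matrix.sub_apply]
    congr 1
    simp only [Matrix.mul_apply, hV, Matrix.of_apply, ite_mul, zero_mul]
    rw [Finset.sum_ite_eq, if_pos (Finset.mem_univ _), hYmean,
      inv_mul_cancel_left₀ (Real.sqrt_pos.2 (hN0 _)).ne']
  -- Chosen so that `Yᵀ b` is the difference of the two centers; then `|b|² - |Yᵀ b|² = |R b|² ≤ δ
  -- |b|²` is the claim.
  set b : Fin K → ℝ := Pi.single k (√(N k))⁻¹ - Pi.single l (√(N l))⁻¹ with hb
  have hbsq : ∑ a, b a ^ 2 = (N k)⁻¹ + (N l)⁻¹ := by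
    have h1 : ∀ a, b a ^ 2 = (if a = k then (N k)⁻¹ else 0) + (if a = l then (N l)⁻¹ else 0) := by
      intro a
      simp only [hb, Pi.sub_apply, Pi.single_apply]
      by_cases ha : a = k
      · subst ha
        rw [if_pos rfl, if_pos rfl, if_neg hkl, if_neg hkl, sub_zero, inv_pow,
          Real.sq_sqrt (hN0 _).le, add_zero]
      · by_cases ha' : a = l
        · subst ha'
          rw [if_neg ha, if_neg ha, if_pos rfl, if_pos rfl, zero_sub, neg_sq, inv_pow,
            Real.sq_sqrt (hN0 _).le, zero_add]
        · simp [ha, ha']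
    simp only [h1, Finset.sum_add_distrib]
    simp
  have hYb : ∀ c, (Y.transpose.mulVec b) c =
      blockMean g (fun i => U i c) k - blockMean g (fun i => U i c) l := by
    intro c
    have h1 : ∀ a, (√(N a))⁻¹ * √(N a) = 1 := fun a =>
      inv_mul_cancel₀ (Real.sqrt_pos.2 (hN0 _)).ne'
    rw [hb, Matrix.mulVec_sub, Pi.sub_apply, Matrix.mulVec_single, Matrix.mulVec_single]
    simp only [Pi.smul_apply, Matrix.col_apply, Matrix.transpose_apply, hYmean,
      MulOpposite.smul_eq_mul_unop, MulOpposite.unop_op]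
    linear_combination blockMean g (fun i => U i c) k * h1 k - blockMean g (fun i => U i c) l * h1 l
  have hRb : ∑ i, (R.mulVec b) i ^ 2 ≤ δ * ∑ a, b a ^ 2 := by
    refine le_trans ?_ (mul_le_mul_of_nonneg_right hR (Finset.sum_nonneg fun _ _ => sq_nonneg _))
    rw [Finset.sum_mul]
    refine Finset.sum_le_sum fun i _ => ?_
    exact Finset.sum_mul_sq_le_sq_mul_sq Finset.univ (R i) b
  have hid : ∑ i, (R.mulVec b) i ^ 2 = ∑ a, b a ^ 2 - ∑ c, (Y.transpose.mulVec b) c ^ 2 := by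
    rw [← dotProduct_self_eq_sum_sq, ← dotProduct_self_eq_sum_sq, ← dotProduct_self_eq_sum_sq,
      Matrix.dotProduct_mulVec, ← Matrix.mulVec_transpose, Matrix.mulVec_mulVec, hRR,
      Matrix.sub_mulVec, Matrix.one_mulVec, sub_dotProduct, ← Matrix.mulVec_mulVec]
    congr 1
    rw [Matrix.dotProduct_mulVec (Y.transpose.mulVec b), Matrix.vecMul_transpose]
  simp only [hYb] at hid
  rw [hid, hbsq] at hRb
  simp only [hN] at hRb ⊢
  linarith

lemma errorMatrix_apply {n K : ℕ} (ghat g : Fin n → Fin K) (σ : Equiv.Perm (Fin K)) (i : Fin n)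
    (k : Fin K) : errorMatrix ghat g σ i k =
      (if σ (ghat i) = k then 1 else 0) - (if g i = k then 1 else 0) := by
  simp only [errorMatrix, clusterMatrix, Matrix.sub_apply, Matrix.mul_apply, Matrix.of_apply, ite_mul,
    one_mul, zero_mul]
  rw [Finset.sum_ite_eq, if_pos (Finset.mem_univ _)]
  simp [Equiv.Perm.permMatrix, PEquiv.toMatrix_apply]

/-- A misplaced node has two nonzero entries in its row, at its true and at its estimated label; a
correctly placed one has none. -/
lemma nnzOn_errorMatrix_le {n K : ℕ} (ghat g : Fin n → Fin K) (σ : Equiv.Perm (Fin K))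
    (G S : Finset (Fin n)) (hS : ∀ i, i ∉ S → σ (ghat i) = g i) :
    nnzOn G (errorMatrix ghat g σ) ≤ 2 * (S.filter (· ∈ G)).card := by
  classical
  unfold nnzOn
  have hsub : ((G ×ˢ (Finset.univ : Finset (Fin K))).filter
      fun p => errorMatrix ghat g σ p.1 p.2 ≠ 0) ⊆
      ((S.filter (· ∈ G)).image fun i => (i, g i)) ∪
        ((S.filter (· ∈ G)).image fun i => (i, σ (ghat i))) := by
    rintro ⟨i, k⟩ hp
    simp only [Finset.mem_filter, Finset.mem_product, Finset.mem_univ, and_true,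
      errorMatrix_apply] at hp
    obtain ⟨hG, hne⟩ := hp
    have hiS : i ∈ S := by
      by_contra hi
      rw [hS i hi, sub_self] at hne
      exact hne rfl
    simp only [Finset.mem_union, Finset.mem_image, Finset.mem_filter, Prod.mk.injEq]
    by_cases h1 : g i = k
    · exact Or.inl ⟨i, ⟨hiS, hG⟩, rfl, h1⟩
    · by_cases h2 : σ (ghat i) = k
      · exact Or.inr ⟨i, ⟨hiS, hG⟩, rfl, h2⟩
      · rw [if_neg h1, if_neg h2, sub_zero] at hne
        exact absurd rfl hne
  refine (Finset.card_le_card hsub).trans ((Finset.card_union_le _ _).trans ?_)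
  have h1 := Finset.card_image_le (s := S.filter (· ∈ G)) (f := fun i => (i, g i))
  have h2 := Finset.card_image_le (s := S.filter (· ∈ G)) (f := fun i => (i, σ (ghat i)))
  omega

lemma communityError_le {n K : ℕ} (hK : 0 < K) (ghat g : Fin n → Fin K) (σ : Equiv.Perm (Fin K))
    {x : ℝ} (h : ∀ k, ((community g k).card : ℝ)⁻¹ *
      (nnzOn (community g k) (errorMatrix ghat g σ) : ℝ) ≤ x) : communityError ghat g ≤ x := by
  have : Nonempty (Fin K) := ⟨⟨0, hK⟩⟩
  exact (ciInf_le (Set.finite_range _).bddBelow σ).trans (ciSup_le h)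

lemma communityError_le_two {n K : ℕ} (hK : 0 < K) (ghat g : Fin n → Fin K) :
    communityError ghat g ≤ 2 := by
  refine communityError_le hK ghat g 1 fun k => ?_
  have h1 := nnzOn_errorMatrix_le ghat g 1 (community g k) Finset.univ
    fun i hi => absurd (Finset.mem_univ i) hi
  rw [Finset.filter_mem_eq_inter, Finset.univ_inter] at h1
  rcases Nat.eq_zero_or_pos (community g k).card with h0 | h0
  · rw [h0]; simp
  · have h2 : (0 : ℝ) < (community g k).card := by exact_mod_cast h0
    rw [inv_mul_le_iff₀ h2]
    rw [mul_comm]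
    exact_mod_cast h1

/-- Misclustered nodes of an approximate solution of the `K`-means problem. -/
lemma exists_perm_of_isApproxKMeans {n K : ℕ} {g : Fin n → Fin K}
    (hg : ∀ k, 0 < (community g k).card) {U : Matrix (Fin n) (Fin K) ℝ} (hU : U.transpose * U = 1)
    {δ ε : ℝ} (hε : 0 ≤ ε)
    (hδ : ∑ i, ∑ c, (U i c - blockMean g (fun i => U i c) (g i)) ^ 2 ≤ δ)
    (hsmall : 8 * (2 + ε) * δ < 1) {ghat : Fin n → Fin K} (hK : IsApproxKMeans ε U ghat) :
    ∃ (σ : Equiv.Perm (Fin K)) (S : Finset (Fin n)), (∀ i, i ∉ S → σ (ghat i) = g i) ∧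
      ∑ i ∈ S, ((community g (g i)).card : ℝ)⁻¹ ≤ 8 * (2 + ε) * δ := by
  classical
  obtain ⟨X, hX⟩ := hK
  set N : Fin K → ℝ := fun k => (community g k).card with hN
  have hN0 : ∀ k, 0 < N k := fun k => by simp only [hN]; exact_mod_cast hg k
  set C : Matrix (Fin K) (Fin K) ℝ := Matrix.of fun k c => blockMean g (fun i => U i c) k with hC
  have happ : ∀ (f : Fin n → Fin K) (Z : Matrix (Fin K) (Fin K) ℝ) i c,
      (clusterMatrix f * Z) i c = Z (f i) c := fun f Z i c => by
    simp [clusterMatrix, Matrix.mul_apply]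
  have hδ0 : 0 ≤ δ :=
    (Finset.sum_nonneg fun _ _ => Finset.sum_nonneg fun _ _ => sq_nonneg _).trans hδ
  have h1 : frobSq (clusterMatrix g * C - U) ≤ δ := by
    refine le_trans (le_of_eq ?_) hδ
    refine Finset.sum_congr rfl fun i _ => Finset.sum_congr rfl fun c _ => ?_
    rw [Matrix.sub_apply, happ, hC, Matrix.of_apply]
    ring
  have h2 : frobSq (clusterMatrix ghat * X - U) ≤ (1 + ε) * δ :=
    (hX g C).trans (by gcongr)
  set e : Fin n → ℝ := fun i => ∑ c, (X (ghat i) c - C (g i) c) ^ 2 with he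
  have h3 : ∑ i, e i ≤ 2 * (2 + ε) * δ := by
    have h4 : ∑ i, e i ≤ 2 * frobSq (clusterMatrix ghat * X - U) +
        2 * frobSq (clusterMatrix g * C - U) := by
      simp only [frobSq, Finset.mul_sum, ← Finset.sum_add_distrib, he]
      refine Finset.sum_le_sum fun i _ => Finset.sum_le_sum fun c _ => ?_
      simp only [Matrix.sub_apply, happ]
      nlinarith [sq_nonneg ((X (ghat i) c - U i c) + (C (g i) c - U i c))]
    linarith
  -- A node is bad if its fitted center is at squared distance at least a quarter of the inverse
  -- size of its community from the true center. Markov's inequality bounds the weighted count of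
  -- bad nodes, and the weights turn it directly into relative errors.
  set S : Finset (Fin n) := Finset.univ.filter fun i => (N (g i))⁻¹ / 4 ≤ e i with hS
  have hSsum : ∑ i ∈ S, (N (g i))⁻¹ ≤ 8 * (2 + ε) * δ := by
    have h4 : ∑ i ∈ S, (N (g i))⁻¹ / 4 ≤ ∑ i, e i :=
      (Finset.sum_le_sum fun i hi => (Finset.mem_filter.1 hi).2).trans
        (Finset.sum_le_sum_of_subset_of_nonneg (Finset.subset_univ _)
          fun i _ _ => Finset.sum_nonneg fun _ _ => sq_nonneg _)
    rw [← Finset.sum_div] at h4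
    linarith
  -- A community consisting of bad nodes only would have total weight 1, contrary to `hsmall`.
  have hrep : ∀ k, ∃ i, g i = k ∧ i ∉ S := by
    intro k
    by_contra! hcon
    have h4 : ∑ i ∈ community g k, (N (g i))⁻¹ ≤ ∑ i ∈ S, (N (g i))⁻¹ :=
      Finset.sum_le_sum_of_subset_of_nonneg
        (fun i hi => hcon i (Finset.mem_filter.1 hi).2)
        fun i _ _ => (inv_pos.2 (hN0 _)).le
    have h5 : ∑ i ∈ community g k, (N (g i))⁻¹ = 1 := by
      rw [Finset.sum_congr rfl (g := fun _ => (N k)⁻¹) fun i hi => by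
        rw [(Finset.mem_filter.1 hi).2], Finset.sum_const, nsmul_eq_mul]
      exact mul_inv_cancel₀ (hN0 k).ne'
    linarith
  -- Good nodes with a common fitted center have true centers at squared distance below half the sum
  -- of the inverse sizes. Centers of distinct communities are at least `1 - δ ≥ 1 / 2` times that
  -- sum apart.
  have hsep : ∀ i j, i ∉ S → j ∉ S → ghat i = ghat j → g i = g j := by
    intro i j hi hj hij
    by_contra hne
    have hi' : e i < (N (g i))⁻¹ / 4 := by simpa [hS] using hi
    have hj' : e j < (N (g j))⁻¹ / 4 := by simpa [hS] using hj
    have h4 := inv_card_add_le_sum_sq_sub hg hU hδ hne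
    have h5 : ∑ c, (blockMean g (fun i => U i c) (g i) - blockMean g (fun i => U i c) (g j)) ^ 2 ≤
        2 * e i + 2 * e j := by
      simp only [he, Finset.mul_sum, ← Finset.sum_add_distrib]
      refine Finset.sum_le_sum fun c _ => ?_
      rw [← hij]
      simp only [hC, Matrix.of_apply]
      nlinarith [sq_nonneg ((X (ghat i) c - blockMean g (fun i => U i c) (g i)) +
        (X (ghat i) c - blockMean g (fun i => U i c) (g j)))]
    have h6 : 1 / 2 ≤ 1 - δ := by nlinarith
    have h7 : 0 < (N (g i))⁻¹ + (N (g j))⁻¹ := add_pos (inv_pos.2 (hN0 _)) (inv_pos.2 (hN0 _))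
    have h8 := mul_le_mul_of_nonneg_right h6 h7.le
    simp only [hN] at h8 hi' hj'
    linarith
  -- One good node per community defines an injection from communities to estimated labels, hence
  -- the permutation.
  choose ι hι using hrep
  have hinj : Function.Injective fun k => ghat (ι k) := fun k l hkl => by
    have := hsep _ _ (hι k).2 (hι l).2 hkl
    rwa [(hι k).1, (hι l).1] at this
  set τ : Equiv.Perm (Fin K) := Equiv.ofBijective _ (Finite.injective_iff_bijective.1 hinj) with hτ
  refine ⟨τ.symm, S, fun i hi => ?_, hSsum⟩
  obtain ⟨l, hl⟩ := τ.surjective (ghat i)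
  have h4 : ghat (ι l) = ghat i := hl
  have h5 := hsep _ _ (hι l).2 hi h4
  rw [(hι l).1] at h5
  rw [← hl, Equiv.symm_apply_apply, h5]

lemma communityError_le_of_isApproxKMeans {n K : ℕ} (hK0 : 0 < K) {g : Fin n → Fin K}
    (hg : ∀ k, 0 < (community g k).card) {U : Matrix (Fin n) (Fin K) ℝ} (hU : U.transpose * U = 1)
    {δ ε : ℝ} (hε : 0 ≤ ε)
    (hδ : ∑ i, ∑ c, (U i c - blockMean g (fun i => U i c) (g i)) ^ 2 ≤ δ)
    {ghat : Fin n → Fin K} (hK : IsApproxKMeans ε U ghat) :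
    communityError ghat g ≤ 16 * (2 + ε) * δ := by
  -- If `8 (2 + ε) δ ≥ 1`, the asserted bound is at least the trivial bound 2.
  rcases lt_or_ge (8 * (2 + ε) * δ) 1 with hsmall | hbig
  swap
  · exact (communityError_le_two hK0 ghat g).trans (by linarith)
  obtain ⟨σ, S, hσ, hS⟩ := exists_perm_of_isApproxKMeans hg hU hε hδ hsmall hK
  refine communityError_le hK0 ghat g σ fun k => ?_
  have h1 : (nnzOn (community g k) (errorMatrix ghat g σ) : ℝ) ≤
      2 * ((S.filter (· ∈ community g k)).card : ℝ) := by
    exact_mod_cast nnzOn_errorMatrix_le ghat g σ (community g k) S hσ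
  have h2 : ((community g k).card : ℝ)⁻¹ * ((S.filter (· ∈ community g k)).card : ℝ) ≤
      ∑ i ∈ S, ((community g (g i)).card : ℝ)⁻¹ := by
    refine le_trans (le_of_eq ?_) (Finset.sum_le_sum_of_subset_of_nonneg
      (Finset.filter_subset (· ∈ community g k) S) fun i _ _ => by positivity)
    rw [Finset.sum_congr rfl (g := fun _ => ((community g k).card : ℝ)⁻¹), Finset.sum_const,
      nsmul_eq_mul, mul_comm]
    intro i hi
    rw [(Finset.mem_filter.1 (Finset.mem_filter.1 hi).2).2]
  have h3 := mul_le_mul_of_nonneg_left h1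
    (show 0 ≤ ((community g k).card : ℝ)⁻¹ by positivity)
  linarith

lemma overallError_le {n K : ℕ} (ghat g : Fin n → Fin K) (σ : Equiv.Perm (Fin K)) :
    overallError ghat g ≤ (n : ℝ)⁻¹ * (nnzOn Finset.univ (errorMatrix ghat g σ) : ℝ) := by
  unfold overallError
  gcongr
  exact ciInf_le (Set.finite_range _).bddBelow σ

lemma overallError_le_of_isApproxKMeans {n K : ℕ} {g : Fin n → Fin K}
    (hg : ∀ k, 0 < (community g k).card) {U : Matrix (Fin n) (Fin K) ℝ} (hU : U.transpose * U = 1)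
    {δ ε : ℝ} (hε : 0 ≤ ε)
    (hδ : ∑ i, ∑ c, (U i c - blockMean g (fun i => U i c) (g i)) ^ 2 ≤ δ)
    (hsmall : 8 * (2 + ε) * δ < 1)
    {ghat : Fin n → Fin K} (hK : IsApproxKMeans ε U ghat) :
    overallError ghat g ≤ 16 * (2 + ε) * δ * ((maxSize g : ℝ) / n) := by
  obtain ⟨σ, S, hσ, hS⟩ := exists_perm_of_isApproxKMeans hg hU hε hδ hsmall hK
  refine (overallError_le ghat g σ).trans ?_
  have h1 := nnzOn_errorMatrix_le ghat g σ Finset.univ S hσ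
  simp only [Finset.mem_univ, Finset.filter_true] at h1
  have h1' : (nnzOn Finset.univ (errorMatrix ghat g σ) : ℝ) ≤ 2 * S.card := by exact_mod_cast h1
  have h2 : (S.card : ℝ) ≤ maxSize g * ∑ i ∈ S, ((community g (g i)).card : ℝ)⁻¹ := by
    rw [Finset.mul_sum, Finset.cast_card]
    refine Finset.sum_le_sum fun i _ => ?_
    have h3 : (0 : ℝ) < (community g (g i)).card := by exact_mod_cast hg _
    rw [← div_eq_mul_inv, le_div_iff₀ h3, one_mul]
    exact_mod_cast Finset.le_sup (f := fun k => (community g k).card) (Finset.mem_univ (g i))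
  have h4 : (maxSize g : ℝ) * ∑ i ∈ S, ((community g (g i)).card : ℝ)⁻¹ ≤
      maxSize g * (8 * (2 + ε) * δ) := by gcongr
  have h5 : (nnzOn Finset.univ (errorMatrix ghat g σ) : ℝ) ≤ 2 * (maxSize g * (8 * (2 + ε) * δ)) := by
    linarith
  calc _ ≤ (n : ℝ)⁻¹ * (2 * (maxSize g * (8 * (2 + ε) * δ))) := by gcongr
    _ = _ := by ring

/-- A bad node has weight at least `1 / n`, so a total weight below `1 / n` leaves no bad node. -/
lemma errors_le_zero_of_isApproxKMeans {n K : ℕ} (hn : 0 < n) (hK0 : 0 < K) {g : Fin n → Fin K}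
    (hg : ∀ k, 0 < (community g k).card) {U : Matrix (Fin n) (Fin K) ℝ} (hU : U.transpose * U = 1)
    {δ ε : ℝ} (hε : 0 ≤ ε)
    (hδ : ∑ i, ∑ c, (U i c - blockMean g (fun i => U i c) (g i)) ^ 2 ≤ δ)
    (hsmall : 8 * (2 + ε) * δ < (n : ℝ)⁻¹)
    {ghat : Fin n → Fin K} (hK : IsApproxKMeans ε U ghat) :
    communityError ghat g ≤ 0 ∧ overallError ghat g ≤ 0 := by
  have hn1 : (1 : ℝ) ≤ n := by exact_mod_cast hn
  obtain ⟨σ, S, hσ, hS⟩ := exists_perm_of_isApproxKMeans hg hU hε hδ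
    (hsmall.trans_le (inv_le_one_of_one_le₀ hn1)) hK
  have hS0 : S = ∅ := by
    by_contra hne
    obtain ⟨i, hi⟩ := Finset.nonempty_iff_ne_empty.2 hne
    have h1 : ((community g (g i)).card : ℝ)⁻¹ ≤ ∑ i ∈ S, ((community g (g i)).card : ℝ)⁻¹ :=
      Finset.single_le_sum (f := fun i => ((community g (g i)).card : ℝ)⁻¹)
        (fun _ _ => by positivity) hi
    have h3 : (0 : ℝ) < (community g (g i)).card := by exact_mod_cast hg _
    have h2 : (n : ℝ)⁻¹ ≤ ((community g (g i)).card : ℝ)⁻¹ := by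
      apply inv_anti₀ h3
      have : (community g (g i)).card ≤ n := by simpa using Finset.card_le_univ (community g (g i))
      exact_mod_cast this
    linarith
  have hnnz : ∀ G : Finset (Fin n), nnzOn G (errorMatrix ghat g σ) = 0 := fun G => by
    have := nnzOn_errorMatrix_le ghat g σ G S hσ
    rw [hS0] at this
    simpa using this
  refine ⟨communityError_le hK0 ghat g σ fun k => ?_, (overallError_le ghat g σ).trans ?_⟩
  · rw [hnnz]; simp
  · rw [hnnz]; simp

/-! The stochastic error of the kernel estimators -/

lemma abs_le_maxEntry {m k : ℕ} (M : Matrix (Fin m) (Fin k) ℝ) (i : Fin m) (j : Fin k) :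
    |M i j| ≤ maxEntry M :=
  le_ciSup (f := fun p : Fin m × Fin k => |M p.1 p.2|) (Set.finite_range _).bddAbove (i, j)

lemma offDiag_smul {n : ℕ} (c : ℝ) (M : Matrix (Fin n) (Fin n) ℝ) :
    offDiag (c • M) = c • offDiag M := by
  ext i j
  simp [offDiag_apply]

/-- The concentration theorem is applied with `q = Cα * α` and with `κ + 1 = C₀ / a`, so that its
bound is the noise level with constant `C₀`. The failure exponent is then linear in `C₀`, which a
union bound over widths will use. -/
theorem exists_noise_tail {c₀ Cα Wmax : ℝ} (hc₀ : 0 < c₀) (hCα : 1 ≤ Cα) (hW0 : 0 < Wmax) :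
    ∃ a C : ℝ, 0 < a ∧ 0 < C ∧ ∀ {Ω : Type*} [MeasurableSpace Ω] {μ : Measure Ω}
      [IsProbabilityMeasure μ] {n K T l : ℕ} {d α : ℝ} {g : ℤ → Fin n → Fin K}
      {B : ℤ → Matrix (Fin K) (Fin K) ℝ} {A : ℤ → Ω → Matrix (Fin n) (Fin n) ℝ}
      {W : Fin 3 → ℕ → ℤ → ℝ},
      IsDynamicNetwork μ T d (fun t => edgeProb (g t) (B t)) A → 2 ≤ n → 0 < α →
      Cα⁻¹ * c₀ * Real.log n / n ≤ α →
      (∀ t ∈ Set.Icc (1 : ℤ) T, (B t).IsSymm ∧ ∀ k k', 0 ≤ B t k k' ∧ B t k k' ≤ 1) →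
      (∀ t ∈ Set.Icc (1 : ℤ) T, maxEntry (B t) ≤ Cα * α) → IsDiscreteKernel l Wmax W →
      ∀ {t : ℤ}, t ∈ Set.Icc (1 : ℤ) T → ∀ {ρ : ℕ}, 2 * ρ ≤ T → ∀ {C₀ : ℝ}, a ≤ C₀ →
      μ {ω | ¬ specNorm (offDiag (smooth W T ρ (fun u => A u ω - edgeProb (g u) (B u)) t)) ≤
        noiseLevel C₀ n α ρ} ≤ ENNReal.ofReal (C * (n : ℝ) ^ (-(C₀ / a - 1))) := by
  obtain ⟨C₁, C₂, hC₁, hC₂, hconc⟩ := exists_specNorm_noise_concentration hc₀ hW0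
  have hCα0 : 0 < Cα := by linarith
  have hsC : 0 < √Cα := Real.sqrt_pos.2 hCα0
  refine ⟨C₁ * √Cα, C₂, by positivity, hC₂, ?_⟩
  intro Ω _ μ _ n K T l d α g B A W hA hn hα hsparse hB hmax hW t ht ρ hρ C₀ hC₀
  have hn' : (0 : ℝ) < n := by exact_mod_cast (show 0 < n by omega)
  obtain ⟨j, hwin, hcard, hsm⟩ := exists_window T ρ hρ ht
  set F := window ρ j with hF
  have hF0 : 0 < F.card := by omega
  have hFc : (1 : ℝ) ≤ F.card := by exact_mod_cast hF0
  set S := F.map (addLeftEmbedding t) with hSdef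
  have hS : ∀ u ∈ S, u ∈ Set.Icc (1 : ℤ) T := by
    intro u hu
    obtain ⟨i, hi, rfl⟩ := Finset.mem_map.1 hu
    exact (hwin i hi).1
  have hSc : S.card = F.card := Finset.card_map _
  have hentry : ∀ u ∈ S, ∀ i j, 0 ≤ edgeProb (g u) (B u) i j ∧
      edgeProb (g u) (B u) i j ≤ Cα * α := fun u hu i j => by
    rw [edgeProb_apply]
    exact ⟨((hB u (hS u hu)).2 _ _).1,
      (le_abs_self _).trans ((abs_le_maxEntry _ _ _).trans (hmax u (hS u hu)))⟩
  have hq : c₀ * Real.log n ≤ n * (Cα * α * S.card) := by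
    rw [hSc]
    have h1 : c₀ * Real.log n ≤ n * (Cα * α) := by
      rw [div_le_iff₀ hn', mul_assoc, inv_mul_le_iff₀ hCα0] at hsparse
      linarith
    have h2 : 0 ≤ n * (Cα * α) := by positivity
    nlinarith
  have ha0 : 0 < C₁ * √Cα := by positivity
  have key := hconc hA hn hS (fun u hu i j => (hentry u hu i j).1)
    (fun u hu i j => (hentry u hu i j).2) (by positivity)
    (fun u hu i j => by
      rw [edgeProb_apply, edgeProb_apply, (hB u (hS u hu)).1.apply])
    (w := fun u => W j ρ (u - t))
    (fun u hu => by
      obtain ⟨i, hi, rfl⟩ := Finset.mem_map.1 hu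
      simp only [addLeftEmbedding_apply, add_sub_cancel_left]
      exact (hW j ρ).1 i hi)
    hq (κ := C₀ / (C₁ * √Cα) - 1) (by rw [sub_nonneg, le_div_iff₀ ha0]; linarith)
  refine le_trans (measure_mono fun ω hω => ?_) key
  rw [Set.mem_ofPred_eq] at hω ⊢
  refine fun hle => hω ?_
  rw [hsm, offDiag_smul, specNorm_smul, abs_of_pos (by positivity),
    inv_mul_le_iff₀ (by linarith)]
  rw [hSdef, Finset.sum_map] at hle
  simp only [addLeftEmbedding_apply, add_sub_cancel_left] at hle
  refine hle.trans ?_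
  rw [← hSdef, hSc, sub_add_cancel, noiseLevel]
  have e1 : C₁ * (C₀ / (C₁ * √Cα)) * √(n * (Cα * α * F.card)) = C₀ * √(n * α * F.card) := by
    rw [show n * (Cα * α * F.card) = Cα * (n * α * F.card) by ring, Real.sqrt_mul hCα0.le]
    field_simp
  have hC0 : 0 ≤ C₀ := ha0.le.trans hC₀
  rw [e1, mul_left_comm]
  gcongr
  have e2 : √(n * α * F.card) = F.card * √(n * α / F.card) := by
    rw [show n * α * F.card = (F.card : ℝ) ^ 2 * (n * α / F.card) by field_simp,
      Real.sqrt_mul (by positivity), Real.sqrt_sq (by linarith)]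
  rw [e2]
  gcongr

/-- The zeroth moment of the kernel equals 1, so the averaged diagonal is `d` without error; off the
diagonal the error is noise plus bias. -/
lemma smooth_adjacency_sub_eq {Ω : Type*} [MeasurableSpace Ω] {μ : Measure Ω} {n T l : ℕ}
    {d Wmax : ℝ}
    {P : ℤ → Matrix (Fin n) (Fin n) ℝ} {A : ℤ → Ω → Matrix (Fin n) (Fin n) ℝ}
    {W : Fin 3 → ℕ → ℤ → ℝ} (hA : IsDynamicNetwork μ T d P A) (hW : IsDiscreteKernel l Wmax W)
    {t : ℤ} (ht : t ∈ Set.Icc (1 : ℤ) T) {ρ : ℕ} (hρ : 2 * ρ ≤ T) (ω : Ω) :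
    smooth W T ρ (fun u => A u ω) t - (d • (1 : Matrix (Fin n) (Fin n) ℝ) + offDiag (P t)) =
      offDiag (smooth W T ρ (fun u => A u ω - P u) t) + offDiag (smooth W T ρ P t - P t) := by
  obtain ⟨j, hwin, -, hsm⟩ := exists_window T ρ hρ ht
  have hone : ((window ρ j).card : ℝ)⁻¹ * ∑ i ∈ window ρ j, W j ρ i = 1 := by
    simpa using (hW j ρ).2 0 (Nat.zero_le _)
  rw [hsm, hsm, hsm]
  ext a b
  simp only [Matrix.sub_apply, Matrix.add_apply, offDiag_apply, Matrix.smul_apply, smul_eq_mul,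
    Matrix.sum_apply, Matrix.one_apply]
  by_cases h : a = b
  · subst h
    rw [if_pos rfl, if_pos rfl, if_pos rfl, if_pos rfl,
      Finset.sum_congr rfl fun i hi => by rw [hA.diag _ (hwin i hi).1], ← Finset.sum_mul,
      ← mul_assoc, hone]
    ring
  · rw [if_neg h, if_neg h, if_neg h, if_neg h]
    simp only [mul_sub, Finset.sum_sub_distrib]
    ring

lemma smooth_adjacency_isSymm {Ω : Type*} [MeasurableSpace Ω] {μ : Measure Ω} {n T : ℕ} {d : ℝ}
    {P : ℤ → Matrix (Fin n) (Fin n) ℝ} {A : ℤ → Ω → Matrix (Fin n) (Fin n) ℝ}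
    (W : Fin 3 → ℕ → ℤ → ℝ) (hA : IsDynamicNetwork μ T d P A)
    {t : ℤ} (ht : t ∈ Set.Icc (1 : ℤ) T) {ρ : ℕ} (hρ : 2 * ρ ≤ T) (ω : Ω) :
    (smooth W T ρ (fun u => A u ω) t).IsSymm := by
  obtain ⟨j, hwin, -, hsm⟩ := exists_window T ρ hρ ht
  rw [hsm]
  ext a b
  simp only [Matrix.transpose_apply, Matrix.smul_apply, smul_eq_mul, Matrix.sum_apply]
  congr 1
  exact Finset.sum_congr rfl fun i hi => by rw [hA.symm _ (hwin i hi).1]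

lemma noiseLevel_antitone {C₀ : ℝ} (hC₀ : 0 ≤ C₀) (n : ℕ) {α : ℝ} (hα : 0 ≤ α) {ρ r : ℕ}
    (h : ρ ≤ r) : noiseLevel C₀ n α r ≤ noiseLevel C₀ n α ρ := by
  unfold noiseLevel
  gcongr

/-- The error of the estimator with the adaptive window width. -/
lemma specNorm_lepski_le {Ω : Type*} [MeasurableSpace Ω] {μ : Measure Ω} {n T l : ℕ}
    {d Wmax C₀ α : ℝ} (hC₀ : 0 ≤ C₀) (hα : 0 ≤ α)
    {P : ℤ → Matrix (Fin n) (Fin n) ℝ} {A : ℤ → Ω → Matrix (Fin n) (Fin n) ℝ}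
    {W : Fin 3 → ℕ → ℤ → ℝ} (hA : IsDynamicNetwork μ T d P A) (hW : IsDiscreteKernel l Wmax W)
    {t : ℤ} (ht : t ∈ Set.Icc (1 : ℤ) T) {ω : Ω} {r₀ r : ℕ} (hr₀ : 2 * r₀ ≤ T)
    (hbias : ∀ ρ ≤ r₀, specNorm (smooth W T ρ P t - P t) ≤ noiseLevel C₀ n α r₀ / 2)
    (hnoise : ∀ ρ ≤ r₀, specNorm (offDiag (smooth W T ρ (fun u => A u ω - P u) t)) ≤
      noiseLevel C₀ n α ρ)
    (hr : IsLepskiWidth C₀ α W T (fun u => A u ω) t r) :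
    2 * r ≤ T ∧ specNorm (smooth W T r (fun u => A u ω) t -
      (d • (1 : Matrix (Fin n) (Fin n) ℝ) + offDiag (P t))) ≤ 6 * noiseLevel C₀ n α r₀ := by
  set Q := d • (1 : Matrix (Fin n) (Fin n) ℝ) + offDiag (P t) with hQ
  have herr : ∀ ρ ≤ r₀, specNorm (smooth W T ρ (fun u => A u ω) t - Q) ≤
      noiseLevel C₀ n α ρ + noiseLevel C₀ n α r₀ := by
    intro ρ hρ
    rw [hQ, smooth_adjacency_sub_eq hA hW ht (by omega)]
    refine (specNorm_add_le _ _).trans (add_le_add (hnoise ρ hρ) ?_)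
    refine (specNorm_offDiag_le _).trans ?_
    linarith [hbias ρ hρ]
  -- The width `r₀` is admissible: against `ρ < r₀` the two errors add up to one noise level at `ρ`
  -- and three at `r₀`, at most four at `ρ`. Maximality gives `r₀ ≤ r`, and the error at `r` is at
  -- most `4 + 2 = 6` noise levels at `r₀`.
  have hmem : r₀ ≤ r := by
    refine hr.2 ⟨hr₀, fun ρ hρ => ?_⟩
    have h1 : smooth W T r₀ (fun u => A u ω) t - smooth W T ρ (fun u => A u ω) t =
        (smooth W T r₀ (fun u => A u ω) t - Q) - (smooth W T ρ (fun u => A u ω) t - Q) := by abel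
    rw [h1]
    have h2 := herr r₀ le_rfl
    have h3 := herr ρ hρ.le
    have h4 := noiseLevel_antitone hC₀ n hα hρ.le
    linarith [specNorm_sub_le (smooth W T r₀ (fun u => A u ω) t - Q)
      (smooth W T ρ (fun u => A u ω) t - Q)]
  refine ⟨hr.1.1, ?_⟩
  have h5 : specNorm (smooth W T r (fun u => A u ω) t - smooth W T r₀ (fun u => A u ω) t) ≤
      4 * noiseLevel C₀ n α r₀ := by
    rcases hmem.lt_or_eq with h | h
    · exact hr.1.2 r₀ h
    · rw [← h, sub_self, specNorm_zero]
      unfold noiseLevel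
      positivity
  have h6 : smooth W T r (fun u => A u ω) t - Q =
      (smooth W T r (fun u => A u ω) t - smooth W T r₀ (fun u => A u ω) t) +
        (smooth W T r₀ (fun u => A u ω) t - Q) := by abel
  rw [h6]
  linarith [specNorm_add_le (smooth W T r (fun u => A u ω) t - smooth W T r₀ (fun u => A u ω) t)
    (smooth W T r₀ (fun u => A u ω) t - Q), herr r₀ le_rfl]

/-- The error of the estimator with the oracle window width. -/
lemma specNorm_oracle_le {Ω : Type*} [MeasurableSpace Ω] {μ : Measure Ω} {n T l : ℕ}
    {d Wmax C₀ α : ℝ} (hC₀ : 0 ≤ C₀)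
    {P : ℤ → Matrix (Fin n) (Fin n) ℝ} {A : ℤ → Ω → Matrix (Fin n) (Fin n) ℝ}
    {W : Fin 3 → ℕ → ℤ → ℝ} (hA : IsDynamicNetwork μ T d P A) (hW : IsDiscreteKernel l Wmax W)
    {t : ℤ} (ht : t ∈ Set.Icc (1 : ℤ) T) {ω : Ω} {r₀ r : ℕ} (hr₀ : 2 * r₀ ≤ T)
    (hbias : specNorm (smooth W T r₀ P t - P t) ≤ noiseLevel C₀ n α r₀ / 2)
    (hnoise : specNorm (offDiag (smooth W T r (fun u => A u ω - P u) t)) ≤ noiseLevel C₀ n α r)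
    (hr : IsOracleWidth C₀ α W T P t r) :
    specNorm (smooth W T r (fun u => A u ω) t -
      (d • (1 : Matrix (Fin n) (Fin n) ℝ) + offDiag (P t))) ≤ 6 * noiseLevel C₀ n α r₀ := by
  rw [smooth_adjacency_sub_eq hA hW ht hr.1]
  -- The error is at most twice the criterion minimised by `r`, and the criterion at `r₀` is at most
  -- 3/2 noise levels. The constant 6 is kept to match the adaptive case.
  have h1 := hr.2 r₀ hr₀
  have h2 := specNorm_add_le (offDiag (smooth W T r (fun u => A u ω - P u) t))
    (offDiag (smooth W T r P t - P t))
  have h3 := specNorm_offDiag_le (smooth W T r P t - P t)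
  have h4 := specNorm_nonneg (smooth W T r P t - P t)
  have h5 : 0 ≤ noiseLevel C₀ n α r := by unfold noiseLevel; positivity
  have h6 : 0 ≤ noiseLevel C₀ n α r₀ := by unfold noiseLevel; positivity
  linarith

/-! Choice of the window width -/

lemma min_one_le_rpow {x p : ℝ} (hx : 0 < x) (hp0 : 0 ≤ p) (hp1 : p ≤ 1) : min 1 x ≤ x ^ p := by
  rcases le_total 1 x with h | h
  · exact (min_le_left _ _).trans (Real.one_le_rpow h hp0)
  · refine (min_le_right _ _).trans ?_
    calc x = x ^ (1 : ℝ) := (Real.rpow_one x).symm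
      _ ≤ x ^ p := Real.rpow_le_rpow_of_exponent_ge hx h hp1

lemma temporalRate_pos {n K T s : ℕ} {α β : ℝ} (hn : 0 < n) (hT : 0 < T) (hα : 0 < α) :
    0 < temporalRate n K T s α β := by
  unfold temporalRate
  positivity

/-- The bound of the bias is dominated by the noise level for small window widths. -/
lemma bias_bound_le_noiseLevel {n K T s r : ℕ} {α β L Cl C₂ Wmax C₀ c : ℝ} (hn : 0 < n)
    (hK : 0 < K) (hT : 0 < T) (hα : 0 < α) (hβ : 0 < β) (hL : 0 ≤ L) (hCl : 1 ≤ Cl)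
    (hW0 : 0 < Wmax) (hC₀ : 0 < C₀) (hc0 : 0 < c) (hc1 : c ≤ 1)
    (hc2 : 16 * Wmax * Cl * √C₂ * c ≤ C₀) (hc3 : 4 * Wmax * L * √c ≤ C₀)
    (hC₂ : 0 < C₂) (hr : r * temporalRate n K T s α β ≤ c) :
    Wmax * (4 * √(s * r * (C₂ * (n / K) * (α * Cl) ^ 2))) +
        n * (α * (Wmax * L * ((r : ℝ) / T) ^ β)) ≤ noiseLevel C₀ n α r / 2 := by
  have hn' : (0 : ℝ) < n := by exact_mod_cast hn
  have hK' : (0 : ℝ) < K := by exact_mod_cast hK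
  have hT' : (0 : ℝ) < T := by exact_mod_cast hT
  unfold noiseLevel
  rcases Nat.eq_zero_or_pos r with rfl | hr0
  · simp only [Nat.cast_zero, mul_zero, zero_mul, Real.sqrt_zero, zero_div,
      Real.zero_rpow hβ.ne', add_zero]
    positivity
  have hr' : (0 : ℝ) < r := by exact_mod_cast hr0
  rw [max_eq_left hr0]
  set A := √(n * α / r) with hA
  have hA0 : 0 < A := by positivity
  set Z₁ := ((n : ℝ) * α / (T : ℝ) ^ (2 * β)) ^ (1 / (2 * β + 1)) with hZ₁
  set Z₂ := √((s : ℝ) * α / K) with hZ₂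
  have hZ₁0 : 0 < Z₁ := by positivity
  have hZ₂0 : 0 ≤ Z₂ := Real.sqrt_nonneg _
  have hr1 : r * Z₁ ≤ c := le_trans (by
    rw [temporalRate]; gcongr; linarith) hr
  have hr2 : r * Z₂ ≤ c := le_trans (by
    rw [temporalRate]; gcongr; linarith) hr
  -- Both parts of the bias are written as the noise scale `A = √(n α / r)` times a power of `r Z₁`
  -- or `r Z₂`: the power 1 for the switches, `β + 1 / 2` for smoothness. Hence `r Z ≤ c` makes each
  -- a small multiple of `A`.
  have e1 : √(s * r * (C₂ * (n / K) * (α * Cl) ^ 2)) = Cl * √C₂ * A * (r * Z₂) := by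
    have h1 : s * r * (C₂ * (n / K) * (α * Cl) ^ 2) =
        Cl ^ 2 * (C₂ * ((n * α / r) * ((r : ℝ) ^ 2 * (s * α / K)))) := by
      field_simp
    rw [h1, Real.sqrt_mul (by positivity), Real.sqrt_mul hC₂.le, Real.sqrt_mul (by positivity),
      Real.sqrt_mul (by positivity), Real.sqrt_sq (by linarith), Real.sqrt_sq hr'.le]
    ring
  have e2 : n * (α * ((r : ℝ) / T) ^ β) = A * (r * Z₁) ^ (β + 1 / 2) := by
    have h1 : (r * Z₁) ^ (β + 1 / 2) = √(n * α * r) * ((r : ℝ) / T) ^ β := by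
      rw [Real.mul_rpow hr'.le hZ₁0.le, hZ₁, ← Real.rpow_mul (by positivity),
        show 1 / (2 * β + 1) * (β + 1 / 2) = 1 / 2 by field_simp,
        Real.div_rpow (by positivity) (by positivity), ← Real.rpow_mul hT'.le,
        show 2 * β * (1 / 2) = β by ring, Real.rpow_add hr', Real.div_rpow hr'.le hT'.le,
        ← Real.sqrt_eq_rpow, ← Real.sqrt_eq_rpow, Real.sqrt_mul (by positivity) (r : ℝ)]
      ring
    have h2 : A * √(n * α * r) = n * α := by
      rw [hA, ← Real.sqrt_mul (by positivity),
        show n * α / r * (n * α * r) = (n * α) ^ 2 by field_simp, Real.sqrt_sq (by positivity)]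
    rw [h1]
    linear_combination (-(((r : ℝ) / T) ^ β)) * h2
  have h3 : (r * Z₁) ^ (β + 1 / 2) ≤ √c := by
    calc (r * Z₁) ^ (β + 1 / 2) ≤ c ^ (β + 1 / 2) := by gcongr
      _ ≤ c ^ ((1 : ℝ) / 2) := Real.rpow_le_rpow_of_exponent_ge hc0 hc1 (by linarith)
      _ = √c := (Real.sqrt_eq_rpow c).symm
  have t1 : Wmax * (4 * √(s * r * (C₂ * (n / K) * (α * Cl) ^ 2))) ≤ C₀ / 4 * A := by
    rw [e1]
    calc Wmax * (4 * (Cl * √C₂ * A * (r * Z₂))) ≤ Wmax * (4 * (Cl * √C₂ * A * c)) := by gcongr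
      _ = (16 * Wmax * Cl * √C₂ * c) / 4 * A := by ring
      _ ≤ C₀ / 4 * A := by gcongr
  have t2 : n * (α * (Wmax * L * ((r : ℝ) / T) ^ β)) ≤ C₀ / 4 * A := by
    calc n * (α * (Wmax * L * ((r : ℝ) / T) ^ β)) =
          Wmax * L * (n * (α * ((r : ℝ) / T) ^ β)) := by ring
      _ = Wmax * L * (A * (r * Z₁) ^ (β + 1 / 2)) := by rw [e2]
      _ ≤ Wmax * L * (A * √c) := by gcongr
      _ = (4 * Wmax * L * √c) / 4 * A := by ring
      _ ≤ C₀ / 4 * A := by gcongr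
  linarith

/-- The smoothness part `Z₁` of the rate satisfies `T Z₁ = (n α T) ^ (1 / (2 β + 1)) ≥ min 1 b`, so
a width of order `c / Z` fits into half of the time range when `c` is small. -/
lemma two_mul_le_of_mul_temporalRate_le {n K T s r : ℕ} {α β c b : ℝ} (hn : 0 < n) (hT : 0 < T)
    (hα : 0 < α) (hβ : 0 < β) (hb : b ≤ n * α) (hc : 2 * c ≤ min 1 b)
    (hr : r * temporalRate n K T s α β ≤ c) : 2 * r ≤ T := by
  have hn' : (0 : ℝ) < n := by exact_mod_cast hn
  have hT' : (0 : ℝ) < T := by exact_mod_cast hT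
  have hT1 : (1 : ℝ) ≤ T := by exact_mod_cast hT
  set Z₁ := ((n : ℝ) * α / (T : ℝ) ^ (2 * β)) ^ (1 / (2 * β + 1)) with hZ₁
  have hZ₁0 : 0 < Z₁ := by positivity
  have hr1 : r * Z₁ ≤ c := le_trans (by
    rw [temporalRate]; gcongr; linarith [Real.sqrt_nonneg ((s : ℝ) * α / K)]) hr
  have e : T * Z₁ = (n * α * T) ^ (1 / (2 * β + 1)) := by
    have h1 : n * α / (T : ℝ) ^ (2 * β) = (n * α * T) / (T : ℝ) ^ (2 * β + 1) := by
      rw [Real.rpow_add_one hT'.ne']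
      field_simp
    rw [hZ₁, h1, Real.div_rpow (by positivity) (by positivity), ← Real.rpow_mul hT'.le,
      mul_one_div_cancel (by positivity), Real.rpow_one, mul_div_cancel₀ _ hT'.ne']
  have h2 : min 1 b ≤ T * Z₁ := by
    rw [e]
    refine le_trans ?_ (min_one_le_rpow (by positivity) (by positivity) ?_)
    · refine min_le_min le_rfl (hb.trans ?_)
      exact le_mul_of_one_le_right (by positivity) hT1
    · rw [div_le_one (by positivity)]; linarith
  have h3 : (2 * r) * Z₁ ≤ T * Z₁ := by linarith
  have h4 := le_of_mul_le_mul_right h3 hZ₁0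
  exact_mod_cast h4

/-- The number of widths to be controlled grows like `C₀ ^ 2` times a power of `n`, but for `n ≥ 2`
the failure probability of each decays exponentially in `C₀`. One threshold for `C₀` therefore
serves all `n`. -/
lemma exists_bandwidth_constant {a G p : ℝ} (ha : 0 < a) (hG : 0 ≤ G) :
    ∃ C : ℝ, ∀ C₀, C ≤ C₀ → ∀ n : ℕ, 2 ≤ n →
      G * C₀ ^ 2 * (n : ℝ) ^ p * (n : ℝ) ^ (-(C₀ / a - 1)) ≤ 1 := by
  have hlog2 : 0 < Real.log 2 := Real.log_pos (by norm_num)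
  have h1 : (fun x : ℝ => x ^ 2) =o[Filter.atTop] fun x => Real.exp (Real.log 2 / a * x) :=
    isLittleO_pow_exp_pos_mul_atTop 2 (by positivity)
  set E := Real.exp (-(Real.log 2 * (1 + p))) with hE
  have hE0 : 0 < E := Real.exp_pos _
  have h2 := h1.bound (show 0 < E / (G + 1) by positivity)
  obtain ⟨C, hC⟩ := Filter.eventually_atTop.1 h2
  refine ⟨max C (a * (1 + p)), fun C₀ hC₀ n hn => ?_⟩
  have hn' : (0 : ℝ) < n := by exact_mod_cast (show 0 < n by omega)
  have h3 := hC C₀ ((le_max_left _ _).trans hC₀)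
  rw [Real.norm_of_nonneg (sq_nonneg _), Real.norm_of_nonneg (Real.exp_pos _).le] at h3
  have h4 : 1 + p ≤ C₀ / a := by
    rw [le_div_iff₀ ha, mul_comm]
    exact (le_max_right _ _).trans hC₀
  have h5 : (n : ℝ) ^ p * (n : ℝ) ^ (-(C₀ / a - 1)) ≤ Real.exp (-(Real.log 2 * (C₀ / a - 1 - p))) := by
    rw [← Real.rpow_add hn', Real.rpow_def_of_pos hn']
    apply Real.exp_le_exp.2
    have : Real.log 2 ≤ Real.log n := Real.log_le_log (by norm_num) (by exact_mod_cast hn)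
    nlinarith
  have h6 : Real.exp (-(Real.log 2 * (C₀ / a - 1 - p))) * (E * Real.exp (Real.log 2 / a * C₀)) =
      1 := by
    rw [hE, ← Real.exp_add, ← Real.exp_add, ← Real.exp_zero]
    congr 1
    ring
  have h7 : G * C₀ ^ 2 ≤ E * Real.exp (Real.log 2 / a * C₀) := by
    rw [div_mul_eq_mul_div, le_div_iff₀ (by positivity)] at h3
    nlinarith [sq_nonneg C₀]
  calc _ = (n : ℝ) ^ p * (n : ℝ) ^ (-(C₀ / a - 1)) * (G * C₀ ^ 2) := by ring
    _ ≤ Real.exp (-(Real.log 2 * (C₀ / a - 1 - p))) * (E * Real.exp (Real.log 2 / a * C₀)) := by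
        gcongr
    _ = 1 := h6

/-! Clustering errors -/

lemma sum_sum_sq_sub_blockMean_le {n K : ℕ} {g : Fin n → Fin K} {B : Matrix (Fin K) (Fin K) ℝ}
    (hB : B.IsSymm) {α Cl m : ℝ} (hα : 0 < α) (hCl : 1 ≤ Cl)
    (hspec : ∀ x ∈ spectrum ℝ (α⁻¹ • B), Cl⁻¹ ≤ x ∧ x ≤ Cl)
    (hm : ∀ k, m ≤ (community g k).card) (hmCl : Cl ^ 2 ≤ m)
    {M : Matrix (Fin n) (Fin n) ℝ} (hM : M.IsSymm) {d Δ : ℝ}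
    (hE : specNorm (M - (d • (1 : Matrix (Fin n) (Fin n) ℝ) + offDiag (edgeProb g B))) ≤ Δ)
    {U : Matrix (Fin n) (Fin K) ℝ} (hU : IsLeadingEigenvectors M U) :
    ∑ i, ∑ c, (U i c - blockMean g (fun i => U i c) (g i)) ^ 2 ≤
      K * (4 * Δ ^ 2 / (α * m / Cl ^ 3) ^ 2) := by
  rw [Finset.sum_comm]
  refine (Finset.sum_le_sum fun c _ =>
    sum_sq_sub_blockMean_le hB hα hCl hspec hm hmCl hM hE hU c).trans ?_
  rw [Finset.sum_const, Finset.card_univ, Fintype.card_fin, nsmul_eq_mul]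

lemma six_noiseLevel_sq {C₀ α : ℝ} {n r : ℕ} (hα : 0 < α) :
    (6 * noiseLevel C₀ n α r) ^ 2 = 36 * C₀ ^ 2 * (n * α) * ((max r 1 : ℕ) : ℝ)⁻¹ := by
  unfold noiseLevel
  rw [mul_pow, mul_pow, Real.sq_sqrt (by positivity)]
  ring

lemma errorBound_nonneg {C ε : ℝ} {n K T s : ℕ} {α β : ℝ} (hC : 0 ≤ C) (hε : 0 ≤ ε)
    (hα : 0 < α) : 0 ≤ errorBound C ε n K T s α β := by
  have : 0 ≤ temporalRate n K T s α β := by unfold temporalRate; positivity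
  unfold errorBound
  positivity

/-- The errors at a window width of the optimal order. -/
lemma errors_le_errorBound_of_width {n K T s r : ℕ} {g ghat : Fin n → Fin K}
    {B : Matrix (Fin K) (Fin K) ℝ} {α β ε d Cl C₀ C₁ c CR : ℝ} (hn : 0 < n) (hK : 0 < K)
    (hα : 0 < α) (hε : 0 ≤ ε) (hCl : 1 ≤ Cl) (hC₁ : 0 < C₁) (hc : 0 < c) (hB : B.IsSymm)
    (hspec : ∀ x ∈ spectrum ℝ (α⁻¹ • B), Cl⁻¹ ≤ x ∧ x ≤ Cl)
    (hm : ∀ k, C₁ * ((n : ℝ) / K) ≤ (community g k).card)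
    (hmCl : ∀ k, Cl ^ 2 ≤ ((community g k).card : ℝ))
    {M : Matrix (Fin n) (Fin n) ℝ} (hM : M.IsSymm)
    (hE : specNorm (M - (d • (1 : Matrix (Fin n) (Fin n) ℝ) + offDiag (edgeProb g B))) ≤
      6 * noiseLevel C₀ n α r) (hcl : IsSpectralClustering ε M ghat)
    (hr : ((max r 1 : ℕ) : ℝ)⁻¹ ≤ 2 / c * min 1 (temporalRate n K T s α β))
    (hCR : 4608 * C₀ ^ 2 * Cl ^ 6 / (c * C₁ ^ 2) ≤ CR) :
    communityError ghat g ≤ errorBound CR ε n K T s α β ∧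
      (errorBound CR ε n K T s α β ≤ 1 →
        overallError ghat g ≤ errorBound CR ε n K T s α β * ((maxSize g : ℝ) / n)) := by
  obtain ⟨U, hU, hKM⟩ := hcl
  have hn' : (0 : ℝ) < n := by exact_mod_cast hn
  have hK' : (0 : ℝ) < K := by exact_mod_cast hK
  have hCl0 : 0 < Cl := by linarith
  have hg : ∀ k, 0 < (community g k).card := fun k => by
    have := (show 0 < C₁ * ((n : ℝ) / K) by positivity).trans_le (hm k)
    exact_mod_cast this
  -- Taking `m` as a maximum satisfies the gap condition `Cl ^ 2 ≤ m` and keeps `m ≥ C₁ n / K` for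
  -- the rate.
  have hδ := sum_sum_sq_sub_blockMean_le hB hα hCl hspec
    (m := max (Cl ^ 2) (C₁ * ((n : ℝ) / K))) (fun k => max_le (hmCl k) (hm k))
    (le_max_left _ _) hM hE hU
  set m := max (Cl ^ 2) (C₁ * ((n : ℝ) / K)) with hmdef
  set δ := K * (4 * (6 * noiseLevel C₀ n α r) ^ 2 / (α * m / Cl ^ 3) ^ 2) with hδdef
  have hZ0 : 0 ≤ min 1 (temporalRate n K T s α β) := by
    have : 0 ≤ temporalRate n K T s α β := by unfold temporalRate; positivity
    positivity
  -- The constant is `16 * 4 * 36 * 2 = 4608`: `K`-means, `sin Θ`, the square of six noise levels,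
  -- and the rounding of the width.
  have hle : 16 * (2 + ε) * δ ≤ errorBound CR ε n K T s α β := by
    calc 16 * (2 + ε) * δ ≤ 16 * (2 + ε) * (K * (4 * (36 * C₀ ^ 2 * (n * α) *
          (2 / c * min 1 (temporalRate n K T s α β))) /
            (α * (C₁ * ((n : ℝ) / K)) / Cl ^ 3) ^ 2)) := by
          rw [hδdef, six_noiseLevel_sq hα]
          gcongr
          exact le_max_right _ _
      _ = 4608 * C₀ ^ 2 * Cl ^ 6 / (c * C₁ ^ 2) * (2 + ε) * ((K : ℝ) ^ 3 / ((n : ℝ) * α)) *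
          min 1 (temporalRate n K T s α β) := by
          field_simp
          ring
      _ ≤ errorBound CR ε n K T s α β := by
          unfold errorBound
          gcongr
  refine ⟨(communityError_le_of_isApproxKMeans hK hg hU.1 hε hδ hKM).trans hle, fun h1 => ?_⟩
  -- A bound at most 1 forces `8 (2 + ε) δ ≤ 1 / 2`, so the nontrivial case of `K`-means applies.
  refine (overallError_le_of_isApproxKMeans hg hU.1 hε hδ (by linarith) hKM).trans ?_
  gcongr

/-- There are no errors at very large window widths. -/
lemma errors_le_errorBound_of_large_width {n K T s r : ℕ} {g ghat : Fin n → Fin K}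
    {B : Matrix (Fin K) (Fin K) ℝ} {α β ε d Cl C₀ C₁ D CR : ℝ} (hn : 0 < n) (hK : 0 < K)
    (hα : 0 < α) (hε : 0 ≤ ε) (hCl : 1 ≤ Cl) (hC₁ : 0 < C₁) (hC₀ : 0 < C₀) (hCR : 0 ≤ CR)
    (hB : B.IsSymm)
    (hspec : ∀ x ∈ spectrum ℝ (α⁻¹ • B), Cl⁻¹ ≤ x ∧ x ≤ Cl)
    (hm : ∀ k, C₁ * ((n : ℝ) / K) ≤ (community g k).card)
    (hmCl : ∀ k, Cl ^ 2 ≤ ((community g k).card : ℝ))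
    {M : Matrix (Fin n) (Fin n) ℝ} (hM : M.IsSymm)
    (hE : specNorm (M - (d • (1 : Matrix (Fin n) (Fin n) ℝ) + offDiag (edgeProb g B))) ≤
      6 * noiseLevel C₀ n α r) (hcl : IsSpectralClustering ε M ghat)
    (hεn : ε ≤ n) (hD : 1 ≤ D * (n * α)) (hr : 4000 * C₀ ^ 2 * D * n ^ 6 ≤ r) :
    communityError ghat g ≤ errorBound CR ε n K T s α β ∧
      (errorBound CR ε n K T s α β ≤ 1 →
        overallError ghat g ≤ errorBound CR ε n K T s α β * ((maxSize g : ℝ) / n)) := by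
  obtain ⟨U, hU, hKM⟩ := hcl
  have hn' : (0 : ℝ) < n := by exact_mod_cast hn
  have hn1 : (1 : ℝ) ≤ n := by exact_mod_cast hn
  have hK' : (0 : ℝ) < K := by exact_mod_cast hK
  have hCl0 : 0 < Cl := by linarith
  have hg : ∀ k, 0 < (community g k).card := fun k => by
    have := (show 0 < C₁ * ((n : ℝ) / K) by positivity).trans_le (hm k)
    exact_mod_cast this
  have hKn : (K : ℝ) ≤ n := by
    have hsurj : Function.Surjective g := fun k => by
      obtain ⟨i, hi⟩ := Finset.card_pos.1 (hg k)
      exact ⟨i, (Finset.mem_filter.1 hi).2⟩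
    have := Fintype.card_le_of_surjective g hsurj
    simp only [Fintype.card_fin] at this
    exact_mod_cast this
  have hCln : Cl ^ 2 ≤ n := by
    refine (hmCl ⟨0, hK⟩).trans ?_
    have := Finset.card_le_univ (community g ⟨0, hK⟩)
    rw [Fintype.card_fin] at this
    exact_mod_cast this
  have hD0 : 0 < D := by
    by_contra h
    nlinarith [show 0 < n * α by positivity]
  have hr0 : (0 : ℝ) < r := lt_of_lt_of_le (by positivity) hr
  have hr1 : 1 ≤ r := by exact_mod_cast hr0
  have hδ := sum_sum_sq_sub_blockMean_le hB hα hCl hspec hmCl le_rfl hM hE hU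
  set δ := K * (4 * (6 * noiseLevel C₀ n α r) ^ 2 / (α * Cl ^ 2 / Cl ^ 3) ^ 2) with hδdef
  have hαinv : α⁻¹ ≤ D * n := by
    rw [inv_le_iff_one_le_mul₀ hα]; linarith
  -- The quantities `2 + ε`, `K`, `Cl ^ 2`, `n` and `α⁻¹` are each at most a multiple of `n`, and
  -- one more `n` comes from comparison with `1 / n`. This explains `n ^ 6`; the constant is `8 * 3
  -- * 144 = 3456 < 4000`.
  have hle : 8 * (2 + ε) * δ < (n : ℝ)⁻¹ := by
    calc 8 * (2 + ε) * δ = 8 * (2 + ε) * (K * (144 * C₀ ^ 2 * n * α⁻¹ * Cl ^ 2 / r)) := by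
          rw [hδdef, six_noiseLevel_sq hα, max_eq_left hr1]
          field_simp
          ring
      _ ≤ 8 * (2 * n + n) * (n * (144 * C₀ ^ 2 * n * (D * n) * n / r)) := by
          gcongr
          linarith
      _ = 3456 * C₀ ^ 2 * D * n ^ 6 / r * (n : ℝ)⁻¹ := by
          field_simp
          ring
      _ < 1 * (n : ℝ)⁻¹ := by
          gcongr
          rw [div_lt_one hr0]
          refine lt_of_lt_of_le ?_ hr
          gcongr
          norm_num
      _ = (n : ℝ)⁻¹ := one_mul _
  obtain ⟨h1, h2⟩ := errors_le_zero_of_isApproxKMeans hn hK hg hU.1 hε hδ hle hKM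
  have hΨ : 0 ≤ errorBound CR ε n K T s α β := errorBound_nonneg hCR hε hα
  exact ⟨h1.trans hΨ, fun _ => h2.trans (by positivity)⟩

/-- A community of bounded size forces `K ≥ C₁ n / Cl ^ 2`, so `K ^ 3 / (n α)` is of order `n ^ 2 /
α`. The lower bound `α / n` on the rate cancels `α` and leaves a factor `n ≥ 1`. -/
lemma two_le_errorBound {n K T s : ℕ} {α β ε Cα Cl C₁ CR : ℝ} (hn : 0 < n) (hK : 0 < K)
    (hα : 0 < α) (hαC : α ≤ Cα) (hε : 0 ≤ ε) (hCl : 0 < Cl) (hCα : 1 ≤ Cα) (hC₁ : 0 < C₁)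
    (hsmall : C₁ * ((n : ℝ) / K) ≤ Cl ^ 2) (hZ : α / n ≤ temporalRate n K T s α β)
    (hCR : Cl ^ 6 * Cα / C₁ ^ 3 ≤ CR) : 2 ≤ errorBound CR ε n K T s α β := by
  have hn' : (0 : ℝ) < n := by exact_mod_cast hn
  have hn1 : (1 : ℝ) ≤ n := by exact_mod_cast hn
  have hK' : (0 : ℝ) < K := by exact_mod_cast hK
  have hCR0 : 0 ≤ CR := le_trans (by positivity) hCR
  have hmin : α / (Cα * n) ≤ min 1 (temporalRate n K T s α β) := by
    refine le_min ?_ (le_trans ?_ hZ)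
    · rw [div_le_one (by positivity)]
      nlinarith
    · gcongr
      nlinarith
  have hKle : C₁ * n / Cl ^ 2 ≤ K := by
    rw [div_le_iff₀ (by positivity)]
    rw [← mul_div_assoc, div_le_iff₀ hK'] at hsmall
    linarith
  calc (2 : ℝ) ≤ 2 * n := by linarith
    _ = Cl ^ 6 * Cα / C₁ ^ 3 * (2 + 0) * ((C₁ * n / Cl ^ 2) ^ 3 / (n * α)) *
        (α / (Cα * n)) := by
        field_simp
        ring
    _ ≤ errorBound CR ε n K T s α β := by
        unfold errorBound
        gcongr

lemma inv_max_floor_le {c Z : ℝ} (hc : 0 < c) (hc1 : c ≤ 1) (hZ : 0 < Z) :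
    ((max ⌊c / Z⌋₊ 1 : ℕ) : ℝ)⁻¹ ≤ 2 / c * min 1 Z := by
  have h1 : (1 : ℝ) ≤ (max ⌊c / Z⌋₊ 1 : ℕ) := by exact_mod_cast le_max_right _ _
  have h2 : ((⌊c / Z⌋₊ : ℕ) : ℝ) ≤ (max ⌊c / Z⌋₊ 1 : ℕ) := by exact_mod_cast le_max_left _ _
  have h3 := Nat.lt_floor_add_one (c / Z)
  rcases le_total 1 Z with h | h
  · rw [min_eq_left h, mul_one]
    refine (inv_le_one_of_one_le₀ h1).trans ?_
    rw [le_div_iff₀ hc]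
    linarith
  · rw [min_eq_right h, inv_le_iff_one_le_mul₀ (by linarith), div_mul_eq_mul_div,
      div_mul_eq_mul_div, le_div_iff₀ hc]
    rw [div_lt_iff₀ hZ] at h3
    nlinarith

/-- The errors of clustering based on an estimator with the balanced window width, truncated at
a polynomial level. -/
lemma errors_le_errorBound {n K T s R : ℕ} {g ghat : Fin n → Fin K}
    {B : Matrix (Fin K) (Fin K) ℝ} {α β ε d Cα Cl C₀ C₁ D c CR : ℝ} (hn : 0 < n) (hK : 0 < K)
    (hT : 0 < T) (hα : 0 < α) (hαC : α ≤ Cα) (hε : 0 ≤ ε) (hCα : 1 ≤ Cα) (hCl : 1 ≤ Cl)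
    (hC₁ : 0 < C₁) (hC₀ : 1 ≤ C₀) (hc : 0 < c) (hc1 : c ≤ 1) (hB : B.IsSymm)
    (hspec : ∀ x ∈ spectrum ℝ (α⁻¹ • B), Cl⁻¹ ≤ x ∧ x ≤ Cl)
    (hm : ∀ k, C₁ * ((n : ℝ) / K) ≤ (community g k).card)
    (halt : α / n ≤ temporalRate n K T s α β ∨
      (ε ≤ n ∧ ∀ k, Cl ^ 2 ≤ ((community g k).card : ℝ)))
    {M : Matrix (Fin n) (Fin n) ℝ} (hM : M.IsSymm)
    (hE : specNorm (M - (d • (1 : Matrix (Fin n) (Fin n) ℝ) + offDiag (edgeProb g B))) ≤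
      6 * noiseLevel C₀ n α (min ⌊c / temporalRate n K T s α β⌋₊ R))
    (hcl : IsSpectralClustering ε M ghat)
    (hD : 1 ≤ D * (n * α)) (hR : 4000 * C₀ ^ 2 * D * n ^ 6 ≤ R)
    (hCR : 4608 * C₀ ^ 2 * Cl ^ 6 / (c * C₁ ^ 2) + Cl ^ 6 * Cα / C₁ ^ 3 ≤ CR) :
    communityError ghat g ≤ errorBound CR ε n K T s α β ∧
      (errorBound CR ε n K T s α β ≤ 1 →
        overallError ghat g ≤ errorBound CR ε n K T s α β * ((maxSize g : ℝ) / n)) := by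
  have hn' : (0 : ℝ) < n := by exact_mod_cast hn
  have hn1 : (1 : ℝ) ≤ n := by exact_mod_cast hn
  have hCl0 : 0 < Cl := by linarith
  have hCα0 : 0 < Cα := by linarith
  have hp1 : 0 ≤ 4608 * C₀ ^ 2 * Cl ^ 6 / (c * C₁ ^ 2) := by positivity
  have hp2 : 0 ≤ Cl ^ 6 * Cα / C₁ ^ 3 := by positivity
  have hZ0 := temporalRate_pos (K := K) (s := s) (β := β) hn hT hα
  by_cases hbig : ∀ k, Cl ^ 2 ≤ ((community g k).card : ℝ)
  · rcases le_or_gt ⌊c / temporalRate n K T s α β⌋₊ R with h | h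
    · rw [min_eq_left h] at hE
      exact errors_le_errorBound_of_width hn hK hα hε hCl hC₁ hc hB hspec hm hbig hM hE hcl
        (inv_max_floor_le hc hc1 hZ0) (by linarith)
    · rw [min_eq_right h.le] at hE
      refine errors_le_errorBound_of_large_width hn hK hα hε hCl hC₁ (by linarith) (by linarith)
        hB hspec hm hbig hM hE hcl ?_ hD hR
      -- Truncation cannot occur under the first alternative: `R < c / Z` gives `D n² Z < 1 ≤ D n
      -- α`, hence `Z < α / n`. So `ε ≤ n` is available.
      refine halt.elim (fun hZ => absurd hZ (not_le.2 ?_)) (·.1)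
      have h1 : (R : ℝ) < ⌊c / temporalRate n K T s α β⌋₊ := by exact_mod_cast h
      have h2 := h1.trans_le (Nat.floor_le (by positivity))
      rw [lt_div_iff₀ hZ0] at h2
      have hD0 : 0 < D := by
        by_contra h
        nlinarith [show 0 < n * α by positivity]
      have h3 : D * n ^ 2 ≤ R := by
        refine le_trans ?_ hR
        have h4 : (1 : ℝ) ≤ C₀ ^ 2 := one_le_pow₀ hC₀
        have h5 : (n : ℝ) ^ 2 ≤ n ^ 6 := pow_le_pow_right₀ hn1 (by norm_num)
        calc D * (n : ℝ) ^ 2 ≤ (4000 * C₀ ^ 2) * D * n ^ 6 := by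
              gcongr
              exact le_mul_of_one_le_left hD0.le (by linarith)
          _ = _ := by ring
      rw [lt_div_iff₀ hn']
      have h6 : D * n ^ 2 * temporalRate n K T s α β < 1 := by
        calc _ ≤ R * temporalRate n K T s α β := by gcongr
          _ < c := h2
          _ ≤ 1 := hc1
      have h7 : D * n * (temporalRate n K T s α β * n) < D * n * α := by linarith
      exact lt_of_mul_lt_mul_left h7 (by positivity)
  -- A community with fewer than `Cl ^ 2` nodes contradicts the second alternative, so the first one
  -- holds and the bound is trivial.
  · push Not at hbig
    obtain ⟨k, hk⟩ := hbig
    have h2 := two_le_errorBound (CR := CR) hn hK hα hαC hε hCl0 hCα hC₁ ((hm k).trans hk.le)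
      (halt.elim id fun h => absurd (h.2 k) (not_le.2 hk)) (by linarith)
    exact ⟨(communityError_le_two hK ghat g).trans h2, fun h => absurd h (by linarith)⟩

lemma exists_width_constant {b L Cl C₂ Wmax C₀ : ℝ} (hb : 0 < b) (hL : 0 ≤ L) (hCl : 1 ≤ Cl)
    (hC₂ : 0 < C₂) (hW0 : 0 < Wmax) (hC₀ : 0 < C₀) :
    ∃ c : ℝ, 0 < c ∧ c ≤ 1 ∧ 2 * c ≤ min 1 b ∧ 16 * Wmax * Cl * √C₂ * c ≤ C₀ ∧
      4 * Wmax * L * √c ≤ C₀ := by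
  have hb1 : 0 < min 1 b := lt_min one_pos hb
  have hs : 0 < √C₂ := Real.sqrt_pos.2 hC₂
  have h1 : 0 < C₀ / (16 * Wmax * Cl * √C₂) := by positivity
  have h2 : 0 < C₀ / (4 * Wmax * (L + 1)) := by positivity
  refine ⟨min (min 1 b / 2) (min (C₀ / (16 * Wmax * Cl * √C₂)) ((C₀ / (4 * Wmax * (L + 1))) ^ 2)),
    by positivity, ?_, ?_, ?_, ?_⟩
  · refine (min_le_left _ _).trans ?_
    linarith [min_le_left 1 b]
  · have := min_le_left (min 1 b / 2)
      (min (C₀ / (16 * Wmax * Cl * √C₂)) ((C₀ / (4 * Wmax * (L + 1))) ^ 2))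
    linarith
  · rw [← le_div_iff₀' (by positivity)]
    exact (min_le_right _ _).trans (min_le_left _ _)
  · calc 4 * Wmax * L * √_ ≤ 4 * Wmax * (L + 1) * √((C₀ / (4 * Wmax * (L + 1))) ^ 2) := by
          gcongr
          · linarith
          · exact (min_le_right _ _).trans (min_le_right _ _)
      _ = C₀ := by
          rw [Real.sqrt_sq h2.le]
          field_simp

/-- The probability that the noise level is exceeded at one of polynomially many widths. -/
lemma exists_uniform_noise_tail {τ c₀ Cα Wmax : ℝ} (hc₀ : 0 < c₀) (hCα : 1 ≤ Cα)
    (hW0 : 0 < Wmax) {D : ℝ} (hD : 0 < D) :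
    ∃ Cmin : ℝ, 1 ≤ Cmin ∧ ∀ {Ω : Type*} [MeasurableSpace Ω] {μ : Measure Ω}
      [IsProbabilityMeasure μ] {n K T l : ℕ} {d α : ℝ} {g : ℤ → Fin n → Fin K}
      {B : ℤ → Matrix (Fin K) (Fin K) ℝ} {A : ℤ → Ω → Matrix (Fin n) (Fin n) ℝ}
      {W : Fin 3 → ℕ → ℤ → ℝ},
      IsDynamicNetwork μ T d (fun t => edgeProb (g t) (B t)) A → 2 ≤ n → 0 < α →
      Cα⁻¹ * c₀ * Real.log n / n ≤ α →
      (∀ t ∈ Set.Icc (1 : ℤ) T, (B t).IsSymm ∧ ∀ k k', 0 ≤ B t k k' ∧ B t k k' ≤ 1) →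
      (∀ t ∈ Set.Icc (1 : ℤ) T, maxEntry (B t) ≤ Cα * α) → IsDiscreteKernel l Wmax W →
      ∀ {t : ℤ}, t ∈ Set.Icc (1 : ℤ) T → ∀ {C₀ : ℝ}, Cmin ≤ C₀ → ∀ (S : Finset ℕ),
      (∀ ρ ∈ S, 2 * ρ ≤ T) → S.card ≤ ⌈4000 * C₀ ^ 2 * D * (n : ℝ) ^ 6⌉₊ + 1 →
      μ {ω | ∃ ρ ∈ S, ¬ specNorm (offDiag (smooth W T ρ
        (fun u => A u ω - edgeProb (g u) (B u)) t)) ≤ noiseLevel C₀ n α ρ} ≤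
          ENNReal.ofReal (4 * (n : ℝ) ^ (-τ)) := by
  obtain ⟨a, C, ha, hC, htail⟩ := exists_noise_tail hc₀ hCα hW0
  obtain ⟨C', hC'⟩ := exists_bandwidth_constant (a := a) (G := (4000 * D + 2) * C) (p := 6 + τ) ha
    (by positivity)
  refine ⟨max 1 (max a C'), le_max_left _ _, ?_⟩
  intro Ω _ μ _ n K T l d α g B A W hA hn hα hsparse hB hmax hW t ht C₀ hC₀ S hS hcard
  have hC₀1 : 1 ≤ C₀ := (le_max_left _ _).trans hC₀
  have hC₀a : a ≤ C₀ := ((le_max_left _ _).trans (le_max_right _ _)).trans hC₀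
  have hC₀' : C' ≤ C₀ := ((le_max_right _ _).trans (le_max_right _ _)).trans hC₀
  have hn' : (0 : ℝ) < n := by exact_mod_cast (show 0 < n by omega)
  have hn1 : (1 : ℝ) ≤ n := by exact_mod_cast (show 1 ≤ n by omega)
  refine measure_exists_mem_le S _ (b := fun _ => C * (n : ℝ) ^ (-(C₀ / a - 1)))
    (fun _ _ => by positivity) ?_
    fun ρ hρ => htail hA hn hα hsparse hB hmax hW ht (hS ρ hρ) hC₀a
  rw [Finset.sum_const, nsmul_eq_mul]
  have h1 : (S.card : ℝ) ≤ (4000 * D + 2) * C₀ ^ 2 * (n : ℝ) ^ 6 := by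
    have h2 : (S.card : ℝ) ≤ ⌈4000 * C₀ ^ 2 * D * (n : ℝ) ^ 6⌉₊ + 1 := by exact_mod_cast hcard
    have h3 := Nat.ceil_lt_add_one (show 0 ≤ 4000 * C₀ ^ 2 * D * (n : ℝ) ^ 6 by positivity)
    have h4 : 1 ≤ C₀ ^ 2 * (n : ℝ) ^ 6 :=
      one_le_mul_of_one_le_of_one_le (one_le_pow₀ hC₀1) (one_le_pow₀ hn1)
    linarith
  have h5 := hC' C₀ hC₀' n hn
  rw [Real.rpow_add hn', Real.rpow_ofNat] at h5
  have h6 : (0 : ℝ) < (n : ℝ) ^ (-τ) := by positivity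
  have h7 : (n : ℝ) ^ τ * (n : ℝ) ^ (-τ) = 1 := by
    rw [← Real.rpow_add hn', add_neg_cancel, Real.rpow_zero]
  calc S.card * (C * (n : ℝ) ^ (-(C₀ / a - 1))) ≤
        (4000 * D + 2) * C₀ ^ 2 * (n : ℝ) ^ 6 * (C * (n : ℝ) ^ (-(C₀ / a - 1))) := by gcongr
    _ = (4000 * D + 2) * C * C₀ ^ 2 * (n ^ 6 * (n : ℝ) ^ τ) * (n : ℝ) ^ (-(C₀ / a - 1)) *
          (n : ℝ) ^ (-τ) := by
        linear_combination (-((4000 * D + 2) * C₀ ^ 2 * (n : ℝ) ^ 6 * C *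
          (n : ℝ) ^ (-(C₀ / a - 1)))) * h7
    _ ≤ 1 * (n : ℝ) ^ (-τ) := by gcongr
    _ ≤ 4 * (n : ℝ) ^ (-τ) := by linarith

end DSBM

/-! ### The main theorem -/

theorem corollary1 :
    ∀ (τ c₀ Cα Wmax : ℝ), 0 < τ → 0 < c₀ → 1 ≤ Cα → 0 < Wmax →
    -- the constant of the bandwidth selection: any sufficiently large number
    ∃ Cmin : ℝ, 0 < Cmin ∧ ∀ C₀ : ℝ, Cmin ≤ C₀ →
    ∀ (β L Cl C₁ C₂ : ℝ), 0 < β → 0 ≤ L → 1 ≤ Cl → 0 < C₁ → 0 < C₂ →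
    ∃ CR : ℝ, 0 < CR ∧
    ∀ (n K T s : ℕ) (α ε d : ℝ), 0 < n → 0 < K → 0 < T → 0 < α → 0 ≤ ε →
    Cα⁻¹ * c₀ * Real.log n / n ≤ α →
    ∀ (Ω : Type*) [MeasurableSpace Ω] (μ : Measure Ω) [IsProbabilityMeasure μ]
      -- memberships, connectivity matrices, adjacency matrices and kernels
      (g : ℤ → Fin n → Fin K) (B : ℤ → Matrix (Fin K) (Fin K) ℝ)
      (A : ℤ → Ω → Matrix (Fin n) (Fin n) ℝ) (W : Fin 3 → ℕ → ℤ → ℝ)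
      -- selected window widths and estimated memberships
      (r : ℤ → Ω → ℕ) (ghat : ℤ → Ω → Fin n → Fin K),
    -- the dynamic stochastic block model
    (∀ t ∈ Set.Icc (1 : ℤ) T, (B t).IsSymm ∧ ∀ k k', 0 ≤ B t k k' ∧ B t k k' ≤ 1) →
    DSBM.IsDynamicNetwork μ T d (fun t => DSBM.edgeProb (g t) (B t)) A →
    (∀ t ∈ Set.Icc (1 : ℤ) T,
      Cα⁻¹ * α ≤ DSBM.maxEntry (B t) ∧ DSBM.maxEntry (B t) ≤ Cα * α) →
    -- temporal smoothness, switching rate, eigenvalues, kernels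
    DSBM.SmoothInTime β L T (fun t => α⁻¹ • B t) →
    DSBM.AtMostSwitches s T g →
    (∀ t ∈ Set.Icc (1 : ℤ) T, ∀ x ∈ spectrum ℝ (α⁻¹ • B t), Cl⁻¹ ≤ x ∧ x ≤ Cl) →
    DSBM.IsDiscreteKernel (DSBM.holderOrder β) Wmax W →
    -- balanced communities
    (∀ t ∈ Set.Icc (1 : ℤ) T, ∀ k : Fin K,
      C₁ * ((n : ℝ) / K) ≤ (DSBM.community (g t) k).card ∧
      ((DSBM.community (g t) k).card : ℝ) ≤ C₂ * ((n : ℝ) / K)) →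
    -- exclusion of degenerate cases for which the time horizon is very long
    (α / n ≤ DSBM.temporalRate n K T s α β ∨
      (ε ≤ n ∧ ∀ t ∈ Set.Icc (1 : ℤ) T, ∀ k : Fin K,
        Cl ^ 2 ≤ (DSBM.community (g t) k).card)) →
    -- the window width is the adaptive one or the (nonrandom) oracle one
    ((∀ t ∈ Set.Icc (1 : ℤ) T, ∀ ω, DSBM.IsLepskiWidth C₀ α W T (fun u => A u ω) t (r t ω)) ∨
      (∀ t ∈ Set.Icc (1 : ℤ) T, ∃ ρ : ℕ,
        DSBM.IsOracleWidth C₀ α W T (fun u => DSBM.edgeProb (g u) (B u)) t ρ ∧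
          ∀ ω, r t ω = ρ)) →
    -- the estimated memberships are obtained by approximate spectral clustering
    (∀ t ∈ Set.Icc (1 : ℤ) T, ∀ ω, DSBM.IsSpectralClustering ε
      (DSBM.smooth W T (r t ω) (fun u => A u ω) t) (ghat t ω)) →
    -- local errors
    (∀ t ∈ Set.Icc (1 : ℤ) T,
      μ {ω | ¬ (DSBM.communityError (ghat t ω) (g t) ≤ DSBM.errorBound CR ε n K T s α β ∧
          (DSBM.errorBound CR ε n K T s α β ≤ 1 →
            DSBM.overallError (ghat t ω) (g t) ≤
              DSBM.errorBound CR ε n K T s α β * ((DSBM.maxSize (g t) : ℝ) / n)))} ≤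
        ENNReal.ofReal (4 * (n : ℝ) ^ (-τ))) ∧
    -- global error
    (∀ τ₁ : ℝ, (T : ℝ) ≤ (n : ℝ) ^ τ₁ →
      μ {ω | ¬ (DSBM.maxCommunityError T (fun t => ghat t ω) g ≤
          DSBM.errorBound CR ε n K T s α β)} ≤
        ENNReal.ofReal (4 * (n : ℝ) ^ (-(τ - τ₁)))) := by
  intro τ c₀ Cα Wmax _ hc₀ hCα hW0
  have hCα0 : 0 < Cα := by linarith
  have hlog2 : 0 < Real.log 2 := Real.log_pos (by norm_num)
  -- For `n ≥ 2` the sparsity condition gives `n α ≥ 1 / D`.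
  set D := Cα / (c₀ * Real.log 2) with hDdef
  have hD0 : 0 < D := by positivity
  obtain ⟨Cmin, hCmin, htail⟩ := DSBM.exists_uniform_noise_tail (τ := τ) hc₀ hCα hW0 hD0
  refine ⟨Cmin, by linarith, fun C₀ hC₀ β L Cl C₁ C₂ hβ hL hCl hC₁ hC₂ => ?_⟩
  have hC₀1 : 1 ≤ C₀ := hCmin.trans hC₀
  have hC₀0 : 0 < C₀ := by linarith
  obtain ⟨c, hc0, hc1, hcb, hc2, hc3⟩ :=
    DSBM.exists_width_constant (inv_pos.2 hD0) hL hCl hC₂ hW0 hC₀0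
  refine ⟨4608 * C₀ ^ 2 * Cl ^ 6 / (c * C₁ ^ 2) + Cl ^ 6 * Cα / C₁ ^ 3, by positivity, ?_⟩
  intro n K T s α ε d hn hK hT hα hε hsparse Ω _ μ _ g B A W r ghat hB hA hmax hH hg hspec hW
    hbal halt hwidth hclust
  set CR := 4608 * C₀ ^ 2 * Cl ^ 6 / (c * C₁ ^ 2) + Cl ^ 6 * Cα / C₁ ^ 3 with hCRdef
  have hn' : (0 : ℝ) < n := by exact_mod_cast hn
  have hlocal : ∀ t ∈ Set.Icc (1 : ℤ) T,
      μ {ω | ¬ (DSBM.communityError (ghat t ω) (g t) ≤ DSBM.errorBound CR ε n K T s α β ∧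
          (DSBM.errorBound CR ε n K T s α β ≤ 1 →
            DSBM.overallError (ghat t ω) (g t) ≤
              DSBM.errorBound CR ε n K T s α β * ((DSBM.maxSize (g t) : ℝ) / n)))} ≤
        ENNReal.ofReal (4 * (n : ℝ) ^ (-τ)) := by
    intro t ht
    -- For `n = 1` the asserted probability bound is 4.
    rcases (show n = 1 ∨ 2 ≤ n by omega) with h1 | hn2
    · refine prob_le_one.trans ?_
      rw [h1, Nat.cast_one, Real.one_rpow, ← ENNReal.ofReal_one]
      exact ENNReal.ofReal_le_ofReal (by norm_num)
    have hD : 1 ≤ D * (n * α) := by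
      rw [div_le_iff₀ hn', mul_assoc, inv_mul_le_iff₀ hCα0] at hsparse
      have h2 : Real.log 2 ≤ Real.log n := Real.log_le_log (by norm_num) (by exact_mod_cast hn2)
      have h3 : c₀ * Real.log 2 ≤ c₀ * Real.log n := by gcongr
      rw [hDdef, div_mul_eq_mul_div, le_div_iff₀ (by positivity)]
      linarith
    have hαC : α ≤ Cα := by
      have : Nonempty (Fin K × Fin K) := ⟨(⟨0, hK⟩, ⟨0, hK⟩)⟩
      have h2 : DSBM.maxEntry (B t) ≤ 1 := ciSup_le fun p => by
        rw [abs_of_nonneg ((hB t ht).2 _ _).1]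
        exact ((hB t ht).2 _ _).2
      have h3 := (hmax t ht).1.trans h2
      rwa [inv_mul_le_iff₀ hCα0, mul_one] at h3
    set R := ⌈4000 * C₀ ^ 2 * D * (n : ℝ) ^ 6⌉₊ with hRdef
    -- The reference width balances bias and noise. The cap `R` depends on `C₀`, `D` and `n` only,
    -- which keeps the threshold for `C₀` independent of `β`, `L` and the other constants.
    set r₀ := min ⌊c / DSBM.temporalRate n K T s α β⌋₊ R with hr₀def
    have hZ0 : 0 < DSBM.temporalRate n K T s α β := DSBM.temporalRate_pos hn hT hα
    have hr₀Z : r₀ * DSBM.temporalRate n K T s α β ≤ c := by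
      rw [← le_div_iff₀ hZ0]
      refine le_trans ?_ (Nat.floor_le (by positivity))
      exact_mod_cast min_le_left _ _
    have hr₀T : 2 * r₀ ≤ T := DSBM.two_mul_le_of_mul_temporalRate_le hn hT hα hβ
      (by rwa [inv_le_iff_one_le_mul₀' hD0]) hcb hr₀Z
    have hbias : ∀ ρ ≤ r₀, DSBM.specNorm (DSBM.smooth W T ρ
        (fun u => DSBM.edgeProb (g u) (B u)) t - DSBM.edgeProb (g t) (B t)) ≤
          DSBM.noiseLevel C₀ n α r₀ / 2 := by
      intro ρ hρ
      refine (DSBM.specNorm_bias_le hT hα hβ hL hCl hC₂ (fun t ht => (hB t ht).1) hH hg hspec hW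
        (fun t ht k => (hbal t ht k).2) ht (r := ρ) (by omega)).trans ?_
      refine le_trans ?_ (DSBM.bias_bound_le_noiseLevel hn hK hT hα hβ hL hCl hW0 hC₀0 hc0 hc1
        hc2 hc3 hC₂ hr₀Z)
      gcongr
    have hdet : ∀ ω, 2 * r t ω ≤ T →
        DSBM.specNorm (DSBM.smooth W T (r t ω) (fun u => A u ω) t -
          (d • (1 : Matrix (Fin n) (Fin n) ℝ) + DSBM.offDiag (DSBM.edgeProb (g t) (B t)))) ≤
            6 * DSBM.noiseLevel C₀ n α r₀ →
        DSBM.communityError (ghat t ω) (g t) ≤ DSBM.errorBound CR ε n K T s α β ∧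
          (DSBM.errorBound CR ε n K T s α β ≤ 1 →
            DSBM.overallError (ghat t ω) (g t) ≤
              DSBM.errorBound CR ε n K T s α β * ((DSBM.maxSize (g t) : ℝ) / n)) :=
      fun ω hrT hE => DSBM.errors_le_errorBound hn hK hT hα hαC hε hCα hCl hC₁ hC₀1 hc0 hc1
        (hB t ht).1 (hspec t ht) (fun k => (hbal t ht k).1)
        (halt.imp_right fun h => ⟨h.1, h.2 t ht⟩)
        (DSBM.smooth_adjacency_isSymm W hA ht hrT ω) hE (hclust t ht ω) hD (Nat.le_ceil _) le_rfl
    -- The adaptive width requires the noise bound at all widths up to `r₀ ≤ R`. The oracle width is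
    -- nonrandom, so the noise bound at that single width is enough, even if it exceeds `R`.
    rcases hwidth with hlep | horacle
    · refine le_trans (measure_mono fun ω hω => ?_) (htail hA hn2 hα hsparse hB
        (fun t ht => (hmax t ht).2) hW ht hC₀ ((Finset.range (R + 1)).filter fun ρ => 2 * ρ ≤ T)
        (fun ρ hρ => (Finset.mem_filter.1 hρ).2)
        ((Finset.card_filter_le _ _).trans (Finset.card_range _).le))
      rw [Set.mem_ofPred_eq] at hω ⊢
      by_contra! hno
      refine hω ?_
      obtain ⟨h1, h2⟩ := DSBM.specNorm_lepski_le (d := d) hC₀0.le hα.le hA hW ht hr₀T hbias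
        (fun ρ hρ => hno ρ (Finset.mem_filter.2 ⟨Finset.mem_range.2
          (Nat.lt_succ_of_le (hρ.trans (min_le_right _ _))), by omega⟩)) (hlep t ht ω)
      exact hdet ω h1 h2
    · obtain ⟨ρ, hρ, hρr⟩ := horacle t ht
      refine le_trans (measure_mono fun ω hω => ?_) (htail hA hn2 hα hsparse hB
        (fun t ht => (hmax t ht).2) hW ht hC₀ {ρ}
        (fun x hx => by rw [Finset.mem_singleton.1 hx]; exact hρ.1)
        (by rw [Finset.card_singleton]; omega))
      rw [Set.mem_ofPred_eq] at hω ⊢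
      by_contra! hno
      refine hω (hdet ω ?_ ?_)
      · rw [hρr ω]; exact hρ.1
      · rw [hρr ω]
        exact DSBM.specNorm_oracle_le hC₀0.le hA hW ht hr₀T (hbias r₀ le_rfl)
          (hno ρ (Finset.mem_singleton_self ρ)) hρ
  refine ⟨hlocal, fun τ₁ hτ₁ => ?_⟩
  -- Union bound over the `T ≤ n ^ τ₁` times.
  refine le_trans (measure_mono fun ω hω => ?_) (DSBM.measure_exists_mem_le (Finset.Icc (1 : ℤ) T)
    (fun t ω => ¬ (DSBM.communityError (ghat t ω) (g t) ≤ DSBM.errorBound CR ε n K T s α β ∧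
      (DSBM.errorBound CR ε n K T s α β ≤ 1 →
        DSBM.overallError (ghat t ω) (g t) ≤
          DSBM.errorBound CR ε n K T s α β * ((DSBM.maxSize (g t) : ℝ) / n))))
    (b := fun _ => 4 * (n : ℝ) ^ (-τ)) (fun _ _ => by positivity) ?_
    fun t ht => hlocal t (Finset.mem_Icc.1 ht))
  · rw [Set.mem_ofPred_eq] at hω ⊢
    by_contra hno
    refine hω ?_
    have : Nonempty (Set.Icc (1 : ℤ) T) := ⟨⟨1, le_rfl, by exact_mod_cast hT⟩⟩
    refine ciSup_le fun t => ?_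
    by_contra h
    exact hno ⟨t, Finset.mem_Icc.2 t.2, fun h' => h h'.1⟩
  · rw [Finset.sum_const, Int.card_Icc, nsmul_eq_mul, add_sub_cancel_right, Int.toNat_natCast]
    calc (T : ℝ) * (4 * (n : ℝ) ^ (-τ)) ≤ (n : ℝ) ^ τ₁ * (4 * (n : ℝ) ^ (-τ)) := by gcongr
      _ = 4 * (n : ℝ) ^ (-(τ - τ₁)) := by
        rw [show -(τ - τ₁) = τ₁ + -τ by ring, Real.rpow_add hn']
        ring
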